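/- Let $n\ge 0$, let $Z=(Z_0,\dots,Z_n)$ be the homogeneous coordinates of $\mathbb{CP}^n$, and let $\beta$ be a holomorphic Poisson structure on $\mathbb{CP}^n$, given in homogeneous coordinates by $\Lambda=\sum_{a,b}\overleftarrow{\partial_{Z_a}}\Lambda^{ab}\overrightarrow{\partial_{Z_b}}$, where $\Lambda^{ab}=-\Lambda^{ba}$ are homogeneous polynomials of degree $2$ and $\{f,g\}=\sum\Lambda^{ab}\,\partial_{Z_a}f\,\partial_{Z_b}g$ satisfies the Jacobi identity. Assume that for all $k$, as bidifferential operators (every arrow acting by the Leibniz rule on everything to its left, respectively right, summation over repeated indices), $$\bigl(\overleftarrow{\partial_{Z_{\alpha_1}}}\Lambda^{\alpha_1\beta_1}\overrightarrow{\partial_{Z_{\beta_1}}}\bigr)\cdots\bigl(\overleftarrow{\partial_{Z_{\alpha_k}}}\Lambda^{\alpha_k\beta_k}\overrightarrow{\partial_{Z_{\beta_k}}}\bigr)=\overleftarrow{\partial_{Z_{\alpha_1}}\cdots\partial_{Z_{\alpha_k}}}\;\Lambda^{\alpha_1\beta_1}\cdots\Lambda^{\alpha_k\beta_k}\;\overrightarrow{\partial_{Z_{\beta_1}}\cdots\partial_{Z_{\beta_k}}}.$$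 Let $\tau\in\mathbb C$ (the deformation parameter), and consider the holomorphic Poisson structure $\tau\beta$ with the product $$f\star_\tau g=\sum_{k\ge0}\frac1{k!}\Bigl(\frac{\mu}{2}\Bigr)^k\tau^k\,\Lambda^{\alpha_1\beta_1}\cdots\Lambda^{\alpha_k\beta_k}\,\partial_{Z_{\alpha_1}}\cdots\partial_{Z_{\alpha_k}}f\;\partial_{Z_{\beta_1}}\cdots\partial_{Z_{\beta_k}}g .$$ 1. For a formal parameter $\mu$, $\star_\tau$ is a well-defined bilinear, associative and unital product on formal Laurent series in $\mu$ with coefficients in the local sections, and in the germs, of the structure sheaf $\mathcal O_{\mathbb{CP}^n}$ (more generally of $\bigoplus_d\mathcal O(d)$, compatibly with the grading), and it quantizes $\tau\beta$: $f\star_\tau g=fg+\frac{\mu}{2}\tau\{f,g\}+O(\mu^2)$. 2. Over every commutative $\mathbb C$-algebra $K$ with an element $\mu\in K$ (so with $\mu$ formal or specialized to a scalar), $\star_\tau$ is a $K$-bilinear, associative and unital product on $\prod_k K\otimes H^0(\mathbb{CP}^n,\mathcal O(k))=K[[Z]]$, and it maps homogeneous polynomials of degrees $i$ and $j$ to a homogeneous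 polynomial of degree $i+j$. 3. For every complex symmetric matrix $A$, with $A[Z]=ZA\,{}^tZ$, the evolution equation $\partial_tF=\frac1\mu A[Z]\star_\tau F$, $F(0)=1$, has a unique solution $F(t)=e_{\star_\tau}^{\frac t\mu A[Z]}$ in $\prod_kH^0(\mathbb{CP}^n,\mathcal O(k))[\mu,\mu^{-1}]$ (differentiation coefficientwise), and for all $t$ it is given by the formula below with $tA$ in place of $A$; in particular, for $t=1$, $$e_{\star_\tau}^{\frac1\mu A[Z]}=\det{}^{-1/2}\Bigl(\frac{e^{\tau\Lambda A}+e^{-\tau\Lambda A}}{2}\Bigr)\cdot\exp\Bigl(\frac1\mu\Bigl(\frac{\tau^{-1}\Lambda^{-1}}{\sqrt{-1}}\tan(\sqrt{-1}\,\tau\Lambda A)\Bigr)[Z]\Bigr).$$ Here functions of the matrix $\tau\Lambda A$, whose entries are quadratic polynomials in $Z$, are formal power series in $Z$; $\det^{-1/2}$ is the inverse square root with constant term $1$; and, writing $\tan x=\sum_k t_kx^k$, the matrix $\frac{\tau^{-1}\Lambda^{-1}}{\sqrt{-1}}\tan(\sqrt{-1}\,\tau\Lambda A)$ denotes $\sum_k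 t_{k+1}(\sqrt{-1})^{k}A(\tau\Lambda A)^k$, whose product with $\tau\Lambda$ from the left is $\frac1{\sqrt{-1}}\tan(\sqrt{-1}\,\tau\Lambda A)$. -/

import Mathlib

open scoped LaurentPolynomial

noncomputable section

namespace StarProduct

/-! ### Bidifferential operators -/

/-- The iterated derivative `D_{α 0} (D_{α 1} (⋯ f))`. -/
def iterD {ι R : Type*} (D : ι → R → R) {k : ℕ} (α : Fin k → ι) (f : R) : R :=
  (List.ofFn α).foldr D f

/-- The normally ordered bidifferential operator
`∑ L^{α₁β₁} ⋯ L^{α_kβ_k} (D_{α₁} ⋯ D_{α_k} f) (D_{β₁} ⋯ D_{β_k} g)`. -/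
def bidiff {ι R : Type*} [Fintype ι] [CommRing R] (D : ι → R → R) (L : Matrix ι ι R)
    (k : ℕ) (f g : R) : R :=
  ∑ α : Fin k → ι, ∑ β : Fin k → ι, (∏ i, L (α i) (β i)) * iterD D α f * iterD D β g

/-! ### Holomorphic Poisson structures on projective space, in homogeneous coordinates -/

/-- A bivector `∑ ←∂_a Λ^{ab} →∂_b` in the homogeneous coordinates `Z_0, …, Z_n`. -/
abbrev Bivector (n : ℕ) : Type :=
  Matrix (Fin (n + 1)) (Fin (n + 1)) (MvPolynomial (Fin (n + 1)) ℂ)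

/-- The bracket `{f, g} = ∑ Λ^{ab} ∂_a f ∂_b g`. -/
def bracket {n : ℕ} (Λ : Bivector n) (f g : MvPolynomial (Fin (n + 1)) ℂ) :
    MvPolynomial (Fin (n + 1)) ℂ :=
  ∑ a, ∑ b, Λ a b * MvPolynomial.pderiv a f * MvPolynomial.pderiv b g

/-- `Λ` is a holomorphic Poisson structure of order zero: the coefficients are homogeneous of
degree two (so that functions of degree zero, i.e. functions on projective space, are preserved),
the biderivation is skew-symmetric and satisfies the Jacobi rule. -/
structure IsHolomorphicPoisson {n : ℕ} (Λ : Bivector n) : Prop where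
  homogeneous : ∀ a b, (Λ a b).IsHomogeneous 2
  skew : ∀ a b, Λ a b = -Λ b a
  jacobi : ∀ f g h : MvPolynomial (Fin (n + 1)) ℂ,
    bracket Λ f (bracket Λ g h) + bracket Λ g (bracket Λ h f) + bracket Λ h (bracket Λ f g) = 0

/-! The string `f (←∂Λ→∂) ⋯ (←∂Λ→∂) g` with `k` factors. To let every arrow act by the Leibniz
rule on everything to its left (right), the `k + 2` entries `f, Λ, …, Λ, g` are put in separate
copies (numbered `0, …, k + 1`) of the coordinates, which are identified at the end. -/

/-- The left arrow of the `i`-th factor (`i = 0, …, k - 1`), which sits in copy `i + 1`. -/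
def leftArrow {n k : ℕ} (i : Fin k) (a : Fin (n + 1))
    (P : MvPolynomial (Fin (k + 2) × Fin (n + 1)) ℂ) :
    MvPolynomial (Fin (k + 2) × Fin (n + 1)) ℂ :=
  ∑ j : Fin (k + 2), if (j : ℕ) < (i : ℕ) + 1 then MvPolynomial.pderiv (j, a) P else 0

/-- The right arrow of the `i`-th factor. -/
def rightArrow {n k : ℕ} (i : Fin k) (b : Fin (n + 1))
    (P : MvPolynomial (Fin (k + 2) × Fin (n + 1)) ℂ) :
    MvPolynomial (Fin (k + 2) × Fin (n + 1)) ℂ :=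
  ∑ j : Fin (k + 2), if (i : ℕ) + 1 < (j : ℕ) then MvPolynomial.pderiv (j, b) P else 0

/-- The polynomial `p`, written in the `j`-th copy of the coordinates. -/
def inCopy {n k : ℕ} (j : Fin (k + 2)) (p : MvPolynomial (Fin (n + 1)) ℂ) :
    MvPolynomial (Fin (k + 2) × Fin (n + 1)) ℂ :=
  MvPolynomial.rename (fun a => (j, a)) p

/-- `f (←∂_{α₁} Λ^{α₁β₁} →∂_{β₁}) ⋯ (←∂_{α_k} Λ^{α_kβ_k} →∂_{β_k}) g`, summed over all indices. -/
def arrowString {n : ℕ} (Λ : Bivector n) (k : ℕ) (f g : MvPolynomial (Fin (n + 1)) ℂ) :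
    MvPolynomial (Fin (n + 1)) ℂ :=
  ∑ α : Fin k → Fin (n + 1), ∑ β : Fin k → Fin (n + 1),
    MvPolynomial.rename Prod.snd
      ((List.finRange k).foldr (fun i P => leftArrow i (α i) (rightArrow i (β i) P))
        (inCopy 0 f * (∏ i : Fin k, inCopy i.succ.castSucc (Λ (α i) (β i)))
          * inCopy (Fin.last (k + 1)) g))

/-- The condition that the powers of `←∂_α Λ^{αβ} →∂_β` are equal to their normally ordered forms. -/
def LambdaRelation {n : ℕ} (Λ : Bivector n) : Prop :=
  ∀ (k : ℕ) (f g : MvPolynomial (Fin (n + 1)) ℂ),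
    arrowString Λ k f g = bidiff (fun a => MvPolynomial.pderiv a) Λ k f g

/-! ### The star product of local holomorphic sections and germs -/

/-- The cone in `ℂ^{n+1} ∖ {0}` over a subset of `ℂP^n`. -/
def cone {n : ℕ} (S : Set (Projectivization ℂ (Fin (n + 1) → ℂ))) : Set (Fin (n + 1) → ℂ) :=
  {z | ∃ hz : z ≠ 0, Projectivization.mk ℂ z hz ∈ S}

/-- `f` represents a holomorphic section of `𝒪(d)` over `W`: it is holomorphic on the cone over `W`
and homogeneous of degree `d` there. For `d = 0` this is a section of the structure sheaf. -/
def IsSection {n : ℕ} (W : Set (Projectivization ℂ (Fin (n + 1) → ℂ))) (d : ℤ)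
    (f : (Fin (n + 1) → ℂ) → ℂ) : Prop :=
  AnalyticOnNhd ℂ f (cone W) ∧ ∀ z ∈ cone W, ∀ c : ℂ, c ≠ 0 → f (c • z) = c ^ d * f z

/-- `f = ∑ μ^m f_m` is a formal Laurent series in `μ` whose coefficients are holomorphic sections
of `𝒪(d)` over neighbourhoods of `S` in `ℂP^n` (a subset of `ℂP^n` is open iff its cone is). If `S`
is open, these are sections over `S`; if `S = {p}`, they represent germs at `p`. -/
def IsFormalSection {n : ℕ} (S : Set (Projectivization ℂ (Fin (n + 1) → ℂ))) (d : ℤ)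
    (f : ℤ → (Fin (n + 1) → ℂ) → ℂ) : Prop :=
  (∀ m, ∃ W, S ⊆ W ∧ IsOpen (cone W) ∧ IsSection W d (f m)) ∧ ∃ N : ℤ, ∀ m < N, f m = 0

/-- Equality over `S`: every coefficient agrees near the cone over `S`. If `S` is open this is
equality over `S`; if `S = {p}` it is equality of germs at `p`. -/
def EqNear {n : ℕ} (S : Set (Projectivization ℂ (Fin (n + 1) → ℂ)))
    (f g : ℤ → (Fin (n + 1) → ℂ) → ℂ) : Prop :=
  ∀ m, ∀ᶠ z in nhdsSet (cone S), f m z = g m z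

/-- The formal series with constant term `a` and no other term. -/
def constSeries {n : ℕ} (a : (Fin (n + 1) → ℂ) → ℂ) : ℤ → (Fin (n + 1) → ℂ) → ℂ :=
  fun m => if m = 0 then a else 0

/-- The holomorphic partial derivative in the direction of `Z_a`. -/
def partialD {n : ℕ} (a : Fin (n + 1)) (f : (Fin (n + 1) → ℂ) → ℂ) : (Fin (n + 1) → ℂ) → ℂ :=
  fun z => fderiv ℂ f z (Pi.single a 1)

/-- The coefficients of `Λ` as functions. -/
def coeffFun {n : ℕ} (Λ : Bivector n) :
    Matrix (Fin (n + 1)) (Fin (n + 1)) ((Fin (n + 1) → ℂ) → ℂ) :=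
  fun a b z => MvPolynomial.eval z (Λ a b)

/-- `f ⋆ g = ∑_k (1/k!) (μ/2)^k Λ^{α₁β₁} ⋯ Λ^{α_kβ_k} ∂_{α₁⋯α_k} f ∂_{β₁⋯β_k} g` for formal Laurent
series in `μ`; the index `p = (i, k)` stands for the contribution of `f_i` and `g_{m-i-k}` to the
coefficient of `μ^m`. -/
def sectionStar {n : ℕ} (Λ : Bivector n) (f g : ℤ → (Fin (n + 1) → ℂ) → ℂ) :
    ℤ → (Fin (n + 1) → ℂ) → ℂ :=
  fun m => ∑ᶠ p : ℤ × ℕ, ((p.2.factorial : ℂ)⁻¹ * (1 / 2) ^ p.2) •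
    bidiff partialD (coeffFun Λ) p.2 (f p.1) (g (m - p.1 - p.2))

/-- `mul` is a symbol calculus over `S` quantizing `Λ`: it is a well defined, `ℂ`-bilinear,
`μ`-linear, unital and associative product on the formal sections (germs) of `⊕_d 𝒪(d)`,
compatible with the grading (in particular it preserves the structure sheaf `𝒪 = 𝒪(0)`), and
`a ⋆ b = a b + (μ/2) {a, b} + O(μ²)`. -/
structure IsSymbolCalculus {n : ℕ} (Λ : Bivector n)
    (S : Set (Projectivization ℂ (Fin (n + 1) → ℂ)))
    (mul : (ℤ → (Fin (n + 1) → ℂ) → ℂ) → (ℤ → (Fin (n + 1) → ℂ) → ℂ) →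
      ℤ → (Fin (n + 1) → ℂ) → ℂ) : Prop where
  closed : ∀ d e f g, IsFormalSection S d f → IsFormalSection S e g →
    IsFormalSection S (d + e) (mul f g)
  congr : ∀ d e f f' g g', IsFormalSection S d f → IsFormalSection S d f' →
    IsFormalSection S e g → IsFormalSection S e g' → EqNear S f f' → EqNear S g g' →
    EqNear S (mul f g) (mul f' g')
  add_left : ∀ d e f f' g, IsFormalSection S d f → IsFormalSection S d f' →
    IsFormalSection S e g → EqNear S (mul (f + f') g) (mul f g + mul f' g)
  add_right : ∀ d e f g g', IsFormalSection S d f → IsFormalSection S e g →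
    IsFormalSection S e g' → EqNear S (mul f (g + g')) (mul f g + mul f g')
  smul_left : ∀ d e f g (c : ℂ), IsFormalSection S d f → IsFormalSection S e g →
    EqNear S (mul (c • f) g) (c • mul f g)
  smul_right : ∀ d e f g (c : ℂ), IsFormalSection S d f → IsFormalSection S e g →
    EqNear S (mul f (c • g)) (c • mul f g)
  shift_left : ∀ d e f g (j : ℤ), IsFormalSection S d f → IsFormalSection S e g →
    EqNear S (mul (fun m => f (m - j)) g) (fun m => mul f g (m - j))
  shift_right : ∀ d e f g (j : ℤ), IsFormalSection S d f → IsFormalSection S e g →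
    EqNear S (mul f (fun m => g (m - j))) (fun m => mul f g (m - j))
  assoc : ∀ d e l f g h, IsFormalSection S d f → IsFormalSection S e g →
    IsFormalSection S l h → EqNear S (mul (mul f g) h) (mul f (mul g h))
  one_mul : ∀ d f, IsFormalSection S d f → EqNear S (mul (constSeries 1) f) f
  mul_one : ∀ d f, IsFormalSection S d f → EqNear S (mul f (constSeries 1)) f
  coeff_neg : ∀ d e a b, IsFormalSection S d (constSeries a) →
    IsFormalSection S e (constSeries b) → ∀ m < 0, ∀ᶠ z in nhdsSet (cone S),
      mul (constSeries a) (constSeries b) m z = 0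
  coeff_zero : ∀ d e a b, IsFormalSection S d (constSeries a) →
    IsFormalSection S e (constSeries b) → ∀ᶠ z in nhdsSet (cone S),
      mul (constSeries a) (constSeries b) 0 z = a z * b z
  coeff_one : ∀ d e a b, IsFormalSection S d (constSeries a) →
    IsFormalSection S e (constSeries b) → ∀ᶠ z in nhdsSet (cone S),
      mul (constSeries a) (constSeries b) 1 z = (1 / 2) *
        ∑ i, ∑ j, MvPolynomial.eval z (Λ i j) * partialD i a z * partialD j b z

/-! ### The star product of polynomials and of their formal sums

The global sections of `𝒪(k)` on `ℂP^n` are the homogeneous polynomials of degree `k`, and formal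
infinite sums of them are formal power series in `Z`. The coefficients lie in a commutative
`ℂ`-algebra `K` with a distinguished element `μ`: this covers a formal parameter (`K = ℂ[μ, μ⁻¹]`,
for instance) and a parameter specialized to a scalar (`K = ℂ`). -/

/-- `f ⋆ g = ∑_k (1/k!) (μ/2)^k Λ^{α₁β₁} ⋯ Λ^{α_kβ_k} ∂_{α₁⋯α_k} f ∂_{β₁⋯β_k} g`. For `Λ` with
quadratic coefficients, only finitely many `k` contribute to each coefficient in `Z`. -/
def formalStar {n : ℕ} {K : Type*} [CommRing K] [Algebra ℂ K] (Λ : Bivector n) (μ : K)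
    (f g : MvPowerSeries (Fin (n + 1)) K) : MvPowerSeries (Fin (n + 1)) K :=
  fun d => ∑ᶠ k : ℕ, ((k.factorial : ℂ)⁻¹ * (1 / 2) ^ k) • (μ ^ k *
    MvPowerSeries.coeff d (bidiff (fun a => MvPowerSeries.pderiv K a)
      (fun a b => (MvPolynomial.map (algebraMap ℂ K) (Λ a b) : MvPowerSeries (Fin (n + 1)) K))
      k f g))

/-- `mul` is a `K`-bilinear, associative product with unit `1`. -/
structure IsAssociativeProduct (K : Type*) {M : Type*} [CommRing K] [CommRing M] [Module K M]
    (mul : M → M → M) : Prop where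
  add_left : ∀ f f' g, mul (f + f') g = mul f g + mul f' g
  add_right : ∀ f g g', mul f (g + g') = mul f g + mul f g'
  smul_left : ∀ (c : K) f g, mul (c • f) g = c • mul f g
  smul_right : ∀ (c : K) f g, mul f (c • g) = c • mul f g
  assoc : ∀ f g h, mul (mul f g) h = mul f (mul g h)
  one_mul : ∀ f, mul 1 f = f
  mul_one : ∀ f, mul f 1 = f

/-! ### Star exponentials of quadratic forms -/

/-- `A[Z] = Z A ᵗZ`, for a matrix `A` whose entries may depend on `Z`. -/
def quadForm {n : ℕ} {K : Type*} [CommRing K]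
    (A : Matrix (Fin (n + 1)) (Fin (n + 1)) (MvPowerSeries (Fin (n + 1)) K)) :
    MvPowerSeries (Fin (n + 1)) K :=
  ∑ i, ∑ j, MvPowerSeries.X i * A i j * MvPowerSeries.X j

/-- A constant matrix. -/
def constMatrix {n : ℕ} (K : Type*) [CommRing K] [Algebra ℂ K]
    (A : Matrix (Fin (n + 1)) (Fin (n + 1)) ℂ) :
    Matrix (Fin (n + 1)) (Fin (n + 1)) (MvPowerSeries (Fin (n + 1)) K) :=
  A.map fun c => MvPowerSeries.C (algebraMap ℂ K c)

/-- The matrix `Λ` with entries in the formal power series. -/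
def lambdaMatrix {n : ℕ} (Λ : Bivector n) :
    Matrix (Fin (n + 1)) (Fin (n + 1)) (MvPowerSeries (Fin (n + 1)) ℂ) :=
  fun a b => (Λ a b : MvPowerSeries (Fin (n + 1)) ℂ)

/-- The formal parameter `μ` and its inverse, in `ℂ[μ, μ⁻¹]`. -/
def mu : ℂ[T;T⁻¹] := LaurentPolynomial.T 1

/-- The inverse `μ⁻¹` of the formal parameter. -/
def muInv : ℂ[T;T⁻¹] := LaurentPolynomial.T (-1)

/-- `F t` solves the evolution equation `∂_t F = (1/μ) A[Z] ⋆ F`, `F 0 = 1`, where the derivative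
in `t` is taken in every coefficient of `Z` and `μ`. Thus `F t` is the star exponential of
`(t/μ) A[Z]`. -/
def IsStarExponential {n : ℕ} (Λ : Bivector n) (A : Matrix (Fin (n + 1)) (Fin (n + 1)) ℂ)
    (F : ℂ → MvPowerSeries (Fin (n + 1)) ℂ[T;T⁻¹]) : Prop :=
  F 0 = 1 ∧ ∀ (t : ℂ) (d : Fin (n + 1) →₀ ℕ) (m : ℤ),
    HasDerivAt (fun s => (MvPowerSeries.coeff d (F s)).coeff m)
      ((MvPowerSeries.coeff d
        (formalStar Λ mu (muInv • quadForm (constMatrix ℂ[T;T⁻¹] A)) (F t))).coeff m) t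

/-- The value `∑ c_k X^k` of a power series at a matrix `X` of formal power series without
constant terms. -/
def matrixValue {n : ℕ} (c : PowerSeries ℂ)
    (X : Matrix (Fin (n + 1)) (Fin (n + 1)) (MvPowerSeries (Fin (n + 1)) ℂ)) :
    Matrix (Fin (n + 1)) (Fin (n + 1)) (MvPowerSeries (Fin (n + 1)) ℂ) :=
  fun i j d => ∑ᶠ k : ℕ, PowerSeries.coeff k c * MvPowerSeries.coeff d ((X ^ k) i j)

/-- The Taylor series of the tangent at `0`. -/
def tanSeries : PowerSeries ℂ := PowerSeries.sin ℂ * (PowerSeries.cos ℂ)⁻¹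

/-- `(e^{ΛA} + e^{-ΛA}) / 2`. -/
def coshMatrix {n : ℕ} (Λ : Bivector n) (A : Matrix (Fin (n + 1)) (Fin (n + 1)) ℂ) :
    Matrix (Fin (n + 1)) (Fin (n + 1)) (MvPowerSeries (Fin (n + 1)) ℂ) :=
  (1 / 2 : ℂ) • (matrixValue (PowerSeries.exp ℂ) (lambdaMatrix Λ * constMatrix ℂ A) +
    matrixValue (PowerSeries.exp ℂ) (-(lambdaMatrix Λ * constMatrix ℂ A)))

/-- `(Λ⁻¹/√-1) tan(√-1 ΛA)`, where the factor `Λ⁻¹` is cancelled against the first `Λ` in each term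
of the tangent series: with `tan x = ∑ t_k x^k` this is `∑_k t_{k+1} (√-1)^k A (ΛA)^k`. -/
def phaseMatrix {n : ℕ} (Λ : Bivector n) (A : Matrix (Fin (n + 1)) (Fin (n + 1)) ℂ) :
    Matrix (Fin (n + 1)) (Fin (n + 1)) (MvPowerSeries (Fin (n + 1)) ℂ) :=
  constMatrix ℂ A * matrixValue
    (PowerSeries.mk fun k => PowerSeries.coeff (k + 1) tanSeries * Complex.I ^ k)
    (lambdaMatrix Λ * constMatrix ℂ A)

/-- `D = u^{-1/2}`, for a formal power series `u` with constant term `1`. -/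
def IsInvSqrt {n : ℕ} (D u : MvPowerSeries (Fin (n + 1)) ℂ) : Prop :=
  MvPowerSeries.constantCoeff D = 1 ∧ D ^ 2 * u = 1

/-- Formal power series in `Z` as series with coefficients in `ℂ[μ, μ⁻¹]`. -/
def toMu {n : ℕ} (f : MvPowerSeries (Fin (n + 1)) ℂ) : MvPowerSeries (Fin (n + 1)) ℂ[T;T⁻¹] :=
  MvPowerSeries.map (algebraMap ℂ ℂ[T;T⁻¹]) f

/-- `exp((1/μ) Q[Z])`. -/
def expQuad {n : ℕ}
    (Q : Matrix (Fin (n + 1)) (Fin (n + 1)) (MvPowerSeries (Fin (n + 1)) ℂ)) :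
    MvPowerSeries (Fin (n + 1)) ℂ[T;T⁻¹] :=
  (PowerSeries.exp ℂ).subst (muInv • toMu (quadForm Q))

end StarProduct

end

/-! Everything rests on flatness (`IsFlat`): the vector fields `∑_a Λ^{ac} ∂_a` annihilate every
coefficient of `Λ`. Put `T(i,l,j) = ∑_c Λ^{cj} ∂_c Λ^{il}`. The arrow relation of order two, tested
on `Z_i` and `Z_j Z_l`, makes `T` skew in `l, j` (`LambdaRelation.antisymm`), and skewness of `Λ`
makes it skew in `i, l`. So `T` is totally antisymmetric, its cyclic sum is `3 T`, and the Jacobi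
identity forces `T = 0` (`IsHolomorphicPoisson.isFlatBivector`).

Under flatness the coefficients behave like constants for every derivative contracted with `Λ`, and
the product is associative for the same reason as the Moyal product. On three arguments the
contractions of slots 12, 13 and 23 commute, and both bracketings are the exponential of their sum.
`IsFlat.sum_antidiagonal` states this order by order for any commutative algebra with commuting
derivations. It is applied to power series, where the `k`-th term starts in degree `2 k` and all
sums are finite in each degree, and to the ring of holomorphic germs at a point of the cone
(`HolGerm`), from where `laurentStar_assoc` passes to Laurent series in `μ`.

For the exponential, absorb `τ` into `Λ`; let `X = ΛA`, `H_a = ∑_b Λ^{ab} ∂_b`, `q = (1/μ) A[Z]`,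
and let `g` be the closed form for `A`. By flatness `q ⋆ ·` is a differential operator of second
order in the `H_a` (`formalStar_quadForm`), and the `H_a` kill all functions of `X`. The entries of
`X` are quadratic, so half the Euler field sends `f(X)` to `X f'(X)`. With `tanh' = 1 - tanh²` in
the exponent and Jacobi's formula for `det cosh X`, half the Euler field applied to `g` equals `q ⋆
g` (`halfEuler_eq_formalStar`).

This stationary equation contains the evolution equation: `q ⋆ ·` raises degrees by exactly two, so
multiplying the part of degree `2 k` of `g` by `t^k` gives a solution
(`coeff_formalStar_timeScale`). The substitution `Z ↦ s Z` turns the closed form for `A` into the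
one for `s² A`, which identifies the solution at `t = s²`. The same shift of degree gives uniqueness
by induction on the degree. -/

noncomputable section

set_option linter.unusedSectionVars false

namespace StarProduct

/-! ### Associativity of exponential bidifferential products with flat coefficients -/

section Algebra

variable {ι K R : Type*} [Fintype ι] [CommRing K] [CommRing R] [Algebra K R]

lemma iterD_zero (D : ι → R → R) (α : Fin 0 → ι) (f : R) : iterD D α f = f := by
  simp [iterD]

lemma iterD_cons (D : ι → R → R) {k : ℕ} (a : ι) (α : Fin k → ι) (f : R) :
    iterD D (Fin.cons a α : Fin (k + 1) → ι) f = D a (iterD D α f) := by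
  simp [iterD, List.ofFn_succ]

lemma iterD_comm {D : ι → R → R} (hD : ∀ a b f, D a (D b f) = D b (D a f)) {k : ℕ} (a : ι)
    (α : Fin k → ι) (f : R) : iterD D α (D a f) = D a (iterD D α f) := by
  induction k with
  | zero => simp [iterD_zero]
  | succ k ih =>
    rw [← Fin.cons_self_tail α, iterD_cons, iterD_cons, ih, hD]

lemma bidiff_zero (D : ι → R → R) (L : Matrix ι ι R) (f g : R) : bidiff D L 0 f g = f * g := by
  simp [bidiff, iterD_zero]

/-- Splitting off the first entry of both multi-indices gives a recursion in `k`; since the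
derivatives commute, the ones split off may act first. -/
lemma bidiff_succ {D : ι → R → R} (hD : ∀ a b f, D a (D b f) = D b (D a f)) (L : Matrix ι ι R)
    (k : ℕ) (f g : R) :
    bidiff D L (k + 1) f g = ∑ a, ∑ b, L a b * bidiff D L k (D a f) (D b g) := by
  unfold bidiff
  rw [← (Fin.consEquiv fun _ => ι).sum_comp, Fintype.sum_prod_type]
  refine Finset.sum_congr rfl fun a _ => ?_
  simp_rw [← (Fin.consEquiv fun _ : Fin (k + 1) => ι).sum_comp
    (fun β => (∏ i, L _ (β i)) * _ * _), Fintype.sum_prod_type]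
  rw [Finset.sum_comm]
  refine Finset.sum_congr rfl fun b _ => ?_
  rw [Finset.mul_sum]
  refine Finset.sum_congr rfl fun α _ => ?_
  rw [Finset.mul_sum]
  refine Finset.sum_congr rfl fun β _ => ?_
  change (∏ i, L ((Fin.cons a α : Fin (k + 1) → ι) i)
      ((Fin.cons b β : Fin (k + 1) → ι) i)) *
    iterD D (Fin.cons a α : Fin (k + 1) → ι) f * iterD D (Fin.cons b β : Fin (k + 1) → ι) g = _
  simp only [iterD_cons, iterD_comm hD, Fin.prod_univ_succ, Fin.cons_zero, Fin.cons_succ]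
  ring

/-- The bidifferential operators of the transposed matrix have exchanged arguments. -/
lemma bidiff_transpose (D : ι → R → R) (L : Matrix ι ι R) (k : ℕ) (f g : R) :
    bidiff D L.transpose k f g = bidiff D L k g f := by
  unfold bidiff
  rw [Finset.sum_comm]
  refine Finset.sum_congr rfl fun α _ => Finset.sum_congr rfl fun β _ => ?_
  simp only [Matrix.transpose_apply]
  ring

variable (D : ι → Derivation K R R) (L : Matrix ι ι R)

lemma iterD_derivation_add {k : ℕ} (α : Fin k → ι) (f g : R) :
    iterD (fun a => D a) α (f + g) = iterD (fun a => D a) α f + iterD (fun a => D a) α g := by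
  induction k with
  | zero => simp [iterD_zero]
  | succ k ih => rw [← Fin.cons_self_tail α]; simp only [iterD_cons, ih, map_add]

lemma iterD_derivation_smul {k : ℕ} (α : Fin k → ι) (c : K) (f : R) :
    iterD (fun a => D a) α (c • f) = c • iterD (fun a => D a) α f := by
  induction k with
  | zero => simp [iterD_zero]
  | succ k ih => rw [← Fin.cons_self_tail α]; simp only [iterD_cons, ih, Derivation.map_smul]

/-- The bidifferential operator as a bilinear map. -/
def bidiffLin (k : ℕ) : R →ₗ[K] R →ₗ[K] R :=
  LinearMap.mk₂ K (bidiff (fun a => D a) L k)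
    (fun f f' g => by simp [bidiff, iterD_derivation_add, mul_add, add_mul, Finset.sum_add_distrib])
    (fun c f g => by simp [bidiff, iterD_derivation_smul, Finset.smul_sum])
    (fun f g g' => by simp [bidiff, iterD_derivation_add, mul_add, Finset.sum_add_distrib])
    (fun c f g => by simp [bidiff, iterD_derivation_smul, Finset.smul_sum])

@[simp] lemma bidiffLin_apply (k : ℕ) (f g : R) :
    bidiffLin D L k f g = bidiff (fun a => D a) L k f g := rfl

/-- Rewriting with this makes `map_sum`, `map_sub` and `map_zero` available for `bidiff`. -/
lemma bidiff_eq_bidiffLin (k : ℕ) (f g : R) :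
    bidiff (fun a => D a) L k f g = bidiffLin D L k f g := rfl

variable {D L}

/-- The coefficients of `L` are annihilated by the vector fields `∑ₐ L a c ∂ₐ` and `∑ₐ L c a ∂ₐ`. -/
structure IsFlat (D : ι → Derivation K R R) (L : Matrix ι ι R) : Prop where
  comm : ∀ a b f, D a (D b f) = D b (D a f)
  left : ∀ c b d, ∑ a, L a c * D a (L b d) = 0
  right : ∀ c b d, ∑ a, L c a * D a (L b d) = 0

lemma IsFlat.transpose (h : IsFlat D L) : IsFlat D L.transpose :=
  ⟨h.comm, fun c b d => h.right c d b, fun c b d => h.left c d b⟩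

/-- Flat elements can be taken out of the first argument. -/
lemma IsFlat.bidiff_succ' (h : IsFlat D L) (k : ℕ) :
    (∀ r f g : R, (∀ c, ∑ a, L a c * D a r = 0) →
      bidiff (fun a => D a) L k (r * f) g = r * bidiff (fun a => D a) L k f g) ∧
    ∀ f g : R, bidiff (fun a => D a) L (k + 1) f g =
      ∑ b, bidiff (fun a => D a) L k (∑ a, L a b * D a f) (D b g) := by
  induction k with
  | zero =>
    refine ⟨fun r f g _ => by simp [bidiff_zero, mul_assoc], fun f g => ?_⟩
    rw [bidiff_succ h.comm, Finset.sum_comm]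
    simp [bidiff_zero, Finset.sum_mul, mul_assoc]
  | succ k ih =>
    -- The two halves need each other: extracting `r` at order `k + 1` uses the recursion already
    -- known, and the next recursion uses this extraction for `r = L a b`.
    have key : ∀ r f g : R, (∀ c, ∑ a, L a c * D a r = 0) →
      bidiff (fun a => D a) L (k + 1) (r * f) g = r * bidiff (fun a => D a) L (k + 1) f g := by
      intro r f g hr
      rw [ih.2, ih.2, Finset.mul_sum]
      refine Finset.sum_congr rfl fun b _ => ?_
      rw [← ih.1 r _ _ hr]
      congr 1
      have := hr b
      calc ∑ a, L a b * D a (r * f) = ∑ a, (r * (L a b * D a f) + f * (L a b * D a r)) :=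
            Finset.sum_congr rfl fun a _ => by
              rw [Derivation.leibniz]; simp only [smul_eq_mul]; ring
        _ = _ := by rw [Finset.sum_add_distrib, ← Finset.mul_sum, ← Finset.mul_sum, this]; ring
    refine ⟨key, fun f g => ?_⟩
    rw [bidiff_succ h.comm, Finset.sum_comm]
    refine Finset.sum_congr rfl fun b _ => ?_
    rw [bidiff_eq_bidiffLin, map_sum, LinearMap.sum_apply]
    refine Finset.sum_congr rfl fun a _ => ?_
    rw [bidiffLin_apply, key]
    exact fun c => h.left c a b

variable (D L)

/-- The contraction of the first two arguments. -/
def contract₁₂ : Module.End R (R → R → R → R) where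
  toFun φ f g h := ∑ a, ∑ b, L a b * φ (D a f) (D b g) h
  map_add' φ ψ := by ext; simp [mul_add, Finset.sum_add_distrib]
  map_smul' r φ := by ext; simp [Finset.mul_sum, mul_left_comm]

/-- The contraction of the first and the third argument. -/
def contract₁₃ : Module.End R (R → R → R → R) where
  toFun φ f g h := ∑ a, ∑ b, L a b * φ (D a f) g (D b h)
  map_add' φ ψ := by ext; simp [mul_add, Finset.sum_add_distrib]
  map_smul' r φ := by ext; simp [Finset.mul_sum, mul_left_comm]

/-- The contraction of the last two arguments. -/
def contract₂₃ : Module.End R (R → R → R → R) where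
  toFun φ f g h := ∑ a, ∑ b, L a b * φ f (D a g) (D b h)
  map_add' φ ψ := by ext; simp [mul_add, Finset.sum_add_distrib]
  map_smul' r φ := by ext; simp [Finset.mul_sum, mul_left_comm]

variable {D L}

lemma sum_four_swap (φ : ι → ι → ι → ι → R) :
    ∑ a, ∑ b, ∑ c, ∑ d, φ a b c d = ∑ c, ∑ d, ∑ a, ∑ b, φ a b c d := by
  have h1 : ∀ a, ∑ b, ∑ c, ∑ d, φ a b c d = ∑ c, ∑ d, ∑ b, φ a b c d := fun a => by
    rw [Finset.sum_comm]
    exact Finset.sum_congr rfl fun c _ => Finset.sum_comm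
  simp_rw [h1]
  rw [Finset.sum_comm]
  exact Finset.sum_congr rfl fun c _ => Finset.sum_comm

/-- The coefficients stand outside `φ` and are never differentiated, so commuting derivations
suffice here and flatness plays no role. -/
lemma commute_contract₁₂_contract₁₃ (hD : ∀ a b f, D a (D b f) = D b (D a f)) :
    Commute (contract₁₂ D L) (contract₁₃ D L) := by
  refine LinearMap.ext fun φ => funext fun f => funext fun g => funext fun h => ?_
  change ∑ a, ∑ b, L a b * ∑ c, ∑ d, L c d * φ (D c (D a f)) (D b g) (D d h) =
    ∑ c, ∑ d, L c d * ∑ a, ∑ b, L a b * φ (D a (D c f)) (D b g) (D d h)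
  simp_rw [Finset.mul_sum]
  rw [sum_four_swap]
  simp_rw [hD, mul_left_comm]

lemma commute_contract₁₂_contract₂₃ (hD : ∀ a b f, D a (D b f) = D b (D a f)) :
    Commute (contract₁₂ D L) (contract₂₃ D L) := by
  refine LinearMap.ext fun φ => funext fun f => funext fun g => funext fun h => ?_
  change ∑ a, ∑ b, L a b * ∑ c, ∑ d, L c d * φ (D a f) (D c (D b g)) (D d h) =
    ∑ c, ∑ d, L c d * ∑ a, ∑ b, L a b * φ (D a f) (D b (D c g)) (D d h)
  simp_rw [Finset.mul_sum]
  rw [sum_four_swap]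
  simp_rw [hD, mul_left_comm]

lemma commute_contract₁₃_contract₂₃ (hD : ∀ a b f, D a (D b f) = D b (D a f)) :
    Commute (contract₁₃ D L) (contract₂₃ D L) := by
  refine LinearMap.ext fun φ => funext fun f => funext fun g => funext fun h => ?_
  change ∑ a, ∑ b, L a b * ∑ c, ∑ d, L c d * φ (D a f) (D c g) (D d (D b h)) =
    ∑ c, ∑ d, L c d * ∑ a, ∑ b, L a b * φ (D a f) (D c g) (D b (D d h))
  simp_rw [Finset.mul_sum]
  rw [sum_four_swap]
  simp_rw [hD, mul_left_comm]

/-- The operators `∑ₐ L a c ∂ₐ` act on `φ f g` by the Leibniz rule. -/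
def ActsByLeibniz (D : ι → Derivation K R R) (L : Matrix ι ι R) (φ : R → R → R) : Prop :=
  ∀ c f g, ∑ a, L a c * D a (φ f g) = ∑ a, L a c * (φ (D a f) g + φ f (D a g))

/-- When `D a`, contracted with `L a c`, falls on a coefficient `L p q` of the operator, the sum
over `a` vanishes by flatness; only the terms hitting `f` or `g` survive. -/
lemma IsFlat.actsByLeibniz (h : IsFlat D L) (k : ℕ) :
    ActsByLeibniz D L (bidiff (fun a => D a) L k) := by
  induction k with
  | zero =>
    intro c f g
    refine Finset.sum_congr rfl fun a _ => ?_
    simp only [bidiff_zero, Derivation.leibniz, smul_eq_mul]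
    ring
  | succ k ih =>
    intro c f g
    calc ∑ a, L a c * D a (bidiff (fun a => D a) L (k + 1) f g)
        = ∑ a, ∑ p, ∑ q, (L p q * (L a c * D a (bidiff (fun a => D a) L k (D p f) (D q g))) +
            bidiff (fun a => D a) L k (D p f) (D q g) * (L a c * D a (L p q))) := by
          refine Finset.sum_congr rfl fun a _ => ?_
          simp only [bidiff_succ h.comm, map_sum, Derivation.leibniz, smul_eq_mul, Finset.mul_sum]
          refine Finset.sum_congr rfl fun p _ => Finset.sum_congr rfl fun q _ => ?_
          ring
      _ = ∑ p, ∑ q, (L p q * ∑ a, L a c * D a (bidiff (fun a => D a) L k (D p f) (D q g)) +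
            bidiff (fun a => D a) L k (D p f) (D q g) * ∑ a, L a c * D a (L p q)) := by
          rw [Finset.sum_comm]
          refine Finset.sum_congr rfl fun p _ => ?_
          rw [Finset.sum_comm]
          refine Finset.sum_congr rfl fun q _ => ?_
          rw [Finset.sum_add_distrib, Finset.mul_sum, Finset.mul_sum]
      _ = ∑ p, ∑ q, ∑ a, L a c * (L p q * (bidiff (fun a => D a) L k (D p (D a f)) (D q g) +
            bidiff (fun a => D a) L k (D p f) (D q (D a g)))) := by
          refine Finset.sum_congr rfl fun p _ => Finset.sum_congr rfl fun q _ => ?_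
          rw [h.left, mul_zero, add_zero, ih, Finset.mul_sum]
          refine Finset.sum_congr rfl fun a _ => ?_
          rw [h.comm a p, h.comm a q]
          ring
      _ = _ := by
          refine (Finset.sum_congr rfl fun p _ => Finset.sum_comm).trans ?_
          rw [Finset.sum_comm]
          refine Finset.sum_congr rfl fun a _ => ?_
          simp only [bidiff_succ h.comm, Finset.mul_sum, ← Finset.sum_add_distrib, mul_add]

/-- Each left derivative of the outer operator, once contracted with `L`, is distributed over `f`
and `g`, so each of the `l` contractions becomes `contract₁₃ + contract₂₃`. The recursion of
`bidiff_succ'` is the right one because it presents the derivative together with its coefficient,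
the only form that `ActsByLeibniz` controls. -/
lemma IsFlat.bidiff_leibniz (h : IsFlat D L) (l : ℕ) {φ : R → R → R}
    (hφ : ActsByLeibniz D L φ) (f g p : R) :
    bidiff (fun a => D a) L l (φ f g) p =
      ((contract₁₃ D L + contract₂₃ D L) ^ l) (fun f g h => φ f g * h) f g p := by
  induction l generalizing f g p with
  | zero => simp [bidiff_zero]
  | succ l ih =>
    rw [pow_succ', Module.End.mul_apply, (h.bidiff_succ' l).2]
    simp_rw [hφ _ f g, bidiff_eq_bidiffLin, map_sum, LinearMap.sum_apply, bidiffLin_apply]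
    rw [Finset.sum_comm]
    set Φ := ((contract₁₃ D L + contract₂₃ D L) ^ l) (fun f g h => φ f g * h) with hΦ
    change _ = (∑ a, ∑ b, L a b * Φ (D a f) g (D b p)) + ∑ a, ∑ b, L a b * Φ f (D a g) (D b p)
    rw [← Finset.sum_add_distrib]
    refine Finset.sum_congr rfl fun a _ => ?_
    rw [← Finset.sum_add_distrib]
    refine Finset.sum_congr rfl fun b _ => ?_
    -- The coefficient `L a b` is now inside the first argument; flatness takes it out.
    rw [(h.bidiff_succ' l).1 _ _ _ fun c => h.left c a b, bidiff_eq_bidiffLin, map_add,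
      LinearMap.add_apply, bidiffLin_apply, bidiffLin_apply, ih, ih, mul_add]

lemma contract₁₂_pow (hD : ∀ a b f, D a (D b f) = D b (D a f)) (k : ℕ) :
    ((contract₁₂ D L) ^ k) (fun f g h => f * g * h) =
      fun f g h => bidiff (fun a => D a) L k f g * h := by
  induction k with
  | zero => simp [bidiff_zero]
  | succ k ih =>
    rw [pow_succ', Module.End.mul_apply, ih]
    funext f g h
    rw [bidiff_succ hD]
    simp only [Finset.sum_mul, mul_assoc]
    rfl

lemma contract₂₃_pow (hD : ∀ a b f, D a (D b f) = D b (D a f)) (k : ℕ) :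
    ((contract₂₃ D L) ^ k) (fun f g h => f * g * h) =
      fun f g h => f * bidiff (fun a => D a) L k g h := by
  induction k with
  | zero => simp [bidiff_zero, mul_assoc]
  | succ k ih =>
    rw [pow_succ', Module.End.mul_apply, ih]
    funext f g h
    rw [bidiff_succ hD]
    simp only [Finset.mul_sum, mul_left_comm f]
    rfl

lemma IsFlat.bidiff_bidiff_left (h : IsFlat D L) (k l : ℕ) (f g p : R) :
    bidiff (fun a => D a) L l (bidiff (fun a => D a) L k f g) p =
      ((contract₁₃ D L + contract₂₃ D L) ^ l * contract₁₂ D L ^ k) (fun f g h => f * g * h)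
        f g p := by
  rw [h.bidiff_leibniz l (h.actsByLeibniz k), Module.End.mul_apply, contract₁₂_pow h.comm]

/-- Reversal of the three arguments. -/
def reverseArgs (φ : R → R → R → R) : R → R → R → R := fun f g h => φ h g f

lemma reverseArgs_contract (φ : R → R → R → R) :
    reverseArgs ((contract₁₃ D L.transpose + contract₂₃ D L.transpose) φ) =
      (contract₁₃ D L + contract₁₂ D L) (reverseArgs φ) := by
  funext f g h
  exact congrArg₂ (fun x y : R => x + y) Finset.sum_comm Finset.sum_comm

lemma reverseArgs_contract_pow (φ : R → R → R → R) (l : ℕ) :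
    reverseArgs (((contract₁₃ D L.transpose + contract₂₃ D L.transpose) ^ l) φ) =
      ((contract₁₃ D L + contract₁₂ D L) ^ l) (reverseArgs φ) := by
  induction l with
  | zero => simp
  | succ l ih => rw [pow_succ', Module.End.mul_apply, reverseArgs_contract, ih, pow_succ',
      Module.End.mul_apply]

/-- Mirror image of `bidiff_bidiff_left`: transposing `L` exchanges the two arguments, and reversing
the three slots exchanges the roles of `contract₂₃` and `contract₁₂` while `contract₁₃` keeps its
place. -/
lemma IsFlat.bidiff_bidiff_right (h : IsFlat D L) (k l : ℕ) (f g p : R) :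
    bidiff (fun a => D a) L l f (bidiff (fun a => D a) L k g p) =
      ((contract₁₃ D L + contract₁₂ D L) ^ l * contract₂₃ D L ^ k) (fun f g h => f * g * h)
        f g p := by
  rw [← bidiff_transpose, ← bidiff_transpose _ L k,
    h.transpose.bidiff_leibniz l (h.transpose.actsByLeibniz k), Module.End.mul_apply,
    contract₂₃_pow h.comm]
  refine (congrFun (congrFun (congrFun (reverseArgs_contract_pow _ l) f) g) p).trans ?_
  have e : (reverseArgs fun f g h : R => bidiff (fun a => D a) L.transpose k f g * h) =
      fun f g h => f * bidiff (fun a => D a) L k g h := by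
    funext f g p
    simp only [reverseArgs, bidiff_transpose]
    ring
  rw [e]

/-- Associativity of `exp (∑ L a b ∂ₐ ⊗ ∂_b)` in each order. -/
lemma IsFlat.sum_antidiagonal (h : IsFlat D L) (m : ℕ) (f g p : R) :
    ∑ x ∈ Finset.HasAntidiagonal.antidiagonal m, m.choose x.1 •
        bidiff (fun a => D a) L x.2 (bidiff (fun a => D a) L x.1 f g) p =
      ∑ x ∈ Finset.HasAntidiagonal.antidiagonal m, m.choose x.1 •
        bidiff (fun a => D a) L x.2 f (bidiff (fun a => D a) L x.1 g p) := by
  have h12 := commute_contract₁₂_contract₁₃ (L := L) h.comm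
  have h13 := commute_contract₁₂_contract₂₃ (L := L) h.comm
  have h23 := commute_contract₁₃_contract₂₃ (L := L) h.comm
  -- Both sides expand the `m`-th power of the sum of the three contractions by the binomial
  -- theorem, with a different summand split off.
  have e1 := (h12.add_right h13).add_pow' m
  have e2 := (h23.symm.add_right h13.symm).add_pow' m
  rw [show contract₂₃ D L + (contract₁₃ D L + contract₁₂ D L) =
    contract₁₂ D L + (contract₁₃ D L + contract₂₃ D L) by abel, e1] at e2
  have e3 := congrFun (congrFun (congrFun
    (LinearMap.congr_fun e2 (fun f g h : R => f * g * h)) f) g) p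
  simp only [LinearMap.sum_apply, Finset.sum_apply, LinearMap.smul_apply, Pi.smul_apply] at e3
  simp_rw [h.bidiff_bidiff_left, h.bidiff_bidiff_right]
  convert e3 using 4 with x _ x _
  · rw [((h12.add_right h13).pow_pow x.1 x.2).eq]
  · rw [((h23.symm.add_right h13.symm).pow_pow x.1 x.2).eq]

end Algebra

/-! ### Factorial weights and resummation along antidiagonals -/

section Weights

variable {ι K R : Type*} [Fintype ι] [CommRing K] [CommRing R] [Algebra K R]
variable {D : ι → Derivation K R R} {L : Matrix ι ι R}

/-- A sum over a square is a sum over diagonals, if the terms beyond the main diagonal vanish. -/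
lemma sum_range_sum_range_eq_sum_antidiagonal {M : Type*} [AddCommMonoid M] (N : ℕ)
    (φ : ℕ → ℕ → M) (hφ : ∀ k l, N ≤ k + l → φ k l = 0) :
    ∑ k ∈ Finset.range N, ∑ l ∈ Finset.range N, φ k l =
      ∑ m ∈ Finset.range N, ∑ x ∈ Finset.HasAntidiagonal.antidiagonal m, φ x.1 x.2 := by
  rw [← Finset.sum_product', Finset.sum_sigma']
  symm
  refine Finset.sum_of_injOn (fun x => x.2) ?_ ?_ ?_ ?_
  · rintro ⟨m, x⟩ hx ⟨m', x'⟩ hx' h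
    simp only [Finset.coe_sigma, Set.mem_sigma_iff, Finset.mem_coe, Finset.mem_range,
      Finset.HasAntidiagonal.mem_antidiagonal] at hx hx' h
    subst h
    obtain rfl : m = m' := hx.2.symm.trans hx'.2
    rfl
  · rintro ⟨m, x⟩ hx
    simp only [Finset.coe_sigma, Set.mem_sigma_iff, Finset.mem_coe, Finset.mem_range,
      Finset.HasAntidiagonal.mem_antidiagonal] at hx
    simp only [Finset.coe_product, Finset.coe_range, Set.mem_prod, Set.mem_Iio]
    omega
  · rintro ⟨k, l⟩ _ h
    refine hφ k l (not_lt.1 fun hlt => h ⟨⟨k + l, (k, l)⟩, ?_, rfl⟩)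
    simp [hlt]
  · intros; rfl

/-- The weights of an exponential: `w k * w l = binom (k + l) k * w (k + l)`. -/
def IsExpWeight (w : ℕ → K) : Prop :=
  ∀ k l, w k * w l = (k + l).choose k • w (k + l)

lemma IsFlat.sum_antidiagonal_weight (h : IsFlat D L) {w : ℕ → K} (hw : IsExpWeight w) (m : ℕ)
    (f g p : R) :
    ∑ x ∈ Finset.HasAntidiagonal.antidiagonal m, (w x.1 * w x.2) •
        bidiff (fun a => D a) L x.2 (bidiff (fun a => D a) L x.1 f g) p =
      ∑ x ∈ Finset.HasAntidiagonal.antidiagonal m, (w x.1 * w x.2) •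
        bidiff (fun a => D a) L x.2 f (bidiff (fun a => D a) L x.1 g p) := by
  have key : ∀ φ : ℕ × ℕ → R, ∑ x ∈ Finset.HasAntidiagonal.antidiagonal m, (w x.1 * w x.2) • φ x =
      w m • ∑ x ∈ Finset.HasAntidiagonal.antidiagonal m, m.choose x.1 • φ x := by
    intro φ
    rw [Finset.smul_sum]
    refine Finset.sum_congr rfl fun x hx => ?_
    rw [hw, Finset.HasAntidiagonal.mem_antidiagonal.1 hx, smul_assoc, smul_comm]
  rw [key fun x => bidiff (fun a => D a) L x.2 (bidiff (fun a => D a) L x.1 f g) p,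
    key fun x => bidiff (fun a => D a) L x.2 f (bidiff (fun a => D a) L x.1 g p),
    h.sum_antidiagonal]

lemma isExpWeight_inv_factorial {K : Type*} [CommRing K] [Algebra ℂ K] (c : ℂ) (μ : K) :
    IsExpWeight fun k => ((k.factorial : ℂ)⁻¹ * c ^ k) • μ ^ k := by
  intro k l
  rw [smul_mul_smul_comm, ← pow_add, ← Nat.cast_smul_eq_nsmul ℂ, smul_smul]
  congr 1
  have h := Nat.choose_mul_factorial_mul_factorial (Nat.le_add_right k l)
  rw [Nat.add_sub_cancel_left] at h
  have h' : ((k + l).choose k : ℂ) * k.factorial * l.factorial = (k + l).factorial := by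
    exact_mod_cast h
  have h1 : (k.factorial : ℂ) ≠ 0 := by exact_mod_cast k.factorial_ne_zero
  have h2 : (l.factorial : ℂ) ≠ 0 := by exact_mod_cast l.factorial_ne_zero
  have h3 : ((k + l).factorial : ℂ) ≠ 0 := by exact_mod_cast (k + l).factorial_ne_zero
  field_simp
  rw [← h', pow_add]
  ring

end Weights

/-! ### Degree supports of power series -/

section Graded

variable {σ K : Type*} [CommRing K]

/-- All monomials of `f` have their degree in `S`. -/
def SupportedIn (S : Set ℤ) (f : MvPowerSeries σ K) : Prop :=
  ∀ d, MvPowerSeries.coeff d f ≠ 0 → (d.degree : ℤ) ∈ S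

lemma SupportedIn.mono {S T : Set ℤ} {f : MvPowerSeries σ K} (h : SupportedIn S f)
    (hST : S ⊆ T) : SupportedIn T f := fun d hd => hST (h d hd)

lemma SupportedIn.coeff_eq_zero {S : Set ℤ} {f : MvPowerSeries σ K} (h : SupportedIn S f)
    {d : σ →₀ ℕ} (hd : (d.degree : ℤ) ∉ S) : MvPowerSeries.coeff d f = 0 :=
  by_contra fun h' => hd (h d h')

lemma SupportedIn.sum {S : Set ℤ} {κ : Type*} {s : Finset κ} {f : κ → MvPowerSeries σ K}
    (hf : ∀ i ∈ s, SupportedIn S (f i)) : SupportedIn S (∑ i ∈ s, f i) := by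
  intro d hd
  rw [map_sum] at hd
  obtain ⟨i, hi, h⟩ := Finset.exists_ne_zero_of_sum_ne_zero hd
  exact hf i hi d h

lemma SupportedIn.smul {S : Set ℤ} {K₀ : Type*} [CommRing K₀] [Algebra K₀ K] {f : MvPowerSeries σ K}
    (hf : SupportedIn S f) (c : K₀) : SupportedIn S (c • f) := by
  intro d hd
  by_contra h
  apply hd
  change c • (MvPowerSeries.coeff d f) = 0
  rw [hf.coeff_eq_zero h, smul_zero]

open scoped Pointwise in
lemma SupportedIn.mul {S T : Set ℤ} {f g : MvPowerSeries σ K} (hf : SupportedIn S f)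
    (hg : SupportedIn T g) : SupportedIn (S + T) (f * g) := by
  classical
  intro d hd
  rw [MvPowerSeries.coeff_mul] at hd
  obtain ⟨x, hx, h⟩ := Finset.exists_ne_zero_of_sum_ne_zero hd
  rw [← Finset.HasAntidiagonal.mem_antidiagonal.1 hx, map_add, Nat.cast_add]
  exact Set.add_mem_add (hf _ (left_ne_zero_of_mul h)) (hg _ (right_ne_zero_of_mul h))

lemma SupportedIn.pderiv {S : Set ℤ} {f : MvPowerSeries σ K} (hf : SupportedIn S f) (a : σ) :
    SupportedIn {x | x + 1 ∈ S} (MvPowerSeries.pderiv K a f) := by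
  intro d hd
  rw [MvPowerSeries.coeff_pderiv] at hd
  simpa using hf _ (left_ne_zero_of_mul hd)

lemma weight_one_eq_degree (d : σ →₀ ℕ) : Finsupp.weight (1 : σ → ℕ) d = d.degree := by
  rw [Finsupp.degree_eq_weight_one]; rfl

lemma supportedIn_of_isHomogeneous {p : MvPolynomial σ K} {i : ℕ} (hp : p.IsHomogeneous i) :
    SupportedIn {(i : ℤ)} (p : MvPowerSeries σ K) := by
  intro d hd
  rw [MvPolynomial.coeff_coe] at hd
  have := hp hd
  rw [weight_one_eq_degree] at this
  simpa using this

lemma SupportedIn.nonneg (f : MvPowerSeries σ K) : SupportedIn {x | 0 ≤ x} f := by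
  intro d _; simp

variable [Fintype σ] {L : Matrix σ σ (MvPowerSeries σ K)}

lemma pderiv_comm (a b : σ) (f : MvPowerSeries σ K) :
    MvPowerSeries.pderiv K a (MvPowerSeries.pderiv K b f) =
      MvPowerSeries.pderiv K b (MvPowerSeries.pderiv K a f) := by
  classical
  ext d
  simp only [MvPowerSeries.coeff_pderiv]
  rw [add_right_comm]
  by_cases h : a = b
  · subst h; ring
  · simp [h, Ne.symm h]
    ring

-- Each quadratic coefficient restores the two degrees lost to the derivatives, so degrees add as
-- for the ordinary product.
open scoped Pointwise in
lemma SupportedIn.bidiff (hL : ∀ a b, SupportedIn {2} (L a b)) (k : ℕ) {S T : Set ℤ}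
    {f g : MvPowerSeries σ K} (hf : SupportedIn S f) (hg : SupportedIn T g) :
    SupportedIn (S + T) (bidiff (fun a => MvPowerSeries.pderiv K a) L k f g) := by
  induction k generalizing S T f g with
  | zero => rw [bidiff_zero]; exact hf.mul hg
  | succ k ih =>
    rw [bidiff_succ pderiv_comm]
    refine SupportedIn.sum fun a _ => SupportedIn.sum fun b _ => ?_
    refine ((hL a b).mul (ih (hf.pderiv a) (hg.pderiv b))).mono ?_
    rintro _ ⟨u, hu, _, ⟨x, hx, y, hy, rfl⟩, rfl⟩
    obtain rfl : u = 2 := hu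
    exact ⟨x + 1, hx, y + 1, hy, by simp; ring⟩

/-- Each of the `k` quadratic coefficients stands outside all derivatives. This bound, independent
of `f` and `g`, makes the star product of power series a finite sum in every degree. -/
lemma supportedIn_bidiff_order (hL : ∀ a b, SupportedIn {2} (L a b)) (k : ℕ)
    (f g : MvPowerSeries σ K) :
    SupportedIn {x | 2 * (k : ℤ) ≤ x}
      (StarProduct.bidiff (fun a => MvPowerSeries.pderiv K a) L k f g) := by
  induction k generalizing f g with
  | zero => simpa using SupportedIn.nonneg _
  | succ k ih =>
    rw [bidiff_succ pderiv_comm]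
    refine SupportedIn.sum fun a _ => SupportedIn.sum fun b _ => ?_
    refine ((hL a b).mul (ih _ _)).mono ?_
    rintro _ ⟨u, hu, x, hx, rfl⟩
    obtain rfl : u = 2 := hu
    simp only [Set.mem_ofPred_eq] at hx ⊢
    push_cast
    linarith

end Graded

/-! ### The star product of formal power series -/

section Formal

variable {n : ℕ} {K : Type*} [CommRing K] [Algebra ℂ K] {Λ : Bivector n} (μ : K)

/-- The coefficients of `Λ` as power series over `K`. -/
def coeffSeries (K : Type*) [CommRing K] [Algebra ℂ K] (Λ : Bivector n) :
    Matrix (Fin (n + 1)) (Fin (n + 1)) (MvPowerSeries (Fin (n + 1)) K) :=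
  fun a b => (MvPolynomial.map (algebraMap ℂ K) (Λ a b) : MvPowerSeries (Fin (n + 1)) K)

/-- The term of order `k` in the star product of power series. -/
abbrev bidiffSeries (Λ : Bivector n) (k : ℕ) (f g : MvPowerSeries (Fin (n + 1)) K) :
    MvPowerSeries (Fin (n + 1)) K :=
  bidiff (fun a => MvPowerSeries.pderiv K a) (coeffSeries K Λ) k f g

/-- The coefficient `(1/k!) (μ/2)^k`. -/
def starWeight (μ : K) (k : ℕ) : K := ((k.factorial : ℂ)⁻¹ * (1 / 2) ^ k) • μ ^ k

lemma starWeight_zero : starWeight μ 0 = 1 := by simp [starWeight]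

lemma isExpWeight_starWeight : IsExpWeight (starWeight μ) := isExpWeight_inv_factorial (1 / 2) μ

lemma supportedIn_coeffSeries (hΛ : ∀ a b, (Λ a b).IsHomogeneous 2) (a b : Fin (n + 1)) :
    SupportedIn {2} (coeffSeries K Λ a b) := by
  exact supportedIn_of_isHomogeneous ((hΛ a b).map (algebraMap ℂ K))

/-- Flatness of a bivector with polynomial coefficients. -/
def IsFlatBivector (Λ : Bivector n) : Prop :=
  IsFlat (K := ℂ) (fun a : Fin (n + 1) => MvPolynomial.pderiv a) Λ

lemma IsFlatBivector.isFlat_coeffSeries (h : IsFlatBivector Λ) :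
    IsFlat (fun a : Fin (n + 1) => MvPowerSeries.pderiv K a) (coeffSeries K Λ) := by
  have key : ∀ (v : Fin (n + 1) → MvPolynomial (Fin (n + 1)) ℂ) (p : MvPolynomial (Fin (n + 1)) ℂ),
      ∑ a, v a * MvPolynomial.pderiv a p = 0 →
      ∑ a, (MvPolynomial.map (algebraMap ℂ K) (v a) : MvPowerSeries (Fin (n + 1)) K) *
        MvPowerSeries.pderiv K a
          (MvPolynomial.map (algebraMap ℂ K) p : MvPowerSeries (Fin (n + 1)) K) = 0 := by
    intro v p hp
    have := congrArg (fun q => MvPolynomial.coeToMvPowerSeries.ringHom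
      (MvPolynomial.map (algebraMap ℂ K) q)) hp
    simpa [MvPowerSeries.pderiv_coe, MvPolynomial.pderiv_map] using this
  exact ⟨pderiv_comm, fun c b d => key (fun a => Λ a c) _ (h.left c b d),
    fun c b d => key (fun a => Λ c a) _ (h.right c b d)⟩

lemma coeff_bidiffSeries_eq_zero (hΛ : ∀ a b, (Λ a b).IsHomogeneous 2) {k : ℕ}
    {d : Fin (n + 1) →₀ ℕ} (hk : d.degree < 2 * k) (f g : MvPowerSeries (Fin (n + 1)) K) :
    MvPowerSeries.coeff d (bidiffSeries Λ k f g) = 0 :=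
  (supportedIn_bidiff_order (supportedIn_coeffSeries hΛ) k f g).coeff_eq_zero (by
    simp only [Set.mem_ofPred_eq]; omega)

/-- Any cut-off above the degree of `d` catches all nonzero terms; the freedom in `N` allows several
coefficients to share one cut-off. -/
lemma coeff_formalStar (hΛ : ∀ a b, (Λ a b).IsHomogeneous 2) {N : ℕ} {d : Fin (n + 1) →₀ ℕ}
    (hN : d.degree < N) (f g : MvPowerSeries (Fin (n + 1)) K) :
    MvPowerSeries.coeff d (formalStar Λ μ f g) =
      ∑ k ∈ Finset.range N, starWeight μ k * MvPowerSeries.coeff d (bidiffSeries Λ k f g) := by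
  have h : MvPowerSeries.coeff d (formalStar Λ μ f g) = ∑ᶠ k : ℕ,
      starWeight μ k * MvPowerSeries.coeff d (bidiffSeries Λ k f g) :=
    finsum_congr fun k => (smul_mul_assoc _ _ _).symm
  rw [h]
  refine finsum_eq_sum_of_support_subset _ fun k hk => ?_
  simp only [Finset.coe_range, Set.mem_Iio]
  by_contra hlt
  exact hk (by simp only [coeff_bidiffSeries_eq_zero hΛ (show d.degree < 2 * k by omega), mul_zero])

/-- Bidifferential terms do not lower degrees, so a change of `f` from degree `N` on is invisible
below degree `N`. -/
lemma coeff_bidiffSeries_congr_left (hΛ : ∀ a b, (Λ a b).IsHomogeneous 2) {N : ℕ} (k : ℕ)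
    {d : Fin (n + 1) →₀ ℕ} (hN : d.degree < N) {f f' : MvPowerSeries (Fin (n + 1)) K}
    (h : ∀ e : Fin (n + 1) →₀ ℕ, e.degree < N → MvPowerSeries.coeff e f = MvPowerSeries.coeff e f')
    (g : MvPowerSeries (Fin (n + 1)) K) :
    MvPowerSeries.coeff d (bidiffSeries Λ k f g) =
      MvPowerSeries.coeff d (bidiffSeries Λ k f' g) := by
  have hs : SupportedIn {x | (N : ℤ) ≤ x} (f - f') := fun e he => by
    by_contra hlt
    simp only [Set.mem_ofPred_eq, not_le, Nat.cast_lt] at hlt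
    exact he (by rw [map_sub, h e hlt, sub_self])
  have := (hs.bidiff (supportedIn_coeffSeries hΛ) k (SupportedIn.nonneg g)).coeff_eq_zero (d := d)
    (by
      rintro ⟨x, hx, y, hy, hxy⟩
      simp only [Set.mem_ofPred_eq] at hx hy hxy
      omega)
  rw [bidiff_eq_bidiffLin, map_sub, LinearMap.sub_apply, map_sub, sub_eq_zero] at this
  exact this

lemma coeff_bidiffSeries_congr_right (hΛ : ∀ a b, (Λ a b).IsHomogeneous 2) {N : ℕ} (k : ℕ)
    {d : Fin (n + 1) →₀ ℕ} (hN : d.degree < N) {g g' : MvPowerSeries (Fin (n + 1)) K}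
    (h : ∀ e : Fin (n + 1) →₀ ℕ, e.degree < N → MvPowerSeries.coeff e g = MvPowerSeries.coeff e g')
    (f : MvPowerSeries (Fin (n + 1)) K) :
    MvPowerSeries.coeff d (bidiffSeries Λ k f g) =
      MvPowerSeries.coeff d (bidiffSeries Λ k f g') := by
  have hs : SupportedIn {x | (N : ℤ) ≤ x} (g - g') := fun e he => by
    by_contra hlt
    simp only [Set.mem_ofPred_eq, not_le, Nat.cast_lt] at hlt
    exact he (by rw [map_sub, h e hlt, sub_self])
  have := ((SupportedIn.nonneg f).bidiff (supportedIn_coeffSeries hΛ) k hs).coeff_eq_zero (d := d)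
    (by
      rintro ⟨x, hx, y, hy, hxy⟩
      simp only [Set.mem_ofPred_eq] at hx hy hxy
      omega)
  rw [bidiff_eq_bidiffLin, map_sub, map_sub, sub_eq_zero] at this
  exact this

/-- The star product of power series, broken off before the order `N`. -/
def partialStar (Λ : Bivector n) (μ : K) (N : ℕ) (f g : MvPowerSeries (Fin (n + 1)) K) :
    MvPowerSeries (Fin (n + 1)) K :=
  ∑ k ∈ Finset.range N, starWeight μ k • bidiffSeries Λ k f g

lemma coeff_formalStar_eq_partialStar (hΛ : ∀ a b, (Λ a b).IsHomogeneous 2) {N : ℕ}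
    {d : Fin (n + 1) →₀ ℕ} (hN : d.degree < N) (f g : MvPowerSeries (Fin (n + 1)) K) :
    MvPowerSeries.coeff d (formalStar Λ μ f g) =
      MvPowerSeries.coeff d (partialStar Λ μ N f g) := by
  rw [coeff_formalStar μ hΛ hN, partialStar, map_sum]
  simp [bidiffSeries]

/-- Associativity modulo degree `N`: the square of index pairs `(k, l)` is cut down to
antidiagonals, on each of which the flat identity applies. -/
lemma coeff_partialStar_assoc (hΛ : ∀ a b, (Λ a b).IsHomogeneous 2) (hf : IsFlatBivector Λ) {N : ℕ}
    {d : Fin (n + 1) →₀ ℕ} (hN : d.degree < N) (f g h : MvPowerSeries (Fin (n + 1)) K) :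
    MvPowerSeries.coeff d (partialStar Λ μ N (partialStar Λ μ N f g) h) =
      MvPowerSeries.coeff d (partialStar Λ μ N f (partialStar Λ μ N g h)) := by
  have hz : ∀ k (p q : MvPowerSeries (Fin (n + 1)) K), N ≤ 2 * k →
      MvPowerSeries.coeff d (bidiffSeries Λ k p q) = 0 := fun k p q hk =>
    coeff_bidiffSeries_eq_zero hΛ (hN.trans_le hk) p q
  have hz1 : ∀ k (p q : MvPowerSeries (Fin (n + 1)) K), N ≤ 2 * k → ∀ e : Fin (n + 1) →₀ ℕ,
      e.degree < N → MvPowerSeries.coeff e (bidiffSeries Λ k p q) = MvPowerSeries.coeff e 0 :=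
    fun k p q hk e he => coeff_bidiffSeries_eq_zero hΛ (he.trans_le hk) p q
  have hl : MvPowerSeries.coeff d (partialStar Λ μ N (partialStar Λ μ N f g) h) =
      ∑ k ∈ Finset.range N, ∑ l ∈ Finset.range N, (starWeight μ k * starWeight μ l) *
        MvPowerSeries.coeff d (bidiffSeries Λ l (bidiffSeries Λ k f g) h) := by
    rw [Finset.sum_comm]
    simp only [partialStar, bidiff_eq_bidiffLin, map_sum, LinearMap.sum_apply, map_smul,
      LinearMap.smul_apply, Finset.smul_sum, smul_smul, smul_eq_mul]
    exact Finset.sum_congr rfl fun k _ => Finset.sum_congr rfl fun l _ => by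
      rw [mul_comm (starWeight μ l)]
  have hr : MvPowerSeries.coeff d (partialStar Λ μ N f (partialStar Λ μ N g h)) =
      ∑ k ∈ Finset.range N, ∑ l ∈ Finset.range N, (starWeight μ k * starWeight μ l) *
        MvPowerSeries.coeff d (bidiffSeries Λ l f (bidiffSeries Λ k g h)) := by
    rw [Finset.sum_comm]
    simp only [partialStar, bidiff_eq_bidiffLin, map_sum, map_smul, Finset.smul_sum, smul_smul,
      smul_eq_mul]
    exact Finset.sum_congr rfl fun k _ => Finset.sum_congr rfl fun l _ => by
      rw [mul_comm (starWeight μ l)]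
  rw [hl, hr, sum_range_sum_range_eq_sum_antidiagonal, sum_range_sum_range_eq_sum_antidiagonal]
  · refine Finset.sum_congr rfl fun m _ => ?_
    have := congrArg (MvPowerSeries.coeff d)
      ((hf.isFlat_coeffSeries (K := K)).sum_antidiagonal_weight
      (isExpWeight_starWeight μ) m f g h)
    simpa [map_sum] using this
  · intro k l hkl
    -- If `k + l ≥ N`, one index is at least `N / 2`, and then the outer or the inner term starts in
    -- degree `N` at the earliest.
    rcases (by omega : N ≤ 2 * l ∨ N ≤ 2 * k) with h' | h'
    · rw [hz _ _ _ h', mul_zero]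
    · rw [coeff_bidiffSeries_congr_right hΛ l hN (hz1 k g h h'), bidiffSeries, bidiff_eq_bidiffLin,
        map_zero, map_zero, mul_zero]
  · intro k l hkl
    rcases (by omega : N ≤ 2 * l ∨ N ≤ 2 * k) with h' | h'
    · rw [hz _ _ _ h', mul_zero]
    · rw [coeff_bidiffSeries_congr_left hΛ l hN (hz1 k f g h'), bidiffSeries, bidiff_eq_bidiffLin,
        map_zero, LinearMap.zero_apply, map_zero, mul_zero]

lemma bidiffSeries_one_left (k : ℕ) (g : MvPowerSeries (Fin (n + 1)) K) :
    bidiffSeries Λ (k + 1) 1 g = 0 := by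
  rw [bidiffSeries, bidiff_succ pderiv_comm]
  refine Finset.sum_eq_zero fun a _ => Finset.sum_eq_zero fun b _ => ?_
  rw [Derivation.map_one_eq_zero, bidiff_eq_bidiffLin, map_zero, LinearMap.zero_apply, mul_zero]

lemma bidiffSeries_one_right (k : ℕ) (g : MvPowerSeries (Fin (n + 1)) K) :
    bidiffSeries Λ (k + 1) g 1 = 0 := by
  rw [bidiffSeries, bidiff_succ pderiv_comm]
  refine Finset.sum_eq_zero fun a _ => Finset.sum_eq_zero fun b _ => ?_
  rw [Derivation.map_one_eq_zero, bidiff_eq_bidiffLin, map_zero, mul_zero]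

theorem isAssociativeProduct_formalStar (hΛ : ∀ a b, (Λ a b).IsHomogeneous 2)
    (hf : IsFlatBivector Λ) :
    IsAssociativeProduct K (formalStar Λ μ : MvPowerSeries (Fin (n + 1)) K →
      MvPowerSeries (Fin (n + 1)) K → MvPowerSeries (Fin (n + 1)) K) where
  add_left f f' g := by
    ext d
    simp only [map_add, coeff_formalStar μ hΛ d.degree.lt_succ_self, bidiffSeries,
      bidiff_eq_bidiffLin, LinearMap.add_apply, mul_add, Finset.sum_add_distrib]
  add_right f g g' := by
    ext d
    simp only [map_add, coeff_formalStar μ hΛ d.degree.lt_succ_self, bidiffSeries,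
      bidiff_eq_bidiffLin, mul_add, Finset.sum_add_distrib]
  smul_left c f g := by
    ext d
    simp only [map_smul, coeff_formalStar μ hΛ d.degree.lt_succ_self, bidiffSeries,
      bidiff_eq_bidiffLin, LinearMap.smul_apply, smul_eq_mul, mul_left_comm _ c, Finset.mul_sum]
  smul_right c f g := by
    ext d
    simp only [map_smul, coeff_formalStar μ hΛ d.degree.lt_succ_self, bidiffSeries,
      bidiff_eq_bidiffLin, smul_eq_mul, mul_left_comm _ c, Finset.mul_sum]
  assoc f g h := by
    ext d
    have hd := d.degree.lt_succ_self
    rw [coeff_formalStar_eq_partialStar μ hΛ hd, coeff_formalStar_eq_partialStar μ hΛ hd,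
      partialStar, partialStar, map_sum, map_sum]
    simp only [map_smul]
    -- Only degrees up to that of `d` matter in the inner products, which may therefore be replaced
    -- by their truncations.
    simp_rw [fun k => coeff_bidiffSeries_congr_left (K := K) hΛ k hd
      (fun e he => coeff_formalStar_eq_partialStar μ hΛ he f g) h,
      fun k => coeff_bidiffSeries_congr_right (K := K) hΛ k hd
      (fun e he => coeff_formalStar_eq_partialStar μ hΛ he g h) f]
    have := coeff_partialStar_assoc μ hΛ hf hd f g h
    rw [partialStar.eq_1 Λ μ _ _ h, partialStar.eq_1 Λ μ _ f (partialStar _ _ _ _ _), map_sum,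
      map_sum] at this
    simpa only [map_smul] using this
  one_mul f := by
    ext d
    rw [coeff_formalStar μ hΛ d.degree.lt_succ_self, Finset.sum_range_succ', Finset.sum_eq_zero]
    · simp [starWeight_zero, bidiff_zero]
    · intro k _
      rw [bidiffSeries_one_left]; simp
  mul_one f := by
    ext d
    rw [coeff_formalStar μ hΛ d.degree.lt_succ_self, Finset.sum_range_succ', Finset.sum_eq_zero]
    · simp [starWeight_zero, bidiff_zero]
    · intro k _
      rw [bidiffSeries_one_right]; simp

/-- For homogeneous `f` the product shifts degrees by exactly `i`. Degrees are integers, so that the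
subtraction `x - i` does not truncate. -/
lemma SupportedIn.formalStar (hΛ : ∀ a b, (Λ a b).IsHomogeneous 2) {i : ℤ} {S : Set ℤ}
    {f g : MvPowerSeries (Fin (n + 1)) K} (hf : SupportedIn {i} f) (hg : SupportedIn S g) :
    SupportedIn {x | x - i ∈ S} (formalStar Λ μ f g) := by
  intro d hd
  rw [coeff_formalStar μ hΛ d.degree.lt_succ_self] at hd
  obtain ⟨k, _, h⟩ := Finset.exists_ne_zero_of_sum_ne_zero hd
  obtain ⟨x, rfl, y, hy, h⟩ := (hf.bidiff (supportedIn_coeffSeries hΛ) k hg) d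
    (right_ne_zero_of_mul h)
  simpa [← h] using hy

/-- A power series all of whose monomials have degree `i` is a homogeneous polynomial. -/
lemma SupportedIn.exists_isHomogeneous {i : ℕ} {f : MvPowerSeries (Fin (n + 1)) K}
    (hf : SupportedIn {(i : ℤ)} f) :
    ∃ r : MvPolynomial (Fin (n + 1)) K, r.IsHomogeneous i ∧
      (r : MvPowerSeries (Fin (n + 1)) K) = f := by
  have hfin : (Function.support fun d => MvPowerSeries.coeff d f).Finite :=
    (Finsupp.finite_of_degree_le i).subset fun d hd => by
      have := hf d hd
      simp only [Set.mem_singleton_iff, Nat.cast_inj] at this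
      exact this.le
  set r : MvPolynomial (Fin (n + 1)) K :=
    ∑ d ∈ hfin.toFinset, MvPolynomial.monomial d (MvPowerSeries.coeff d f) with hr
  have key : ∀ d, MvPolynomial.coeff d r = MvPowerSeries.coeff d f := by
    intro d
    rw [hr, MvPolynomial.coeff_sum]
    simp only [MvPolynomial.coeff_monomial, Finset.sum_ite_eq', Set.Finite.mem_toFinset,
      Function.mem_support]
    split_ifs with h
    · rfl
    · exact (by simpa using h : MvPowerSeries.coeff d f = 0).symm
  refine ⟨r, fun d hd => ?_, ?_⟩
  · rw [weight_one_eq_degree]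
    rw [key] at hd
    simpa using hf d hd
  · ext d
    rw [MvPolynomial.coeff_coe, key]

lemma exists_isHomogeneous_formalStar (hΛ : ∀ a b, (Λ a b).IsHomogeneous 2) {i j : ℕ}
    {p q : MvPolynomial (Fin (n + 1)) K} (hp : p.IsHomogeneous i) (hq : q.IsHomogeneous j) :
    ∃ r : MvPolynomial (Fin (n + 1)) K, r.IsHomogeneous (i + j) ∧
      (r : MvPowerSeries (Fin (n + 1)) K) =
        StarProduct.formalStar Λ μ (p : MvPowerSeries (Fin (n + 1)) K) q := by
  refine SupportedIn.exists_isHomogeneous (((supportedIn_of_isHomogeneous hp).formalStar μ hΛ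
    (supportedIn_of_isHomogeneous hq)).mono fun x hx => ?_)
  simp only [Set.mem_singleton_iff, Set.mem_ofPred_eq] at hx ⊢
  push_cast
  linarith

end Formal

/-! ### Flatness from the arrow relation and the Jacobi identity -/

section Flatness

variable {n : ℕ} {Λ : Bivector n}

open MvPolynomial in
lemma pderiv_inCopy {k : ℕ} (j j' : Fin (k + 2)) (a : Fin (n + 1))
    (p : MvPolynomial (Fin (n + 1)) ℂ) :
    pderiv (j, a) (inCopy j' p) = if j = j' then inCopy j' (pderiv a p) else 0 := by
  split_ifs with h
  · subst h
    exact pderiv_rename (fun x y h => by simpa using h) a p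
  · apply pderiv_eq_zero_of_notMem_vars
    intro hm
    have := vars_rename _ _ hm
    simp at this
    exact h this.2.symm

lemma rename_snd_inCopy {k : ℕ} (j : Fin (k + 2)) (p : MvPolynomial (Fin (n + 1)) ℂ) :
    MvPolynomial.rename Prod.snd (inCopy j p) = p := by
  rw [inCopy, MvPolynomial.rename_rename]
  exact MvPolynomial.rename_id_apply p

-- The left arrow of the second factor acts on `f` or on the first coefficient, and the right arrow
-- of the first factor acts on `g` or on the second coefficient: two choices each, hence four terms.
open MvPolynomial in
lemma arrowString_two (f g : MvPolynomial (Fin (n + 1)) ℂ) :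
    arrowString Λ 2 f g = ∑ a, ∑ c, ∑ b, ∑ d,
      (pderiv a (pderiv c f) * Λ a b * Λ c d * pderiv b (pderiv d g) +
        pderiv a f * pderiv c (Λ a b) * Λ c d * pderiv b (pderiv d g) +
        pderiv a (pderiv c f) * Λ a b * pderiv b (Λ c d) * pderiv d g +
        pderiv a f * pderiv c (Λ a b) * pderiv b (Λ c d) * pderiv d g) := by
  unfold arrowString
  rw [← (finTwoArrowEquiv (Fin (n + 1))).symm.sum_comp, Fintype.sum_prod_type]
  refine Finset.sum_congr rfl fun a _ => Finset.sum_congr rfl fun c _ => ?_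
  rw [← (finTwoArrowEquiv (Fin (n + 1))).symm.sum_comp, Fintype.sum_prod_type]
  refine Finset.sum_congr rfl fun b _ => Finset.sum_congr rfl fun d _ => ?_
  simp [List.finRange_succ, leftArrow, rightArrow, Fin.sum_univ_succ, pderiv_inCopy, 
    Derivation.leibniz, rename_snd_inCopy]
  ring

lemma pderiv_poly_comm {σ : Type*} [Fintype σ] (a b : σ) (f : MvPolynomial σ ℂ) :
    MvPolynomial.pderiv a (MvPolynomial.pderiv b f) =
      MvPolynomial.pderiv b (MvPolynomial.pderiv a f) := by
  apply MvPolynomial.coe_injective σ ℂ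
  simp only [← MvPowerSeries.pderiv_coe]
  exact pderiv_comm a b _

open MvPolynomial in
/-- The relation of order two, for functions `Z_i` and `Z_j Z_l`. -/
lemma LambdaRelation.antisymm (h : LambdaRelation Λ) (i j l : Fin (n + 1)) :
    ∑ c, Λ c j * pderiv c (Λ i l) + ∑ c, Λ c l * pderiv c (Λ i j) = 0 := by
  have hX : ∀ a c : Fin (n + 1), pderiv a (pderiv c (X i : MvPolynomial (Fin (n + 1)) ℂ)) = 0 := by
    intro a c
    rw [pderiv_X]
    rcases eq_or_ne c i with rfl | hc
    · simp
    · simp [hc]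
  -- For `f = Z_i` the second derivatives of `f` vanish, which kills the normally ordered side and
  -- two of the four terms.
  have h0 : ∀ g, ∑ c, ∑ b, ∑ d, (pderiv c (Λ i b) * Λ c d * pderiv b (pderiv d g) +
      pderiv c (Λ i b) * pderiv b (Λ c d) * pderiv d g) = 0 := by
    intro g
    have e := h 2 (X i) g
    rw [arrowString_two, bidiff_succ fun a b f => pderiv_poly_comm a b f] at e
    simp only [bidiff_succ fun a b f => pderiv_poly_comm a b f, hX, bidiff_zero, zero_mul,
      mul_zero, Finset.sum_const_zero, zero_add, add_zero] at e
    rw [Finset.sum_eq_single i] at e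
    · simpa using e
    · intro a _ ha
      simp [pderiv_X, Ne.symm ha]
    · simp
  -- A linear `g` isolates the term with both coefficients differentiated.
  have h1 : ∀ j, ∑ c, ∑ b, pderiv c (Λ i b) * pderiv b (Λ c j) = 0 := by
    intro j
    have e := h0 (X j)
    rw [← e]
    refine Finset.sum_congr rfl fun c _ => Finset.sum_congr rfl fun b _ => ?_
    rw [Finset.sum_eq_single j]
    · simp
    · intro a _ ha
      simp [pderiv_X, Ne.symm ha]
    · simp
  -- For the quadratic `g` those terms drop out by `h1`, leaving the terms with a single
  -- differentiated coefficient.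
  have e := h0 (X j * X l)
  have hs : ∀ φ : Fin (n + 1) → MvPolynomial (Fin (n + 1)) ℂ,
      ∑ d, φ d * pderiv d (X j * X l) = φ j * X l + φ l * X j := by
    intro φ
    simp [Derivation.leibniz, pderiv_X, Pi.single_apply, mul_add, Finset.sum_add_distrib]
    ring
  have hs2 : ∀ (c : Fin (n + 1)) (φ : Fin (n + 1) → MvPolynomial (Fin (n + 1)) ℂ),
      ∑ b, ∑ d, φ b * Λ c d * pderiv b (pderiv d (X j * X l)) = φ l * Λ c j + φ j * Λ c l := by
    intro c φ
    have h1 : ∀ (b d p q : Fin (n + 1)), pderiv b (if p = d then X q else 0 : MvPolynomial _ ℂ) =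
        if p = d then if q = b then 1 else 0 else 0 := by
      intro b d p q
      split_ifs with h1 h2
      · simp [h2]
      · simp [pderiv_X, Ne.symm h2]
      · simp
    simp [Derivation.leibniz, pderiv_X, Pi.single_apply, mul_add, Finset.sum_add_distrib, h1]
    ring
  have e1 : ∑ c, ∑ b, ∑ d, (pderiv c (Λ i b) * Λ c d * pderiv b (pderiv d (X j * X l)) +
      pderiv c (Λ i b) * pderiv b (Λ c d) * pderiv d (X j * X l)) =
      (∑ c, Λ c j * pderiv c (Λ i l) + ∑ c, Λ c l * pderiv c (Λ i j)) +
      ((∑ c, ∑ b, pderiv c (Λ i b) * pderiv b (Λ c j)) * X l +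
       (∑ c, ∑ b, pderiv c (Λ i b) * pderiv b (Λ c l)) * X j) := by
    simp only [Finset.sum_add_distrib, hs2, hs, Finset.sum_mul]
    simp only [mul_comm]
  rw [h1, h1, zero_mul, zero_mul, add_zero, add_zero] at e1
  rw [← e1, e]

open MvPolynomial in
lemma IsHolomorphicPoisson.isFlatBivector (h : IsHolomorphicPoisson Λ) (hrel : LambdaRelation Λ) :
    IsFlatBivector Λ := by
  set T : Fin (n + 1) → Fin (n + 1) → Fin (n + 1) → MvPolynomial (Fin (n + 1)) ℂ :=
    fun i l j => ∑ c, Λ c j * pderiv c (Λ i l) with hT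
  have h1 : ∀ i j l, T i l j = -T i j l := fun i j l =>
    eq_neg_of_add_eq_zero_left (hrel.antisymm i j l)
  have h2 : ∀ i j l, T i l j = -T l i j := fun i j l => by
    simp only [hT]
    rw [← Finset.sum_neg_distrib]
    refine Finset.sum_congr rfl fun c _ => ?_
    rw [h.skew i l, map_neg, mul_neg]
  have hb : ∀ a p, bracket Λ (X a) p = -∑ c, Λ c a * pderiv c p := by
    intro a p
    rw [bracket, Finset.sum_eq_single a, ← Finset.sum_neg_distrib]
    · refine Finset.sum_congr rfl fun c _ => ?_
      rw [h.skew a c]; simp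
    · intro b _ hb
      simp [pderiv_X, Ne.symm hb]
    · simp
  have hbX : ∀ a b, bracket Λ (X a) (X b) = Λ a b := by
    intro a b
    rw [hb, Finset.sum_eq_single b, h.skew a b]
    · simp
    · intro c _ hc
      simp [pderiv_X, Ne.symm hc]
    · simp
  have hJ : ∀ a b c, T b c a + T c a b + T a b c = 0 := by
    intro a b c
    have e := h.jacobi (X a) (X b) (X c)
    rw [hbX, hbX, hbX, hb, hb, hb] at e
    linear_combination -e
  -- By the two antisymmetries `T` is invariant under cyclic permutations, so the Jacobi identity
  -- reads `3 T = 0`.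
  have h0 : ∀ a b c, T a b c = 0 := by
    intro a b c
    have e := hJ a b c
    rw [h1 b a c, h2 b c a, h1 c b a, h2 c a b, h1 a c b] at e
    have e1 := h1 a c b
    have e2 := h2 a b c
    have e3 : (3 : MvPolynomial (Fin (n + 1)) ℂ) * T a b c = 0 := by
      have r1 : T b c a = T a b c := by rw [h1 b a c, h2 b c a, neg_neg]
      have r2 : T c a b = T a b c := by rw [h2 c b a, h1 a b c, neg_neg]
      have e := hJ a b c
      rw [r1, r2] at e
      linear_combination e
    exact (mul_eq_zero.1 e3).resolve_left (by norm_num)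
  refine ⟨fun a b f => pderiv_poly_comm a b f, fun c b d => h0 b d c, fun c b d => ?_⟩
  rw [← neg_eq_zero, ← Finset.sum_neg_distrib, ← h0 b d c]
  refine Finset.sum_congr rfl fun a _ => ?_
  rw [h.skew c a]; simp

/-- The flatness conditions are homogeneous quadratic in the bivector, so they survive every
scaling, also by zero. -/
lemma IsFlatBivector.smul (h : IsFlatBivector Λ) (τ : ℂ) : IsFlatBivector (τ • Λ) := by
  have key : ∀ (v : Fin (n + 1) → MvPolynomial (Fin (n + 1)) ℂ) (p : MvPolynomial (Fin (n + 1)) ℂ),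
      ∑ a, v a * MvPolynomial.pderiv a p = 0 →
      ∑ a, (τ • v a) * MvPolynomial.pderiv a (τ • p) = 0 := by
    intro v p hp
    simp only [Derivation.map_smul, smul_mul_smul_comm, ← Finset.smul_sum, hp, smul_zero]
  exact ⟨h.comm, fun c b d => key (fun a => Λ a c) _ (h.left c b d),
    fun c b d => key (fun a => Λ c a) _ (h.right c b d)⟩

lemma bracket_smul (τ : ℂ) (f g : MvPolynomial (Fin (n + 1)) ℂ) :
    bracket (τ • Λ) f g = τ • bracket Λ f g := by
  simp only [bracket, Finset.smul_sum, Matrix.smul_apply, smul_mul_assoc]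

lemma bracket_smul_right (τ : ℂ) (f g : MvPolynomial (Fin (n + 1)) ℂ) :
    bracket Λ f (τ • g) = τ • bracket Λ f g := by
  simp only [bracket, Finset.smul_sum, Derivation.map_smul, mul_smul_comm]

lemma IsHolomorphicPoisson.smul (h : IsHolomorphicPoisson Λ) (τ : ℂ) :
    IsHolomorphicPoisson (τ • Λ) where
  homogeneous a b := by
    rw [Matrix.smul_apply, MvPolynomial.smul_eq_C_mul]
    exact (h.homogeneous a b).C_mul τ
  skew a b := by rw [Matrix.smul_apply, Matrix.smul_apply, h.skew a b, smul_neg]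
  jacobi f g p := by
    simp only [bracket_smul, bracket_smul_right, ← smul_add, h.jacobi, smul_zero]

end Flatness

/-! ### Products of formal Laurent series in the deformation parameter -/

section Laurent

variable {M : Type*} [AddCommGroup M]

/-- The product of formal Laurent series `∑ μ^m f_m` in which `∑ μ^k B k` multiplies
coefficients. -/
def laurentStar (B : ℕ → M → M → M) (f g : ℤ → M) : ℤ → M :=
  fun m => ∑ᶠ p : ℤ × ℕ, B p.2 (f p.1) (g (m - p.1 - p.2))

/-- A nonzero term has `N₁ ≤ i ≤ m - N₂` and `k ≤ m - N₁ - N₂`. Every larger finite box gives the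
same value, so different products can be compared over one index set. -/
lemma laurentStar_eq_sum {B : ℕ → M → M → M} (hl : ∀ k g, B k 0 g = 0) (hr : ∀ k f, B k f 0 = 0)
    {f g : ℤ → M} {N₁ N₂ m : ℤ} (hf : ∀ i < N₁, f i = 0) (hg : ∀ i < N₂, g i = 0)
    {I : Finset ℤ} {N : ℕ} (hI : Finset.Icc N₁ (m - N₂) ⊆ I) (hN : m - N₁ - N₂ < N) :
    laurentStar B f g m = ∑ i ∈ I, ∑ k ∈ Finset.range N, B k (f i) (g (m - i - k)) := by
  rw [← Finset.sum_product']
  refine finsum_eq_sum_of_support_subset _ fun p hp => ?_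
  have h1 : N₁ ≤ p.1 := by
    by_contra h
    exact hp (by simp only [hf p.1 (not_le.1 h), hl])
  have h2 : N₂ ≤ m - p.1 - p.2 := by
    by_contra h
    exact hp (by simp only [hg _ (not_le.1 h), hr])
  simp only [Finset.coe_product, Finset.coe_range, Set.mem_prod, Set.mem_Iio, Finset.mem_coe]
  exact ⟨hI (Finset.mem_Icc.2 ⟨h1, by omega⟩), by omega⟩

lemma laurentStar_eq_zero {B : ℕ → M → M → M} (hl : ∀ k g, B k 0 g = 0) (hr : ∀ k f, B k f 0 = 0)
    {f g : ℤ → M} {N₁ N₂ m : ℤ} (hf : ∀ i < N₁, f i = 0) (hg : ∀ i < N₂, g i = 0)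
    (hm : m < N₁ + N₂) : laurentStar B f g m = 0 := by
  rw [laurentStar_eq_sum hl hr hf hg (I := ∅) (N := 0)]
  · simp
  · rw [Finset.Icc_eq_empty (by omega)]
  · omega

lemma laurentStar_shift_left (B : ℕ → M → M → M) (f g : ℤ → M) (j : ℤ) :
    laurentStar B (fun m => f (m - j)) g = fun m => laurentStar B f g (m - j) := by
  funext m
  refine Eq.trans (finsum_congr fun p => ?_)
    (finsum_comp_equiv (Equiv.prodCongr (Equiv.subRight j) (Equiv.refl ℕ))
      (f := fun p => B p.2 (f p.1) (g (m - j - p.1 - p.2))))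
  simp only [Equiv.prodCongr_apply, Prod.map, Equiv.subRight_apply, Equiv.refl_apply]
  congr 2
  omega

lemma laurentStar_shift_right (B : ℕ → M → M → M) (f g : ℤ → M) (j : ℤ) :
    laurentStar B f (fun m => g (m - j)) = fun m => laurentStar B f g (m - j) := by
  funext m
  refine finsum_congr fun p => ?_
  change B p.2 (f p.1) (g (m - p.1 - p.2 - j)) = B p.2 (f p.1) (g (m - j - p.1 - p.2))
  rw [show m - p.1 - p.2 - j = m - j - p.1 - p.2 by omega]

lemma laurentStar_single_left {B : ℕ → M → M → M} (hl : ∀ k g, B k 0 g = 0) {e : M}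
    (he : ∀ k g, B (k + 1) e g = 0) (g : ℤ → M) (m : ℤ) :
    laurentStar B (fun i => if i = 0 then e else 0) g m = B 0 e (g m) := by
  unfold laurentStar
  rw [finsum_eq_single _ ((0 : ℤ), 0)]
  · simp
  · rintro ⟨i, k⟩ hik
    by_cases hi : i = 0
    · subst hi
      cases k with
      | zero => exact absurd rfl hik
      | succ k => simp [he]
    · simp [hi, hl]

lemma laurentStar_single_right {B : ℕ → M → M → M} (hr : ∀ k f, B k f 0 = 0) {e : M}
    (he : ∀ k g, B (k + 1) g e = 0) (g : ℤ → M) (m : ℤ) :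
    laurentStar B g (fun i => if i = 0 then e else 0) m = B 0 (g m) e := by
  unfold laurentStar
  rw [finsum_eq_single _ ((m : ℤ), 0)]
  · simp
  · rintro ⟨i, k⟩ hik
    by_cases hi : m - i - k = 0
    · simp only [hi, if_true]
      cases k with
      | zero => exact absurd (by simp at hi ⊢; omega) hik
      | succ k => simp [he]
    · simp [hi, hr]

lemma laurentStar_single_single {B : ℕ → M → M → M} (hl : ∀ k g, B k 0 g = 0)
    (hr : ∀ k f, B k f 0 = 0) (a b : M) (m : ℕ) :
    laurentStar B (fun i => if i = 0 then a else 0) (fun i => if i = 0 then b else 0) m =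
      B m a b := by
  unfold laurentStar
  rw [finsum_eq_single _ ((0 : ℤ), m)]
  · simp
  · rintro ⟨i, k⟩ hik
    by_cases hi : i = 0
    · subst hi
      have : (m : ℤ) - 0 - k ≠ 0 := fun h => hik (by rw [Prod.mk.injEq]; omega)
      simp only [this, if_false, hr]
    · simp [hi, hl]

/-- Associativity passes from the family `∑ μ^k β k` to Laurent series. -/
lemma laurentStar_assoc {K : Type*} [CommRing K] [Module K M] (β : ℕ → M →ₗ[K] M →ₗ[K] M)
    (hβ : ∀ (m : ℕ) (f g h : M),
      ∑ x ∈ Finset.HasAntidiagonal.antidiagonal m, β x.2 (β x.1 f g) h =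
        ∑ x ∈ Finset.HasAntidiagonal.antidiagonal m, β x.2 f (β x.1 g h))
    {f g h : ℤ → M} {N : ℕ} (hf : ∀ i < -(N : ℤ), f i = 0) (hg : ∀ i < -(N : ℤ), g i = 0)
    (hh : ∀ i < -(N : ℤ), h i = 0) (m : ℤ) :
    laurentStar (fun k f g => β k f g) (laurentStar (fun k f g => β k f g) f g) h m =
      laurentStar (fun k f g => β k f g) f (laurentStar (fun k f g => β k f g) g h) m := by
  have hl : ∀ k g, β k 0 g = 0 := fun k g => by rw [map_zero, LinearMap.zero_apply]
  have hr : ∀ k f, β k f 0 = 0 := fun k f => map_zero _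
  have hfg : ∀ i < -(2 * N : ℤ), laurentStar (fun k f g => β k f g) f g i = 0 := fun i hi =>
    laurentStar_eq_zero hl hr hf hg (by omega)
  have hgh : ∀ i < -(2 * N : ℤ), laurentStar (fun k f g => β k f g) g h i = 0 := fun i hi =>
    laurentStar_eq_zero hl hr hg hh (by omega)
  -- All three factors start at `-N` and the double products at `-2 N`, so a nonzero triple term has
  -- all its positions in this window and satisfies `k + l ≤ m + 3 N < k₀`.
  set I := Finset.Icc (-(2 * N : ℤ)) (m + 2 * N) with hI
  set k₀ := (m + 3 * N + 1).toNat with hk₀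
  have hIs : ∀ a b : ℤ, -(2 * N : ℤ) ≤ a → b ≤ m + 2 * N → Finset.Icc a b ⊆ I := fun a b ha hb =>
    Finset.Icc_subset_Icc ha hb
  have hL : laurentStar (fun k f g => β k f g) (laurentStar (fun k f g => β k f g) f g) h m =
      ∑ i ∈ I, ∑ j ∈ I, ∑ k ∈ Finset.range k₀, ∑ l ∈ Finset.range k₀,
        β l (β k (f i) (g j)) (h (m - i - j - k - l)) := by
    rw [laurentStar_eq_sum hl hr hfg hh (I := I) (N := k₀) (hIs _ _ le_rfl (by omega)) (by omega)]
    have e1 : ∀ p ∈ I, ∀ l : ℕ, β l (laurentStar (fun k f g => β k f g) f g p) (h (m - p - l)) =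
        ∑ i ∈ I, ∑ k ∈ Finset.range k₀, β l (β k (f i) (g (p - i - k))) (h (m - p - l)) := by
      intro p _ l
      -- The window suffices for the inner product only when `p` is bounded above; otherwise the
      -- factor from `h` vanishes.
      by_cases hp : m - p - l < -(N : ℤ)
      · simp [hh _ hp]
      · rw [laurentStar_eq_sum hl hr hf hg (I := I) (N := k₀) (hIs _ _ (by omega) (by omega))
          (by omega)]
        simp only [map_sum, LinearMap.sum_apply]
    rw [Finset.sum_congr rfl fun p hp => Finset.sum_congr rfl fun l _ => e1 p hp l]
    -- The shift `p = i + j + k` indexes both bracketings by the positions `i`, `j` of the first two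
    -- factors.
    have e2 : ∀ i ∈ I, ∀ k l : ℕ, ∑ p ∈ I, β l (β k (f i) (g (p - i - k))) (h (m - p - l)) =
        ∑ j ∈ I, β l (β k (f i) (g j)) (h (m - i - j - k - l)) := by
      intro i hi k l
      by_cases hfi : i < -(N : ℤ)
      · simp [hf i hfi]
      rw [← finsum_eq_sum_of_support_subset (s := I), ← finsum_eq_sum_of_support_subset (s := I),
        ← finsum_comp_equiv (Equiv.addRight (i + k))]
      · refine finsum_congr fun j => ?_
        simp only [Equiv.coe_addRight]
        rw [show j + (i + k) - i - k = j by ring,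
          show m - (j + (i + k)) - l = m - i - j - k - l by ring]
      · intro j hj
        have h1 : -(N : ℤ) ≤ j := by
          by_contra hc
          exact hj (by simp [hg j (not_le.1 hc)])
        have h2 : -(N : ℤ) ≤ m - i - j - k - l := by
          by_contra hc
          exact hj (by simp [hh _ (not_le.1 hc)])
        rw [hI, Finset.mem_coe, Finset.mem_Icc]
        omega
      · intro p hp
        have h1 : -(N : ℤ) ≤ p - i - k := by
          by_contra hc
          exact hp (by simp [hg _ (not_le.1 hc)])
        have h2 : -(N : ℤ) ≤ m - p - l := by
          by_contra hc
          exact hp (by simp [hh _ (not_le.1 hc)])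
        rw [hI, Finset.mem_coe, Finset.mem_Icc]
        omega
    calc ∑ p ∈ I, ∑ l ∈ Finset.range k₀, ∑ i ∈ I, ∑ k ∈ Finset.range k₀,
          β l (β k (f i) (g (p - i - k))) (h (m - p - l))
        = ∑ i ∈ I, ∑ k ∈ Finset.range k₀, ∑ l ∈ Finset.range k₀, ∑ p ∈ I,
          β l (β k (f i) (g (p - i - k))) (h (m - p - l)) := by
          rw [Finset.sum_congr rfl fun p _ => Finset.sum_comm, Finset.sum_comm]
          refine Finset.sum_congr rfl fun i _ => ?_
          rw [Finset.sum_congr rfl fun p _ => Finset.sum_comm, Finset.sum_comm]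
          exact Finset.sum_congr rfl fun k _ => Finset.sum_comm
      _ = ∑ i ∈ I, ∑ k ∈ Finset.range k₀, ∑ l ∈ Finset.range k₀, ∑ j ∈ I,
          β l (β k (f i) (g j)) (h (m - i - j - k - l)) :=
          Finset.sum_congr rfl fun i hi => Finset.sum_congr rfl fun k _ =>
            Finset.sum_congr rfl fun l _ => e2 i hi k l
      _ = _ := by
          refine Finset.sum_congr rfl fun i _ => ?_
          rw [Finset.sum_comm (s := I)]
          exact Finset.sum_congr rfl fun k _ => Finset.sum_comm
  have hR : laurentStar (fun k f g => β k f g) f (laurentStar (fun k f g => β k f g) g h) m =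
      ∑ i ∈ I, ∑ j ∈ I, ∑ k ∈ Finset.range k₀, ∑ l ∈ Finset.range k₀,
        β l (f i) (β k (g j) (h (m - i - j - k - l))) := by
    rw [laurentStar_eq_sum hl hr hf hgh (I := I) (N := k₀) (hIs _ _ (by omega) (by omega))
      (by omega)]
    refine Finset.sum_congr rfl fun i _ => ?_
    have e1 : ∀ l : ℕ, β l (f i) (laurentStar (fun k f g => β k f g) g h (m - i - l)) =
        ∑ j ∈ I, ∑ k ∈ Finset.range k₀, β l (f i) (β k (g j) (h (m - i - j - k - l))) := by
      intro l
      by_cases hi : i < -(N : ℤ)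
      · simp [hf _ hi]
      · rw [laurentStar_eq_sum hl hr hg hh (I := I) (N := k₀) (hIs _ _ (by omega) (by omega))
          (by omega)]
        simp only [map_sum]
        refine Finset.sum_congr rfl fun j _ => Finset.sum_congr rfl fun k _ => ?_
        congr 3
        omega
    rw [Finset.sum_congr rfl fun l _ => e1 l, Finset.sum_comm]
    exact Finset.sum_congr rfl fun j _ => Finset.sum_comm
  rw [hL, hR]
  refine Finset.sum_congr rfl fun i _ => Finset.sum_congr rfl fun j _ => ?_
  by_cases hi : i < -(N : ℤ)
  · simp [hf i hi]
  by_cases hj : j < -(N : ℤ)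
  · simp [hg j hj]
  have hz : ∀ k l : ℕ, k₀ ≤ k + l → h (m - i - j - k - l) = 0 := fun k l hkl => hh _ (by omega)
  rw [sum_range_sum_range_eq_sum_antidiagonal, sum_range_sum_range_eq_sum_antidiagonal]
  · refine Finset.sum_congr rfl fun s _ => ?_
    have e : ∀ x ∈ Finset.HasAntidiagonal.antidiagonal s,
        h (m - i - j - x.1 - x.2) = h (m - i - j - s) := by
      intro x hx
      rw [← Finset.HasAntidiagonal.mem_antidiagonal.1 hx]
      push_cast
      congr 1
      omega
    rw [Finset.sum_congr rfl fun x hx => by rw [e x hx], hβ]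
    exact Finset.sum_congr rfl fun x hx => by rw [e x hx]
  · intro k l hkl
    simp [hz k l hkl]
  · intro k l hkl
    simp [hz k l hkl]

end Laurent

/-! ### The differential algebra of holomorphic germs -/

section Germs

open Filter Topology

variable {n : ℕ} {z : Fin (n + 1) → ℂ} {f g : (Fin (n + 1) → ℂ) → ℂ}

lemma partialD_zero (a : Fin (n + 1)) : partialD a (0 : (Fin (n + 1) → ℂ) → ℂ) = 0 := by
  funext y; simp [partialD]

lemma _root_.AnalyticAt.partialD (hf : AnalyticAt ℂ f z) (a : Fin (n + 1)) :
    AnalyticAt ℂ (partialD a f) z :=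
  ((ContinuousLinearMap.apply ℂ ℂ (Pi.single a (1 : ℂ) : Fin (n + 1) → ℂ)).analyticAt _).comp
    hf.fderiv

lemma _root_.Filter.EventuallyEq.partialD (h : f =ᶠ[𝓝 z] g) (a : Fin (n + 1)) :
    partialD a f =ᶠ[𝓝 z] partialD a g := by
  filter_upwards [h.fderiv (𝕜 := ℂ)] with y hy
  simp only [StarProduct.partialD, hy]

lemma partialD_add_eventually (hf : AnalyticAt ℂ f z) (hg : AnalyticAt ℂ g z) (a : Fin (n + 1)) :
    partialD a (f + g) =ᶠ[𝓝 z] partialD a f + partialD a g := by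
  filter_upwards [hf.eventually_analyticAt, hg.eventually_analyticAt] with y h1 h2
  simp [partialD, fderiv_add h1.differentiableAt h2.differentiableAt]

lemma partialD_smul_eventually (hf : AnalyticAt ℂ f z) (c : ℂ) (a : Fin (n + 1)) :
    partialD a (c • f) =ᶠ[𝓝 z] c • partialD a f := by
  filter_upwards [hf.eventually_analyticAt] with y h1
  simp [partialD, fderiv_const_smul h1.differentiableAt]

lemma partialD_mul_eventually (hf : AnalyticAt ℂ f z) (hg : AnalyticAt ℂ g z) (a : Fin (n + 1)) :
    partialD a (f * g) =ᶠ[𝓝 z] f * partialD a g + g * partialD a f := by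
  filter_upwards [hf.eventually_analyticAt, hg.eventually_analyticAt] with y h1 h2
  simp [partialD, fderiv_mul h1.differentiableAt h2.differentiableAt]

lemma partialD_comm_eventually (hf : AnalyticAt ℂ f z) (a b : Fin (n + 1)) :
    partialD a (partialD b f) =ᶠ[𝓝 z] partialD b (partialD a f) := by
  filter_upwards [hf.eventually_analyticAt] with y hy
  have hs := hy.contDiffAt.isSymmSndFDerivAt_of_omega
  have key : ∀ a b : Fin (n + 1), partialD a (partialD b f) y =
      fderiv ℂ (fderiv ℂ f) y (Pi.single a 1) (Pi.single b 1) := by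
    intro a b
    have h := ((ContinuousLinearMap.apply ℂ ℂ
      (Pi.single b (1 : ℂ) : Fin (n + 1) → ℂ)).hasFDerivAt.comp y
        hy.fderiv.differentiableAt.hasFDerivAt).fderiv
    change fderiv ℂ (⇑(ContinuousLinearMap.apply ℂ ℂ
      (Pi.single b (1 : ℂ) : Fin (n + 1) → ℂ)) ∘ fderiv ℂ f) y (Pi.single a 1) = _
    rw [h]
    rfl
  rw [key, key]
  exact hs _ _

lemma analyticAt_eval (p : MvPolynomial (Fin (n + 1)) ℂ) :
    AnalyticAt ℂ (fun y => MvPolynomial.eval y p) z := by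
  have := AnalyticAt.aeval_mvPolynomial (𝕜 := ℂ) (f := fun y : Fin (n + 1) → ℂ => y) (z := z)
    (fun i => (ContinuousLinearMap.proj (R := ℂ) (φ := fun _ : Fin (n + 1) => ℂ) i).analyticAt z) p
  simpa [MvPolynomial.aeval_eq_eval] using this

/-- Analytic and algebraic derivatives of polynomials agree; this carries flatness from polynomials
to germs. -/
lemma partialD_eval (a : Fin (n + 1)) (p : MvPolynomial (Fin (n + 1)) ℂ) :
    partialD a (fun y => MvPolynomial.eval y p) =
      fun y => MvPolynomial.eval y (MvPolynomial.pderiv a p) := by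
  induction p using MvPolynomial.induction_on with
  | C c => funext y; simp [partialD]
  | add p q hp hq =>
    funext y
    have := (partialD_add_eventually (z := y) (analyticAt_eval p) (analyticAt_eval q) a).eq_of_nhds
    rw [hp, hq] at this
    rw [map_add, map_add]
    simp only [map_add]
    exact this
  | mul_X p i hp =>
    funext y
    have := (partialD_mul_eventually (z := y) (analyticAt_eval p)
      (analyticAt_eval (MvPolynomial.X i)) a).eq_of_nhds
    rw [hp] at this
    have hX : partialD a (fun y : Fin (n + 1) → ℂ => MvPolynomial.eval y (MvPolynomial.X i)) =
        fun y => MvPolynomial.eval y (MvPolynomial.pderiv a (MvPolynomial.X i)) := by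
      funext y
      have h := (ContinuousLinearMap.proj (R := ℂ) (φ := fun _ : Fin (n + 1) => ℂ) i).fderiv (x := y)
      simp only [partialD, MvPolynomial.eval_X, MvPolynomial.pderiv_X]
      change fderiv ℂ (⇑(ContinuousLinearMap.proj (R := ℂ) (φ := fun _ : Fin (n + 1) => ℂ) i)) y _
        = _
      rw [h]
      by_cases hia : i = a
      · subst hia; simp
      · simp [hia]
    rw [hX] at this
    simp only [Pi.add_apply, Pi.mul_apply] at this
    rw [Derivation.leibniz, smul_eq_mul, smul_eq_mul, map_add, map_mul, map_mul, ← this]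
    congr 1
    funext y
    simp

variable (z)

/-- The functions that are holomorphic at `z`. -/
def analyticSubalgebra : Subalgebra ℂ ((Fin (n + 1) → ℂ) → ℂ) where
  carrier := {f | AnalyticAt ℂ f z}
  mul_mem' hf hg := hf.mul hg
  add_mem' hf hg := hf.add hg
  algebraMap_mem' _ := analyticAt_const

/-- The functions that vanish near `z`. -/
def vanishingIdeal : Ideal (analyticSubalgebra z) where
  carrier := {f | ∀ᶠ y in 𝓝 z, f.1 y = 0}
  zero_mem' := Eventually.of_forall fun _ => rfl
  add_mem' {f g} hf hg := by
    filter_upwards [hf, hg] with y h1 h2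
    change f.1 y + g.1 y = 0
    rw [h1, h2, add_zero]
  smul_mem' c f hf := by
    filter_upwards [hf] with y h1
    change c.1 y * f.1 y = 0
    rw [h1, mul_zero]

/-- The ring of germs at `z` of holomorphic functions. -/
def HolGerm : Type := analyticSubalgebra z ⧸ vanishingIdeal z

instance : CommRing (HolGerm z) :=
  inferInstanceAs (CommRing (analyticSubalgebra z ⧸ vanishingIdeal z))

instance : Algebra ℂ (HolGerm z) :=
  inferInstanceAs (Algebra ℂ (analyticSubalgebra z ⧸ vanishingIdeal z))

/-- The projection to the ring of germs. -/
def toGerm : analyticSubalgebra z →ₐ[ℂ] HolGerm z := Ideal.Quotient.mkₐ ℂ (vanishingIdeal z)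

open Classical in
/-- The germ at `z`, with value `0` at functions that are not holomorphic at `z`. -/
def germ (f : (Fin (n + 1) → ℂ) → ℂ) : HolGerm z :=
  if h : AnalyticAt ℂ f z then toGerm z ⟨f, h⟩ else 0

variable {z}

lemma germ_of_analyticAt (hf : AnalyticAt ℂ f z) :
    germ z f = toGerm z ⟨f, hf⟩ := dif_pos hf

/-- Agreement near `z` becomes equality in a ring. This is where `partialD` becomes a derivation:
the sum and product rules for `fderiv` hold near a point of analyticity, not for arbitrary
functions. -/
lemma germ_eq_iff (hf : AnalyticAt ℂ f z) (hg : AnalyticAt ℂ g z) :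
    germ z f = germ z g ↔ f =ᶠ[𝓝 z] g := by
  rw [germ_of_analyticAt hf, germ_of_analyticAt hg]
  refine (Ideal.Quotient.eq (I := vanishingIdeal z)).trans ?_
  change (∀ᶠ y in 𝓝 z, f y - g y = 0) ↔ _
  simp only [sub_eq_zero]
  rfl

lemma exists_germ_eq (q : HolGerm z) : ∃ f, AnalyticAt ℂ f z ∧ germ z f = q := by
  obtain ⟨⟨f, hf⟩, rfl⟩ := Ideal.Quotient.mk_surjective q
  exact ⟨f, hf, germ_of_analyticAt hf⟩

lemma germ_add (hf : AnalyticAt ℂ f z) (hg : AnalyticAt ℂ g z) :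
    germ z (f + g) = germ z f + germ z g := by
  rw [germ_of_analyticAt hf, germ_of_analyticAt hg, germ_of_analyticAt (hf.add hg), ← map_add]
  rfl

lemma germ_mul (hf : AnalyticAt ℂ f z) (hg : AnalyticAt ℂ g z) :
    germ z (f * g) = germ z f * germ z g := by
  rw [germ_of_analyticAt hf, germ_of_analyticAt hg, germ_of_analyticAt (hf.mul hg), ← map_mul]
  rfl

lemma germ_smul (hf : AnalyticAt ℂ f z) (c : ℂ) : germ z (c • f) = c • germ z f := by
  rw [germ_of_analyticAt hf, germ_of_analyticAt (hf.const_smul (c := c)), ← map_smul]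
  rfl

lemma germ_const (c : ℂ) : germ z (fun _ => c) = algebraMap ℂ (HolGerm z) c := by
  rw [germ_of_analyticAt analyticAt_const, ← (toGerm z).commutes]
  rfl

lemma germ_zero : germ z (0 : (Fin (n + 1) → ℂ) → ℂ) = 0 := by
  have := germ_const (z := z) 0
  rwa [map_zero] at this

lemma germ_one : germ z (1 : (Fin (n + 1) → ℂ) → ℂ) = 1 := by
  have := germ_const (z := z) 1
  rwa [map_one] at this

lemma analyticAt_sum {κ : Type*} {s : Finset κ} {F : κ → (Fin (n + 1) → ℂ) → ℂ}
    (hF : ∀ i ∈ s, AnalyticAt ℂ (F i) z) : AnalyticAt ℂ (∑ i ∈ s, F i) z :=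
  sum_mem (S := analyticSubalgebra z) hF

lemma analyticAt_prod {κ : Type*} {s : Finset κ} {F : κ → (Fin (n + 1) → ℂ) → ℂ}
    (hF : ∀ i ∈ s, AnalyticAt ℂ (F i) z) : AnalyticAt ℂ (∏ i ∈ s, F i) z :=
  prod_mem (S := analyticSubalgebra z) hF

lemma germ_sum {κ : Type*} {s : Finset κ} {F : κ → (Fin (n + 1) → ℂ) → ℂ}
    (hF : ∀ i ∈ s, AnalyticAt ℂ (F i) z) : germ z (∑ i ∈ s, F i) = ∑ i ∈ s, germ z (F i) := by
  classical
  induction s using Finset.induction_on with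
  | empty => simpa using germ_zero
  | insert i s hi ih =>
    rw [Finset.sum_insert hi, Finset.sum_insert hi, germ_add (hF i (by simp))
      (analyticAt_sum fun j hj => hF j (by simp [hj])), ih fun j hj => hF j (by simp [hj])]

lemma germ_prod {κ : Type*} {s : Finset κ} {F : κ → (Fin (n + 1) → ℂ) → ℂ}
    (hF : ∀ i ∈ s, AnalyticAt ℂ (F i) z) : germ z (∏ i ∈ s, F i) = ∏ i ∈ s, germ z (F i) := by
  classical
  induction s using Finset.induction_on with
  | empty => simpa using germ_one
  | insert i s hi ih =>
    rw [Finset.prod_insert hi, Finset.prod_insert hi, germ_mul (hF i (by simp))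
      (analyticAt_prod fun j hj => hF j (by simp [hj])), ih fun j hj => hF j (by simp [hj])]

lemma germ_partialD_congr (hf : AnalyticAt ℂ f z) (hg : AnalyticAt ℂ g z) (h : germ z f = germ z g)
    (a : Fin (n + 1)) : germ z (partialD a f) = germ z (partialD a g) :=
  (germ_eq_iff (hf.partialD a) (hg.partialD a)).2 (((germ_eq_iff hf hg).1 h).partialD a)

variable (z) in
/-- The partial derivatives of germs. -/
def germD (a : Fin (n + 1)) : Derivation ℂ (HolGerm z) (HolGerm z) :=
  -- The chosen representative is immaterial, since functions that agree near `z` have derivatives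
  -- that agree near `z`.
  have spec : ∀ f, AnalyticAt ℂ f z →
      germ z (partialD a (exists_germ_eq (germ z f)).choose) = germ z (partialD a f) := fun f hf =>
    germ_partialD_congr (exists_germ_eq (germ z f)).choose_spec.1 hf
      (exists_germ_eq (germ z f)).choose_spec.2 a
  Derivation.mk'
    { toFun := fun q => germ z (partialD a (exists_germ_eq q).choose)
      map_add' := fun p q => by
        obtain ⟨f, hf, rfl⟩ := exists_germ_eq p
        obtain ⟨g, hg, rfl⟩ := exists_germ_eq q
        rw [← germ_add hf hg, spec _ (hf.add hg), spec _ hf, spec _ hg,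
          ← germ_add (hf.partialD a) (hg.partialD a)]
        exact (germ_eq_iff ((hf.add hg).partialD a) ((hf.partialD a).add (hg.partialD a))).2
          (partialD_add_eventually hf hg a)
      map_smul' := fun c p => by
        obtain ⟨f, hf, rfl⟩ := exists_germ_eq p
        rw [← germ_smul hf, spec _ (hf.const_smul (c := c)), spec _ hf, RingHom.id_apply,
          ← germ_smul (hf.partialD a)]
        exact (germ_eq_iff ((hf.const_smul (c := c)).partialD a)
          ((hf.partialD a).const_smul (c := c))).2 (partialD_smul_eventually hf c a) }
    fun p q => by
      obtain ⟨f, hf, rfl⟩ := exists_germ_eq p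
      obtain ⟨g, hg, rfl⟩ := exists_germ_eq q
      simp only [LinearMap.coe_mk, AddHom.coe_mk, smul_eq_mul]
      rw [← germ_mul hf hg, spec _ (hf.mul hg), spec _ hf, spec _ hg,
        ← germ_mul hf (hg.partialD a), ← germ_mul hg (hf.partialD a),
        ← germ_add (hf.mul (hg.partialD a)) (hg.mul (hf.partialD a))]
      exact (germ_eq_iff ((hf.mul hg).partialD a)
        ((hf.mul (hg.partialD a)).add (hg.mul (hf.partialD a)))).2 (partialD_mul_eventually hf hg a)

lemma germD_germ (a : Fin (n + 1)) (hf : AnalyticAt ℂ f z) :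
    germD z a (germ z f) = germ z (partialD a f) :=
  germ_partialD_congr (exists_germ_eq (germ z f)).choose_spec.1 hf
    (exists_germ_eq (germ z f)).choose_spec.2 a

lemma germD_comm (a b : Fin (n + 1)) (q : HolGerm z) :
    germD z a (germD z b q) = germD z b (germD z a q) := by
  obtain ⟨f, hf, rfl⟩ := exists_germ_eq q
  rw [germD_germ _ hf, germD_germ _ hf, germD_germ _ (hf.partialD b), germD_germ _ (hf.partialD a)]
  exact (germ_eq_iff ((hf.partialD b).partialD a) ((hf.partialD a).partialD b)).2
    (partialD_comm_eventually hf a b)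

variable (z) in
/-- The germs of the coefficients of `Λ`. -/
def germCoeff (Λ : Bivector n) : Matrix (Fin (n + 1)) (Fin (n + 1)) (HolGerm z) :=
  fun a b => germ z (coeffFun Λ a b)

lemma IsFlatBivector.isFlat_germCoeff {Λ : Bivector n} (h : IsFlatBivector Λ) :
    IsFlat (germD z) (germCoeff z Λ) := by
  have key : ∀ (v : Fin (n + 1) → MvPolynomial (Fin (n + 1)) ℂ) (p : MvPolynomial (Fin (n + 1)) ℂ),
      ∑ a, v a * MvPolynomial.pderiv a p = 0 →
      ∑ a, germ z (fun y => MvPolynomial.eval y (v a)) *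
        germD z a (germ z fun y => MvPolynomial.eval y p) = 0 := by
    intro v p hp
    simp only [germD_germ _ (analyticAt_eval p), partialD_eval]
    rw [Finset.sum_congr rfl fun a _ => (germ_mul (analyticAt_eval (v a)) (analyticAt_eval _)).symm,
      ← germ_sum fun a _ => (analyticAt_eval (v a)).mul (analyticAt_eval _)]
    refine Eq.trans (congrArg _ ?_) germ_zero
    funext y
    have := congrArg (MvPolynomial.eval y) hp
    simpa using this
  exact ⟨germD_comm, fun c b d => key (fun a => Λ a c) _ (h.left c b d),
    fun c b d => key (fun a => Λ c a) _ (h.right c b d)⟩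

lemma analyticAt_iterD (hf : AnalyticAt ℂ f z) {k : ℕ} (α : Fin k → Fin (n + 1)) :
    AnalyticAt ℂ (iterD partialD α f) z := by
  induction k with
  | zero => simpa [iterD_zero] using hf
  | succ k ih =>
    rw [← Fin.cons_self_tail α, iterD_cons]
    exact (ih _).partialD _

lemma germ_iterD (hf : AnalyticAt ℂ f z) {k : ℕ} (α : Fin k → Fin (n + 1)) :
    germ z (iterD partialD α f) = iterD (fun a => germD z a) α (germ z f) := by
  induction k with
  | zero => simp [iterD_zero]
  | succ k ih =>
    rw [← Fin.cons_self_tail α, iterD_cons, iterD_cons, ← ih, germD_germ _ (analyticAt_iterD hf _)]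

lemma analyticAt_coeffFun (Λ : Bivector n) (a b : Fin (n + 1)) :
    AnalyticAt ℂ (coeffFun Λ a b) z := analyticAt_eval (Λ a b)

lemma analyticAt_bidiff (Λ : Bivector n) (hf : AnalyticAt ℂ f z) (hg : AnalyticAt ℂ g z) (k : ℕ) :
    AnalyticAt ℂ (bidiff partialD (coeffFun Λ) k f g) z :=
  analyticAt_sum fun α _ => analyticAt_sum fun β _ =>
    ((analyticAt_prod fun i _ => analyticAt_coeffFun Λ (α i) (β i)).mul
      (analyticAt_iterD hf α)).mul (analyticAt_iterD hg β)

lemma germ_bidiff (Λ : Bivector n) (hf : AnalyticAt ℂ f z) (hg : AnalyticAt ℂ g z) (k : ℕ) :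
    germ z (bidiff partialD (coeffFun Λ) k f g) =
      bidiff (fun a => germD z a) (germCoeff z Λ) k (germ z f) (germ z g) := by
  have h1 : ∀ α β : Fin k → Fin (n + 1), AnalyticAt ℂ (∏ i, coeffFun Λ (α i) (β i)) z :=
    fun α β => analyticAt_prod fun i _ => analyticAt_coeffFun Λ (α i) (β i)
  have h2 : ∀ α β : Fin k → Fin (n + 1), AnalyticAt ℂ
      ((∏ i, coeffFun Λ (α i) (β i)) * iterD partialD α f * iterD partialD β g) z :=
    fun α β => ((h1 α β).mul (analyticAt_iterD hf α)).mul (analyticAt_iterD hg β)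
  unfold bidiff
  rw [germ_sum fun α _ => analyticAt_sum fun β _ => h2 α β]
  refine Finset.sum_congr rfl fun α _ => ?_
  rw [germ_sum fun β _ => h2 α β]
  refine Finset.sum_congr rfl fun β _ => ?_
  rw [germ_mul ((h1 α β).mul (analyticAt_iterD hf α)) (analyticAt_iterD hg β),
    germ_mul (h1 α β) (analyticAt_iterD hf α), germ_iterD hf, germ_iterD hg,
    germ_prod fun i _ => analyticAt_coeffFun Λ (α i) (β i)]
  rfl

end Germs

/-! ### The star product of sections and germs over projective space -/

section Sections

open Filter Topology

variable {n : ℕ} {Λ : Bivector n} {z : Fin (n + 1) → ℂ}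
  {S W : Set (Projectivization ℂ (Fin (n + 1) → ℂ))}

/-- The coefficient `(1/k!) (1/2)^k`. -/
def sectionWeight (k : ℕ) : ℂ := (k.factorial : ℂ)⁻¹ * (1 / 2) ^ k

lemma isExpWeight_sectionWeight : IsExpWeight sectionWeight := by
  have := isExpWeight_inv_factorial (K := ℂ) (1 / 2) 1
  simp only [one_pow, smul_eq_mul, mul_one] at this
  exact this

/-- The term of order `k` in the star product of functions. -/
def funTerm (Λ : Bivector n) (k : ℕ) (f g : (Fin (n + 1) → ℂ) → ℂ) : (Fin (n + 1) → ℂ) → ℂ :=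
  sectionWeight k • bidiff partialD (coeffFun Λ) k f g

variable (z) in
/-- The term of order `k` in the star product of germs. -/
def germTerm (Λ : Bivector n) (k : ℕ) : HolGerm z →ₗ[ℂ] HolGerm z →ₗ[ℂ] HolGerm z :=
  sectionWeight k • bidiffLin (germD z) (germCoeff z Λ) k

lemma germTerm_apply (k : ℕ) (f g : HolGerm z) : germTerm z Λ k f g =
    sectionWeight k • bidiff (fun a => germD z a) (germCoeff z Λ) k f g := rfl

lemma sectionStar_eq (f g : ℤ → (Fin (n + 1) → ℂ) → ℂ) :
    sectionStar Λ f g = laurentStar (funTerm Λ) f g := rfl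

lemma iterD_partialD_zero {k : ℕ} (α : Fin k → Fin (n + 1)) :
    iterD partialD α (0 : (Fin (n + 1) → ℂ) → ℂ) = 0 := by
  induction k with
  | zero => simp [iterD_zero]
  | succ k ih => rw [← Fin.cons_self_tail α, iterD_cons, ih, partialD_zero]

lemma funTerm_zero_left (k : ℕ) (g : (Fin (n + 1) → ℂ) → ℂ) : funTerm Λ k 0 g = 0 := by
  simp [funTerm, bidiff, iterD_partialD_zero]

lemma funTerm_zero_right (k : ℕ) (f : (Fin (n + 1) → ℂ) → ℂ) : funTerm Λ k f 0 = 0 := by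
  simp [funTerm, bidiff, iterD_partialD_zero]

lemma germTerm_zero_left (k : ℕ) (g : HolGerm z) : germTerm z Λ k 0 g = 0 := by
  rw [map_zero, LinearMap.zero_apply]

lemma analyticAt_funTerm {f g : (Fin (n + 1) → ℂ) → ℂ} (hf : AnalyticAt ℂ f z)
    (hg : AnalyticAt ℂ g z) (k : ℕ) : AnalyticAt ℂ (funTerm Λ k f g) z :=
  (analyticAt_bidiff Λ hf hg k).const_smul

lemma germ_funTerm {f g : (Fin (n + 1) → ℂ) → ℂ} (hf : AnalyticAt ℂ f z)
    (hg : AnalyticAt ℂ g z) (k : ℕ) :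
    germ z (funTerm Λ k f g) = germTerm z Λ k (germ z f) (germ z g) := by
  rw [funTerm, germ_smul (analyticAt_bidiff Λ hf hg k), germ_bidiff Λ hf hg, germTerm_apply]

/-- A Laurent series of functions that are holomorphic at `z`. -/
structure IsAnalyticSeries (z : Fin (n + 1) → ℂ) (f : ℤ → (Fin (n + 1) → ℂ) → ℂ) : Prop where
  analyticAt : ∀ m, AnalyticAt ℂ (f m) z
  bounded : ∃ N : ℤ, ∀ m < N, f m = 0

lemma IsFormalSection.isAnalyticSeries {d : ℤ} {f : ℤ → (Fin (n + 1) → ℂ) → ℂ}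
    (hf : IsFormalSection S d f) (hz : z ∈ cone S) : IsAnalyticSeries z f := by
  refine ⟨fun m => ?_, hf.2⟩
  obtain ⟨W, hSW, _, hW⟩ := hf.1 m
  obtain ⟨h0, h⟩ := hz
  exact hW.1 z ⟨h0, hSW h⟩

lemma eqNear_iff (f g : ℤ → (Fin (n + 1) → ℂ) → ℂ) :
    EqNear S f g ↔ ∀ z ∈ cone S, ∀ m, f m =ᶠ[𝓝 z] g m := by
  simp only [EqNear, eventually_nhdsSet_iff_forall]
  exact ⟨fun h z hz m => h m z hz, fun h m z hz => h z hz m⟩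

variable {f f' g g' h : ℤ → (Fin (n + 1) → ℂ) → ℂ}

lemma IsAnalyticSeries.sectionStar (hf : IsAnalyticSeries z f) (hg : IsAnalyticSeries z g) :
    IsAnalyticSeries z (sectionStar Λ f g) := by
  obtain ⟨N₁, hN₁⟩ := hf.bounded
  obtain ⟨N₂, hN₂⟩ := hg.bounded
  refine ⟨fun m => ?_, N₁ + N₂, fun m hm => laurentStar_eq_zero funTerm_zero_left
    funTerm_zero_right hN₁ hN₂ hm⟩
  rw [sectionStar_eq, laurentStar_eq_sum funTerm_zero_left funTerm_zero_right hN₁ hN₂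
    (Finset.Subset.refl _) (N := (m - N₁ - N₂ + 1).toNat) (by omega)]
  exact analyticAt_sum fun i _ => analyticAt_sum fun k _ =>
    analyticAt_funTerm (hf.analyticAt i) (hg.analyticAt _) k

/-- Each coefficient is a finite sum, and germs commute with finite sums. Congruence, linearity,
unit and associativity are thereby reduced to the ring of germs. -/
lemma germ_sectionStar (hf : IsAnalyticSeries z f) (hg : IsAnalyticSeries z g) (m : ℤ) :
    germ z (sectionStar Λ f g m) = laurentStar (fun k p q => germTerm z Λ k p q)
      (fun i => germ z (f i)) (fun i => germ z (g i)) m := by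
  obtain ⟨N₁, hN₁⟩ := hf.bounded
  obtain ⟨N₂, hN₂⟩ := hg.bounded
  rw [sectionStar_eq, laurentStar_eq_sum funTerm_zero_left funTerm_zero_right hN₁ hN₂
    (Finset.Subset.refl _) (N := (m - N₁ - N₂ + 1).toNat) (by omega),
    laurentStar_eq_sum germTerm_zero_left (fun k f => map_zero _)
    (fun i hi => by rw [hN₁ i hi, germ_zero]) (fun i hi => by rw [hN₂ i hi, germ_zero])
    (Finset.Subset.refl _) (N := (m - N₁ - N₂ + 1).toNat) (by omega),
    germ_sum fun i _ => analyticAt_sum fun k _ =>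
      analyticAt_funTerm (hf.analyticAt i) (hg.analyticAt _) k]
  refine Finset.sum_congr rfl fun i _ => ?_
  rw [germ_sum fun k _ => analyticAt_funTerm (hf.analyticAt i) (hg.analyticAt _) k]
  exact Finset.sum_congr rfl fun k _ => germ_funTerm (hf.analyticAt i) (hg.analyticAt _) k

lemma IsAnalyticSeries.add (hf : IsAnalyticSeries z f) (hg : IsAnalyticSeries z g) :
    IsAnalyticSeries z (f + g) := by
  obtain ⟨N₁, hN₁⟩ := hf.bounded
  obtain ⟨N₂, hN₂⟩ := hg.bounded
  refine ⟨fun m => (hf.analyticAt m).add (hg.analyticAt m), min N₁ N₂, fun m hm => ?_⟩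
  rw [Pi.add_apply, hN₁ m (lt_min_iff.1 hm).1, hN₂ m (lt_min_iff.1 hm).2, add_zero]

lemma IsAnalyticSeries.smul (hf : IsAnalyticSeries z f) (c : ℂ) : IsAnalyticSeries z (c • f) := by
  obtain ⟨N₁, hN₁⟩ := hf.bounded
  refine ⟨fun m => (hf.analyticAt m).const_smul (c := c), N₁, fun m hm => ?_⟩
  rw [Pi.smul_apply, hN₁ m hm, smul_zero]

lemma isAnalyticSeries_one : IsAnalyticSeries z (constSeries (1 : (Fin (n + 1) → ℂ) → ℂ)) := by
  refine ⟨fun m => ?_, 0, fun m hm => if_neg hm.ne⟩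
  simp only [constSeries]
  split_ifs
  · exact analyticAt_const
  · exact analyticAt_const

lemma germ_bounded (hf : IsAnalyticSeries z f) : ∃ N : ℕ, ∀ M : ℕ, N ≤ M →
    ∀ i < -(M : ℤ), germ z (f i) = 0 := by
  obtain ⟨N₁, hN₁⟩ := hf.bounded
  exact ⟨N₁.natAbs, fun M hM i hi => by rw [hN₁ i (by omega), germ_zero]⟩

lemma laurentStar_germTerm_eq_sum {f g : ℤ → HolGerm z} {N : ℕ} (hf : ∀ i < -(N : ℤ), f i = 0)
    (hg : ∀ i < -(N : ℤ), g i = 0) (m : ℤ) :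
    laurentStar (fun k p q => germTerm z Λ k p q) f g m =
      ∑ i ∈ Finset.Icc (-(N : ℤ)) (m + N), ∑ k ∈ Finset.range (m + 2 * N + 1).toNat,
        germTerm z Λ k (f i) (g (m - i - k)) :=
  laurentStar_eq_sum germTerm_zero_left (fun _ _ => map_zero _) hf hg
    (by rw [sub_neg_eq_add]) (by omega)

lemma sectionStar_add_left (hf : IsAnalyticSeries z f) (hf' : IsAnalyticSeries z f')
    (hg : IsAnalyticSeries z g) (m : ℤ) :
    sectionStar Λ (f + f') g m =ᶠ[𝓝 z] (sectionStar Λ f g + sectionStar Λ f' g) m := by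
  rw [← germ_eq_iff (((hf.add hf').sectionStar hg).analyticAt m)
    (((hf.sectionStar hg).add (hf'.sectionStar hg)).analyticAt m), Pi.add_apply,
    germ_add ((hf.sectionStar hg).analyticAt m) ((hf'.sectionStar hg).analyticAt m),
    germ_sectionStar (hf.add hf') hg, germ_sectionStar hf hg, germ_sectionStar hf' hg]
  obtain ⟨N₁, h₁⟩ := germ_bounded hf
  obtain ⟨N₂, h₂⟩ := germ_bounded hf'
  obtain ⟨N₃, h₃⟩ := germ_bounded hg
  obtain ⟨N₄, h₄⟩ := germ_bounded (hf.add hf')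
  set N := N₁ + N₂ + N₃ + N₄
  rw [laurentStar_germTerm_eq_sum (h₄ N (by omega)) (h₃ N (by omega)),
    laurentStar_germTerm_eq_sum (h₁ N (by omega)) (h₃ N (by omega)),
    laurentStar_germTerm_eq_sum (h₂ N (by omega)) (h₃ N (by omega))]
  simp only [← Finset.sum_add_distrib, Pi.add_apply, germ_add (hf.analyticAt _) (hf'.analyticAt _),
    map_add, LinearMap.add_apply]

lemma sectionStar_add_right (hf : IsAnalyticSeries z f) (hg : IsAnalyticSeries z g)
    (hg' : IsAnalyticSeries z g') (m : ℤ) :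
    sectionStar Λ f (g + g') m =ᶠ[𝓝 z] (sectionStar Λ f g + sectionStar Λ f g') m := by
  rw [← germ_eq_iff ((hf.sectionStar (hg.add hg')).analyticAt m)
    (((hf.sectionStar hg).add (hf.sectionStar hg')).analyticAt m), Pi.add_apply,
    germ_add ((hf.sectionStar hg).analyticAt m) ((hf.sectionStar hg').analyticAt m),
    germ_sectionStar hf (hg.add hg'), germ_sectionStar hf hg, germ_sectionStar hf hg']
  obtain ⟨N₁, h₁⟩ := germ_bounded hf
  obtain ⟨N₂, h₂⟩ := germ_bounded hg
  obtain ⟨N₃, h₃⟩ := germ_bounded hg'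
  obtain ⟨N₄, h₄⟩ := germ_bounded (hg.add hg')
  set N := N₁ + N₂ + N₃ + N₄
  rw [laurentStar_germTerm_eq_sum (h₁ N (by omega)) (h₄ N (by omega)),
    laurentStar_germTerm_eq_sum (h₁ N (by omega)) (h₂ N (by omega)),
    laurentStar_germTerm_eq_sum (h₁ N (by omega)) (h₃ N (by omega))]
  simp only [← Finset.sum_add_distrib, Pi.add_apply, germ_add (hg.analyticAt _) (hg'.analyticAt _),
    map_add]

lemma sectionStar_smul_left (hf : IsAnalyticSeries z f) (hg : IsAnalyticSeries z g) (c : ℂ)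
    (m : ℤ) : sectionStar Λ (c • f) g m =ᶠ[𝓝 z] (c • sectionStar Λ f g) m := by
  rw [← germ_eq_iff (((hf.smul c).sectionStar hg).analyticAt m)
    (((hf.sectionStar hg).smul c).analyticAt m), Pi.smul_apply,
    germ_smul ((hf.sectionStar hg).analyticAt m),
    germ_sectionStar (hf.smul c) hg, germ_sectionStar hf hg]
  obtain ⟨N₁, h₁⟩ := germ_bounded hf
  obtain ⟨N₂, h₂⟩ := germ_bounded hg
  obtain ⟨N₃, h₃⟩ := germ_bounded (hf.smul c)
  set N := N₁ + N₂ + N₃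
  rw [laurentStar_germTerm_eq_sum (h₃ N (by omega)) (h₂ N (by omega)),
    laurentStar_germTerm_eq_sum (h₁ N (by omega)) (h₂ N (by omega))]
  simp only [Finset.smul_sum, Pi.smul_apply, germ_smul (hf.analyticAt _), map_smul,
    LinearMap.smul_apply]

lemma sectionStar_smul_right (hf : IsAnalyticSeries z f) (hg : IsAnalyticSeries z g) (c : ℂ)
    (m : ℤ) : sectionStar Λ f (c • g) m =ᶠ[𝓝 z] (c • sectionStar Λ f g) m := by
  rw [← germ_eq_iff ((hf.sectionStar (hg.smul c)).analyticAt m)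
    (((hf.sectionStar hg).smul c).analyticAt m), Pi.smul_apply,
    germ_smul ((hf.sectionStar hg).analyticAt m),
    germ_sectionStar hf (hg.smul c), germ_sectionStar hf hg]
  obtain ⟨N₁, h₁⟩ := germ_bounded hf
  obtain ⟨N₂, h₂⟩ := germ_bounded hg
  obtain ⟨N₃, h₃⟩ := germ_bounded (hg.smul c)
  set N := N₁ + N₂ + N₃
  rw [laurentStar_germTerm_eq_sum (h₁ N (by omega)) (h₃ N (by omega)),
    laurentStar_germTerm_eq_sum (h₁ N (by omega)) (h₂ N (by omega))]
  simp only [Finset.smul_sum, Pi.smul_apply, germ_smul (hg.analyticAt _), map_smul]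

lemma sectionStar_congr (hf : IsAnalyticSeries z f) (hf' : IsAnalyticSeries z f')
    (hg : IsAnalyticSeries z g) (hg' : IsAnalyticSeries z g') (h₁ : ∀ m, f m =ᶠ[𝓝 z] f' m)
    (h₂ : ∀ m, g m =ᶠ[𝓝 z] g' m) (m : ℤ) :
    sectionStar Λ f g m =ᶠ[𝓝 z] sectionStar Λ f' g' m := by
  rw [← germ_eq_iff ((hf.sectionStar hg).analyticAt m) ((hf'.sectionStar hg').analyticAt m),
    germ_sectionStar hf hg, germ_sectionStar hf' hg']
  congr 1
  · exact funext fun i => (germ_eq_iff (hf.analyticAt i) (hf'.analyticAt i)).2 (h₁ i)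
  · exact funext fun i => (germ_eq_iff (hg.analyticAt i) (hg'.analyticAt i)).2 (h₂ i)

lemma sectionStar_assoc (hΛ : IsFlatBivector Λ) (hf : IsAnalyticSeries z f)
    (hg : IsAnalyticSeries z g) (hh : IsAnalyticSeries z h) (m : ℤ) :
    sectionStar Λ (sectionStar Λ f g) h m =ᶠ[𝓝 z] sectionStar Λ f (sectionStar Λ g h) m := by
  rw [← germ_eq_iff (((hf.sectionStar hg).sectionStar hh).analyticAt m)
    ((hf.sectionStar (hg.sectionStar hh)).analyticAt m),
    germ_sectionStar (hf.sectionStar hg) hh, germ_sectionStar hf (hg.sectionStar hh)]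
  simp only [germ_sectionStar hf hg, germ_sectionStar hg hh]
  obtain ⟨N₁, h₁⟩ := germ_bounded hf
  obtain ⟨N₂, h₂⟩ := germ_bounded hg
  obtain ⟨N₃, h₃⟩ := germ_bounded hh
  refine laurentStar_assoc (germTerm z Λ) (fun m f g h => ?_) (h₁ (N₁ + N₂ + N₃) (by omega))
    (h₂ (N₁ + N₂ + N₃) (by omega)) (h₃ (N₁ + N₂ + N₃) (by omega)) m
  have := (hΛ.isFlat_germCoeff (z := z)).sum_antidiagonal_weight isExpWeight_sectionWeight m f g h
  simp only [germTerm, LinearMap.smul_apply, map_smul, smul_smul, bidiffLin_apply]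
  simpa only [mul_comm] using this

lemma germ_constSeries (a : (Fin (n + 1) → ℂ) → ℂ) :
    (fun i => germ z (constSeries a i)) = fun i => if i = 0 then germ z a else 0 := by
  funext i
  simp only [constSeries]
  split_ifs
  · rfl
  · exact germ_zero

lemma sectionStar_one_left (hf : IsAnalyticSeries z f) (m : ℤ) :
    sectionStar Λ (constSeries 1) f m =ᶠ[𝓝 z] f m := by
  rw [← germ_eq_iff ((isAnalyticSeries_one.sectionStar hf).analyticAt m) (hf.analyticAt m),
    germ_sectionStar isAnalyticSeries_one hf, germ_constSeries, germ_one,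
    laurentStar_single_left germTerm_zero_left]
  · simp [germTerm_apply, bidiff_zero, sectionWeight]
  · intro k g
    rw [germTerm_apply, bidiff_succ germD_comm]
    simp only [Derivation.map_one_eq_zero]
    simp [bidiff_eq_bidiffLin, -bidiffLin_apply]

lemma sectionStar_one_right (hf : IsAnalyticSeries z f) (m : ℤ) :
    sectionStar Λ f (constSeries 1) m =ᶠ[𝓝 z] f m := by
  rw [← germ_eq_iff ((hf.sectionStar isAnalyticSeries_one).analyticAt m) (hf.analyticAt m),
    germ_sectionStar hf isAnalyticSeries_one, germ_constSeries, germ_one,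
    laurentStar_single_right fun _ _ => map_zero _]
  · simp [germTerm_apply, bidiff_zero, sectionWeight]
  · intro k g
    rw [germTerm_apply, bidiff_succ germD_comm]
    simp only [Derivation.map_one_eq_zero]
    simp [bidiff_eq_bidiffLin, -bidiffLin_apply]

lemma sectionStar_constSeries (a b : (Fin (n + 1) → ℂ) → ℂ) (m : ℕ) :
    sectionStar Λ (constSeries a) (constSeries b) m = funTerm Λ m a b :=
  laurentStar_single_single funTerm_zero_left funTerm_zero_right a b m

lemma sectionStar_constSeries_neg (a b : (Fin (n + 1) → ℂ) → ℂ) {m : ℤ} (hm : m < 0) :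
    sectionStar Λ (constSeries a) (constSeries b) m = 0 :=
  laurentStar_eq_zero funTerm_zero_left funTerm_zero_right (N₁ := 0) (N₂ := 0)
    (fun i hi => if_neg hi.ne) (fun i hi => if_neg hi.ne) (by omega)

lemma IsSection.add {d : ℤ} {f g : (Fin (n + 1) → ℂ) → ℂ} (hf : IsSection W d f)
    (hg : IsSection W d g) : IsSection W d (f + g) := by
  refine ⟨hf.1.add hg.1, fun z hz c hc => ?_⟩
  rw [Pi.add_apply, Pi.add_apply, hf.2 z hz c hc, hg.2 z hz c hc, mul_add]

lemma IsSection.zero (W : Set (Projectivization ℂ (Fin (n + 1) → ℂ))) (d : ℤ) : IsSection W d 0 :=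
  ⟨fun _ _ => analyticAt_const, fun z _ c _ => by simp⟩

lemma IsSection.sum {κ : Type*} {s : Finset κ} {d : ℤ} {F : κ → (Fin (n + 1) → ℂ) → ℂ}
    (hF : ∀ i ∈ s, IsSection W d (F i)) : IsSection W d (∑ i ∈ s, F i) :=
  Finset.sum_induction _ _ (fun _ _ => IsSection.add) (IsSection.zero W d) hF

lemma IsSection.smul {d : ℤ} {f : (Fin (n + 1) → ℂ) → ℂ} (hf : IsSection W d f) (c : ℂ) :
    IsSection W d (c • f) := by
  refine ⟨fun z hz => (hf.1 z hz).const_smul, fun z hz b hb => ?_⟩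
  rw [Pi.smul_apply, Pi.smul_apply, hf.2 z hz b hb, smul_eq_mul, smul_eq_mul, mul_left_comm]

lemma IsSection.mul {d e : ℤ} {f g : (Fin (n + 1) → ℂ) → ℂ} (hf : IsSection W d f)
    (hg : IsSection W e g) : IsSection W (d + e) (f * g) := by
  refine ⟨hf.1.mul hg.1, fun z hz c hc => ?_⟩
  rw [Pi.mul_apply, Pi.mul_apply, hf.2 z hz c hc, hg.2 z hz c hc, zpow_add₀ hc]
  ring

lemma IsSection.mono {V : Set (Projectivization ℂ (Fin (n + 1) → ℂ))} {d : ℤ}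
    {f : (Fin (n + 1) → ℂ) → ℂ} (hf : IsSection W d f) (h : V ⊆ W) : IsSection V d f := by
  have hc : cone V ⊆ cone W := fun z ⟨h0, hz⟩ => ⟨h0, h hz⟩
  exact ⟨hf.1.mono hc, fun z hz => hf.2 z (hc hz)⟩

lemma smul_mem_cone {c : ℂ} (hc : c ≠ 0) (hz : z ∈ cone W) : c • z ∈ cone W := by
  obtain ⟨h0, hz⟩ := hz
  refine ⟨smul_ne_zero hc h0, ?_⟩
  convert hz using 1
  rw [Projectivization.mk_eq_mk_iff']
  exact ⟨c, rfl⟩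

/-- Differentiating `f (c y) = c ^ d f y` in `y` produces an extra factor `c` on the left. The
identity must hold in a neighbourhood of `z`, hence the open cone. -/
lemma IsSection.partialD {d : ℤ} {f : (Fin (n + 1) → ℂ) → ℂ} (hW : IsOpen (cone W))
    (hf : IsSection W d f) (a : Fin (n + 1)) : IsSection W (d - 1) (partialD a f) := by
  refine ⟨fun z hz => (hf.1 z hz).partialD a, fun z hz c hc => ?_⟩
  have h1 : HasFDerivAt (fun y => f (c • y)) (c • fderiv ℂ f (c • z)) z := by
    have h := (hf.1 _ (smul_mem_cone hc hz)).differentiableAt.hasFDerivAt.comp z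
      ((hasFDerivAt_id (𝕜 := ℂ) z).const_smul c)
    refine h.congr_fderiv ?_
    ext v
    simp
  have h2 : HasFDerivAt (fun y => f (c • y)) (c ^ d • fderiv ℂ f z) z := by
    refine ((hf.1 z hz).differentiableAt.hasFDerivAt.const_smul (c ^ d)).congr_of_eventuallyEq ?_
    filter_upwards [hW.mem_nhds hz] with y hy
    exact hf.2 y hy c hc
  have h3 := congrArg (fun l => l (Pi.single a 1)) (h1.unique h2)
  simp only [smul_apply, smul_eq_mul] at h3
  rw [zpow_sub_one₀ hc]
  simp only [StarProduct.partialD]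
  field_simp
  linear_combination h3

lemma isSection_coeffFun (hΛ : ∀ a b, (Λ a b).IsHomogeneous 2) (a b : Fin (n + 1)) :
    IsSection W 2 (coeffFun Λ a b) := by
  refine ⟨fun z _ => analyticAt_coeffFun Λ a b, fun z _ c _ => ?_⟩
  change MvPolynomial.eval (c • z) (Λ a b) = c ^ (2 : ℤ) * MvPolynomial.eval z (Λ a b)
  rw [MvPolynomial.eval_eq, MvPolynomial.eval_eq, Finset.mul_sum]
  refine Finset.sum_congr rfl fun d hd => ?_
  have h2 := hΛ a b (MvPolynomial.mem_support_iff.1 hd)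
  rw [weight_one_eq_degree, Finsupp.degree_apply] at h2
  simp only [Pi.smul_apply, smul_eq_mul, mul_pow, Finset.prod_mul_distrib, Finset.prod_pow_eq_pow_sum,
    h2]
  norm_cast
  ring

lemma IsSection.iterD {d : ℤ} {f : (Fin (n + 1) → ℂ) → ℂ} (hW : IsOpen (cone W))
    (hf : IsSection W d f) {k : ℕ} (α : Fin k → Fin (n + 1)) :
    IsSection W (d - k) (iterD StarProduct.partialD α f) := by
  induction k with
  | zero => simpa [iterD_zero] using hf
  | succ k ih =>
    rw [← Fin.cons_self_tail α, iterD_cons]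
    have := (ih (Fin.tail α)).partialD hW (α 0)
    rwa [sub_sub] at this

lemma IsSection.one (W : Set (Projectivization ℂ (Fin (n + 1) → ℂ))) : IsSection W 0 1 :=
  ⟨fun _ _ => analyticAt_const, fun z _ c _ => by simp⟩

lemma IsSection.prod {e : ℤ} {k : ℕ} {F : Fin k → (Fin (n + 1) → ℂ) → ℂ}
    (hF : ∀ i, IsSection W e (F i)) : IsSection W (k * e) (∏ i, F i) := by
  induction k with
  | zero => simpa using IsSection.one W
  | succ k ih =>
    rw [Fin.prod_univ_succ]
    have := (hF 0).mul (ih fun i => hF i.succ)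
    convert this using 1
    push_cast
    ring

/-- Degree count: the coefficients contribute `2 k`, and the derivatives remove `k` from each of `f`
and `g`. -/
lemma IsSection.funTerm (hΛ : ∀ a b, (Λ a b).IsHomogeneous 2) {d e : ℤ}
    {f g : (Fin (n + 1) → ℂ) → ℂ} (hW : IsOpen (cone W)) (hf : IsSection W d f)
    (hg : IsSection W e g) (k : ℕ) : IsSection W (d + e) (funTerm Λ k f g) := by
  refine IsSection.smul (IsSection.sum fun α _ => IsSection.sum fun β _ => ?_) _
  have := ((IsSection.prod fun i => isSection_coeffFun (W := W) hΛ (α i) (β i)).mul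
    (hf.iterD hW α)).mul (hg.iterD hW β)
  convert this using 1
  ring

lemma IsFormalSection.sectionStar (hΛ : ∀ a b, (Λ a b).IsHomogeneous 2) {d e : ℤ}
    (hf : IsFormalSection S d f) (hg : IsFormalSection S e g) :
    IsFormalSection S (d + e) (sectionStar Λ f g) := by
  obtain ⟨hf, N₁, hN₁⟩ := hf
  obtain ⟨hg, N₂, hN₂⟩ := hg
  refine ⟨fun m => ?_, N₁ + N₂, fun m hm => laurentStar_eq_zero funTerm_zero_left
    funTerm_zero_right hN₁ hN₂ hm⟩
  choose U hSU hU hfU using hf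
  choose V hSV hV hgV using hg
  set I := Finset.Icc N₁ (m - N₂) with hI
  set K := Finset.range (m - N₁ - N₂ + 1).toNat with hK
  -- Only finitely many coefficients of `f` and `g` enter the `m`-th coefficient, so a finite
  -- intersection of their domains serves.
  refine ⟨⋂ i ∈ I, ⋂ k ∈ K, U i ∩ V (m - i - k), ?_, ?_, ?_⟩
  · exact Set.subset_iInter₂ fun i _ => Set.subset_iInter₂ fun k _ =>
      Set.subset_inter (hSU i) (hSV _)
  -- The condition `z ≠ 0` is kept for empty index sets: the cone over all of projective space omits
  -- the origin.
  · have : cone (⋂ i ∈ I, ⋂ k ∈ K, U i ∩ V (m - i - k)) =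
        {z | z ≠ 0} ∩ ⋂ i ∈ I, ⋂ k ∈ K, cone (U i) ∩ cone (V (m - i - k)) := by
      ext z
      simp only [cone, Set.mem_iInter, Set.mem_inter_iff, Set.mem_ofPred_eq]
      constructor
      · rintro ⟨h0, h⟩
        exact ⟨h0, fun i hi k hk => ⟨⟨h0, (h i hi k hk).1⟩, ⟨h0, (h i hi k hk).2⟩⟩⟩
      · rintro ⟨h0, h⟩
        exact ⟨h0, fun i hi k hk => ⟨(h i hi k hk).1.2, (h i hi k hk).2.2⟩⟩
    rw [this]
    exact isOpen_ne.inter (isOpen_biInter_finset fun i _ => isOpen_biInter_finset fun k _ =>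
      (hU i).inter (hV _))
  · rw [sectionStar_eq, laurentStar_eq_sum funTerm_zero_left funTerm_zero_right hN₁ hN₂
      (Finset.Subset.refl _) (N := (m - N₁ - N₂ + 1).toNat) (by omega)]
    refine IsSection.sum fun i hi => IsSection.sum fun k hk => ?_
    have hs : (⋂ i ∈ I, ⋂ k ∈ K, U i ∩ V (m - i - k)) ⊆ U i ∩ V (m - i - k) :=
      (Set.iInter₂_subset i hi).trans (Set.iInter₂_subset k hk)
    refine (IsSection.funTerm (W := U i ∩ V (m - i - k)) hΛ ?_
      ((hfU i).mono Set.inter_subset_left) ((hgV _).mono Set.inter_subset_right) k).mono hs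
    have : cone (U i ∩ V (m - i - k)) = cone (U i) ∩ cone (V (m - i - k)) := by
      ext z
      exact ⟨fun ⟨h0, h⟩ => ⟨⟨h0, h.1⟩, ⟨h0, h.2⟩⟩, fun ⟨⟨h0, h1⟩, ⟨_, h2⟩⟩ => ⟨h0, h1, h2⟩⟩
    rw [this]
    exact (hU i).inter (hV _)

theorem isSymbolCalculus_sectionStar (hΛ : ∀ a b, (Λ a b).IsHomogeneous 2)
    (hflat : IsFlatBivector Λ) (S : Set (Projectivization ℂ (Fin (n + 1) → ℂ))) :
    IsSymbolCalculus Λ S (sectionStar Λ) where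
  closed d e f g hf hg := hf.sectionStar hΛ hg
  congr d e f f' g g' hf hf' hg hg' h₁ h₂ := by
    rw [eqNear_iff] at h₁ h₂ ⊢
    exact fun z hz => sectionStar_congr (hf.isAnalyticSeries hz) (hf'.isAnalyticSeries hz)
      (hg.isAnalyticSeries hz) (hg'.isAnalyticSeries hz) (h₁ z hz) (h₂ z hz)
  add_left d e f f' g hf hf' hg := (eqNear_iff _ _).2 fun z hz => sectionStar_add_left
    (hf.isAnalyticSeries hz) (hf'.isAnalyticSeries hz) (hg.isAnalyticSeries hz)
  add_right d e f g g' hf hg hg' := (eqNear_iff _ _).2 fun z hz => sectionStar_add_right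
    (hf.isAnalyticSeries hz) (hg.isAnalyticSeries hz) (hg'.isAnalyticSeries hz)
  smul_left d e f g c hf hg := (eqNear_iff _ _).2 fun z hz => sectionStar_smul_left
    (hf.isAnalyticSeries hz) (hg.isAnalyticSeries hz) c
  smul_right d e f g c hf hg := (eqNear_iff _ _).2 fun z hz => sectionStar_smul_right
    (hf.isAnalyticSeries hz) (hg.isAnalyticSeries hz) c
  shift_left d e f g j _ _ := (eqNear_iff _ _).2 fun z _ m => by
    simp only [sectionStar_eq, laurentStar_shift_left]
    rfl
  shift_right d e f g j _ _ := (eqNear_iff _ _).2 fun z _ m => by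
    simp only [sectionStar_eq, laurentStar_shift_right]
    rfl
  assoc d e l f g h hf hg hh := (eqNear_iff _ _).2 fun z hz => sectionStar_assoc hflat
    (hf.isAnalyticSeries hz) (hg.isAnalyticSeries hz) (hh.isAnalyticSeries hz)
  one_mul d f hf := (eqNear_iff _ _).2 fun z hz => sectionStar_one_left (hf.isAnalyticSeries hz)
  mul_one d f hf := (eqNear_iff _ _).2 fun z hz => sectionStar_one_right (hf.isAnalyticSeries hz)
  coeff_neg d e a b _ _ m hm := Eventually.of_forall fun z => by
    rw [sectionStar_constSeries_neg a b hm]; rfl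
  coeff_zero d e a b _ _ := Eventually.of_forall fun z => by
    have := sectionStar_constSeries (Λ := Λ) a b 0
    rw [Nat.cast_zero] at this
    rw [this]
    simp [funTerm, bidiff_zero, sectionWeight]
  coeff_one d e a b _ _ := Eventually.of_forall fun z => by
    have := sectionStar_constSeries (Λ := Λ) a b 1
    rw [Nat.cast_one] at this
    rw [this]
    simp only [funTerm, sectionWeight, bidiff, Pi.smul_apply, Finset.sum_apply, smul_eq_mul]
    rw [← (Equiv.funUnique (Fin 1) (Fin (n + 1))).symm.sum_comp]
    simp_rw [← (Equiv.funUnique (Fin 1) (Fin (n + 1))).symm.sum_comp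
      (fun β : Fin 1 → Fin (n + 1) => _)]
    simp [iterD, coeffFun]

end Sections

/-! ### Jacobi's formula -/

section DetDerivation

variable {ι R : Type*} [Fintype ι] [DecidableEq ι] [CommRing R]

/-- Jacobi's formula for the derivative of a determinant. -/
lemma derivation_det {K : Type*} [CommRing K] [Algebra K R] (δ : Derivation K R R)
    (M N : Matrix ι ι R) (h : M * N = 1) : δ M.det = M.det * (N * M.map δ).trace := by
  -- A derivation is the same as a ring homomorphism `a ↦ a + ε δ a` into the dual numbers, and
  -- determinants commute with ring homomorphisms.
  let φ : R →+* TrivSqZeroExt R R :=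
    { toFun := fun a => TrivSqZeroExt.inl a + TrivSqZeroExt.inr (δ a)
      map_one' := by ext <;> simp
      map_mul' := fun a b => by ext <;> simp [Derivation.leibniz, mul_comm]
      map_zero' := by ext <;> simp
      map_add' := fun a b => by ext <;> simp }
  let i : R →+* TrivSqZeroExt R R := TrivSqZeroExt.inlHom R R
  -- Here `φ M = M (1 + ε N δM)`, and `det (1 + ε Y) = 1 + ε tr Y` because `ε² = 0`.
  have h1 : φ.mapMatrix M = i.mapMatrix M *
      (1 + (TrivSqZeroExt.inr 1 : TrivSqZeroExt R R) • i.mapMatrix (N * M.map δ)) := by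
    have h2 : i.mapMatrix M * ((TrivSqZeroExt.inr 1 : TrivSqZeroExt R R) • i.mapMatrix (N * M.map δ))
        = (TrivSqZeroExt.inr 1 : TrivSqZeroExt R R) • i.mapMatrix (M.map δ) := by
      rw [Matrix.mul_smul, ← map_mul, ← mul_assoc, h, one_mul]
    rw [mul_add, mul_one, h2]
    ext a b <;> simp [φ, i]
  have h3 := congrArg Matrix.det h1
  rw [← RingHom.map_det, Matrix.det_mul, ← RingHom.map_det, Matrix.det_one_add_smul] at h3
  have h4 := congrArg TrivSqZeroExt.snd h3
  have h5 : (i.mapMatrix (N * M.map δ)).trace = i (N * M.map δ).trace := by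
    rw [Matrix.trace, Matrix.trace, map_sum]
    rfl
  rw [h5] at h4
  simpa [φ, i, pow_two] using h4

end DetDerivation

/-! ### Power series evaluated at matrices -/

section MatrixFunctions

variable {n : ℕ} {X : Matrix (Fin (n + 1)) (Fin (n + 1)) (MvPowerSeries (Fin (n + 1)) ℂ)}

/-- No entry has a constant term. -/
def HasNoConstantTerm (X : Matrix (Fin (n + 1)) (Fin (n + 1)) (MvPowerSeries (Fin (n + 1)) ℂ)) :
    Prop :=
  ∀ i j, SupportedIn {x | 1 ≤ x} (X i j)

lemma HasNoConstantTerm.pow (hX : HasNoConstantTerm X) (k : ℕ) (i j : Fin (n + 1)) :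
    SupportedIn {x | (k : ℤ) ≤ x} ((X ^ k) i j) := by
  induction k generalizing i j with
  | zero => simpa using SupportedIn.nonneg _
  | succ k ih =>
    rw [pow_succ, Matrix.mul_apply]
    refine SupportedIn.sum fun l _ => ((ih i l).mul (hX l j)).mono ?_
    rintro _ ⟨x, hx, y, hy, rfl⟩
    simp only [Set.mem_ofPred_eq] at hx hy ⊢
    push_cast
    omega

/-- The sum `∑ c_k X^k`, broken off before the order `N`. -/
def truncValue (c : PowerSeries ℂ) (N : ℕ)
    (X : Matrix (Fin (n + 1)) (Fin (n + 1)) (MvPowerSeries (Fin (n + 1)) ℂ)) :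
    Matrix (Fin (n + 1)) (Fin (n + 1)) (MvPowerSeries (Fin (n + 1)) ℂ) :=
  ∑ k ∈ Finset.range N, PowerSeries.coeff k c • X ^ k

lemma coeff_truncValue (c : PowerSeries ℂ) (N : ℕ) (i j : Fin (n + 1)) (d : Fin (n + 1) →₀ ℕ) :
    MvPowerSeries.coeff d (truncValue c N X i j) =
      ∑ k ∈ Finset.range N, PowerSeries.coeff k c * MvPowerSeries.coeff d ((X ^ k) i j) := by
  simp [truncValue, Matrix.sum_apply]

lemma coeff_matrixValue (hX : HasNoConstantTerm X) (c : PowerSeries ℂ) {N : ℕ} (i j : Fin (n + 1))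
    {d : Fin (n + 1) →₀ ℕ} (hN : d.degree < N) :
    MvPowerSeries.coeff d (matrixValue c X i j) =
      ∑ k ∈ Finset.range N, PowerSeries.coeff k c * MvPowerSeries.coeff d ((X ^ k) i j) := by
  change ∑ᶠ k : ℕ, PowerSeries.coeff k c * MvPowerSeries.coeff d ((X ^ k) i j) = _
  refine finsum_eq_sum_of_support_subset _ fun k hk => ?_
  simp only [Finset.coe_range, Set.mem_Iio]
  by_contra hlt
  refine hk ?_
  simp only [(hX.pow k i j).coeff_eq_zero (d := d) (by simp only [Set.mem_ofPred_eq]; omega),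
    mul_zero]

lemma matrixValue_sub_truncValue (hX : HasNoConstantTerm X) (c : PowerSeries ℂ) (N : ℕ)
    (i j : Fin (n + 1)) :
    SupportedIn {x | (N : ℤ) ≤ x} (matrixValue c X i j - truncValue c N X i j) := by
  intro d hd
  by_contra h
  simp only [Set.mem_ofPred_eq, not_le, Nat.cast_lt] at h
  exact hd (by rw [map_sub, coeff_matrixValue hX c i j h, coeff_truncValue, sub_self])

lemma coeff_matrixValue_eq_truncValue (hX : HasNoConstantTerm X) (c : PowerSeries ℂ) {N : ℕ}
    (i j : Fin (n + 1)) {d : Fin (n + 1) →₀ ℕ} (hN : d.degree < N) :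
    MvPowerSeries.coeff d (matrixValue c X i j) = MvPowerSeries.coeff d (truncValue c N X i j) := by
  rw [coeff_matrixValue hX c i j hN, coeff_truncValue]

lemma coeff_mul_congr {σ K : Type*} [CommRing K] {f f' g g' : MvPowerSeries σ K} {d : σ →₀ ℕ}
    (hf : ∀ e : σ →₀ ℕ, e.degree ≤ d.degree → MvPowerSeries.coeff e f = MvPowerSeries.coeff e f')
    (hg : ∀ e : σ →₀ ℕ, e.degree ≤ d.degree → MvPowerSeries.coeff e g = MvPowerSeries.coeff e g') :
    MvPowerSeries.coeff d (f * g) = MvPowerSeries.coeff d (f' * g') := by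
  classical
  rw [MvPowerSeries.coeff_mul, MvPowerSeries.coeff_mul]
  refine Finset.sum_congr rfl fun x hx => ?_
  have h := congrArg Finsupp.degree (Finset.HasAntidiagonal.mem_antidiagonal.1 hx)
  rw [map_add] at h
  rw [hf x.1 (by omega), hg x.2 (by omega)]

/-- Only powers of one matrix occur, and these commute, so evaluation is multiplicative as for a
scalar. Truncations reduce this to the Cauchy product. -/
lemma matrixValue_mul (hX : HasNoConstantTerm X) (c c' : PowerSeries ℂ) :
    matrixValue (c * c') X = matrixValue c X * matrixValue c' X := by
  ext i j d
  have hd := d.degree.lt_succ_self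
  rw [coeff_matrixValue hX _ i j hd, Matrix.mul_apply, map_sum]
  have h1 : ∀ l, MvPowerSeries.coeff d (matrixValue c X i l * matrixValue c' X l j) =
      MvPowerSeries.coeff d (truncValue c (d.degree + 1) X i l *
        truncValue c' (d.degree + 1) X l j) := fun l => coeff_mul_congr
    (fun e he => coeff_matrixValue_eq_truncValue hX c i l (Nat.lt_succ_of_le he))
    (fun e he => coeff_matrixValue_eq_truncValue hX c' l j (Nat.lt_succ_of_le he))
  simp only [h1]
  rw [← map_sum, ← Matrix.mul_apply, truncValue, truncValue, Finset.sum_mul_sum]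
  simp only [smul_mul_smul_comm, ← pow_add, Matrix.sum_apply, map_sum, Matrix.smul_apply, map_smul,
    smul_eq_mul]
  rw [sum_range_sum_range_eq_sum_antidiagonal]
  · refine Finset.sum_congr rfl fun m _ => ?_
    rw [PowerSeries.coeff_mul, Finset.sum_mul]
    exact Finset.sum_congr rfl fun x hx => by rw [Finset.HasAntidiagonal.mem_antidiagonal.1 hx]
  · intro k l hkl
    rw [(hX.pow (k + l) i j).coeff_eq_zero (d := d) (by simp only [Set.mem_ofPred_eq]; omega),
      mul_zero]

lemma matrixValue_add (hX : HasNoConstantTerm X) (c c' : PowerSeries ℂ) :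
    matrixValue (c + c') X = matrixValue c X + matrixValue c' X := by
  ext i j d
  have hd := d.degree.lt_succ_self
  simp only [Matrix.add_apply, map_add, coeff_matrixValue hX _ i j hd, add_mul,
    Finset.sum_add_distrib]

lemma matrixValue_smul (hX : HasNoConstantTerm X) (a : ℂ) (c : PowerSeries ℂ) :
    matrixValue (a • c) X = a • matrixValue c X := by
  ext i j d
  have hd := d.degree.lt_succ_self
  simp only [Matrix.smul_apply, map_smul, coeff_matrixValue hX _ i j hd, smul_eq_mul, mul_assoc,
    Finset.mul_sum]

lemma matrixValue_one (hX : HasNoConstantTerm X) : matrixValue 1 X = 1 := by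
  ext i j d
  rw [coeff_matrixValue hX _ i j d.degree.lt_succ_self, Finset.sum_range_succ', Finset.sum_eq_zero]
  · simp
  · intro k _
    simp [PowerSeries.coeff_one]

lemma matrixValue_X (hX : HasNoConstantTerm X) : matrixValue PowerSeries.X X = X := by
  ext i j d
  rw [coeff_matrixValue hX _ i j (N := d.degree + 2) (by omega), Finset.sum_eq_single 1]
  · simp
  · intro k _ hk
    simp [PowerSeries.coeff_X, hk]
  · intro h
    simp at h

lemma matrixValue_sub (hX : HasNoConstantTerm X) (c c' : PowerSeries ℂ) :
    matrixValue (c - c') X = matrixValue c X - matrixValue c' X := by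
  rw [sub_eq_add_neg, ← neg_one_smul ℂ c', matrixValue_add hX, matrixValue_smul hX,
    neg_one_smul, sub_eq_add_neg]

lemma matrixValue_smul_matrix (a : ℂ) (c : PowerSeries ℂ) :
    matrixValue c (a • X) = matrixValue (PowerSeries.rescale a c) X := by
  ext i j d
  refine finsum_congr fun k => ?_
  rw [smul_pow, PowerSeries.coeff_rescale, Matrix.smul_apply, map_smul, smul_eq_mul]
  ring

lemma matrixValue_neg_matrix (c : PowerSeries ℂ) :
    matrixValue c (-X) = matrixValue (PowerSeries.rescale (-1) c) X := by
  rw [← matrixValue_smul_matrix, neg_one_smul]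

/-- A vector field with power series as coefficients. -/
def vectorField {σ K : Type*} [Fintype σ] [CommRing K] (v : σ → MvPowerSeries σ K) :
    Derivation K (MvPowerSeries σ K) (MvPowerSeries σ K) :=
  ∑ a, v a • MvPowerSeries.pderiv K a

lemma vectorField_apply {σ K : Type*} [Fintype σ] [CommRing K] (v : σ → MvPowerSeries σ K)
    (f : MvPowerSeries σ K) : vectorField v f = ∑ a, v a * MvPowerSeries.pderiv K a f := by
  have h : ∀ s : Finset σ, (∑ a ∈ s, v a • MvPowerSeries.pderiv K a) f =
      ∑ a ∈ s, v a * MvPowerSeries.pderiv K a f := by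
    classical
    intro s
    induction s using Finset.induction_on with
    | empty => simp
    | insert a s ha ih =>
      rw [Finset.sum_insert ha, Finset.sum_insert ha, Derivation.add_apply, ih]
      rfl
  exact h Finset.univ

lemma SupportedIn.vectorField {σ K : Type*} [Fintype σ] [CommRing K] (v : σ → MvPowerSeries σ K)
    {N : ℤ} {f : MvPowerSeries σ K} (hf : SupportedIn {x | N + 1 ≤ x} f) :
    SupportedIn {x | N ≤ x} (vectorField v f) := by
  rw [vectorField_apply]
  refine SupportedIn.sum fun a _ => ((SupportedIn.nonneg (v a)).mul (hf.pderiv a)).mono ?_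
  rintro _ ⟨x, hx, y, hy, rfl⟩
  simp only [Set.mem_ofPred_eq] at hx hy ⊢
  omega

lemma map_derivation_mul {K R ι : Type*} [Fintype ι] [CommRing K] [CommRing R] [Algebra K R]
    (δ : Derivation K R R) (M N : Matrix ι ι R) :
    (M * N).map δ = M.map δ * N + M * N.map δ := by
  ext i j
  simp only [Matrix.map_apply, Matrix.mul_apply, Matrix.add_apply, map_sum, Derivation.leibniz,
    smul_eq_mul, ← Finset.sum_add_distrib]
  exact Finset.sum_congr rfl fun l _ => by ring

/-- A vector field can lower degrees by one, so one power more than usual has to be kept. -/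
lemma coeff_vectorField_matrixValue (hX : HasNoConstantTerm X) (c : PowerSeries ℂ)
    (v : Fin (n + 1) → MvPowerSeries (Fin (n + 1)) ℂ) {N : ℕ} (i j : Fin (n + 1))
    {d : Fin (n + 1) →₀ ℕ} (hN : d.degree < N) :
    MvPowerSeries.coeff d (vectorField v (matrixValue c X i j)) = ∑ k ∈ Finset.range (N + 1),
      PowerSeries.coeff k c * MvPowerSeries.coeff d ((X ^ k).map (vectorField v) i j) := by
  have h1 := (matrixValue_sub_truncValue hX c (N + 1) i j).mono (T := {x | (N : ℤ) + 1 ≤ x})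
    (fun x hx => by simpa using hx)
  have h2 := (h1.vectorField v).coeff_eq_zero (d := d) (by simp only [Set.mem_ofPred_eq]; omega)
  rw [map_sub, map_sub, sub_eq_zero] at h2
  rw [h2, truncValue, Matrix.sum_apply, map_sum, map_sum]
  simp

lemma map_vectorField_pow_of_eq_zero {v : Fin (n + 1) → MvPowerSeries (Fin (n + 1)) ℂ}
    (h : X.map (vectorField v) = 0) (k : ℕ) : (X ^ k).map (vectorField v) = 0 := by
  induction k with
  | zero =>
    ext i j : 2
    rw [pow_zero, Matrix.map_apply, Matrix.one_apply]
    split_ifs <;> simp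
  | succ k ih => rw [pow_succ, map_derivation_mul, ih, h, zero_mul, mul_zero, add_zero]

/-- Vector fields that annihilate `X` annihilate the functions of `X`. -/
lemma map_vectorField_matrixValue_of_eq_zero (hX : HasNoConstantTerm X) (c : PowerSeries ℂ)
    {v : Fin (n + 1) → MvPowerSeries (Fin (n + 1)) ℂ} (h : X.map (vectorField v) = 0) :
    (matrixValue c X).map (vectorField v) = 0 := by
  ext i j d
  rw [Matrix.map_apply, coeff_vectorField_matrixValue hX c v i j d.degree.lt_succ_self]
  refine Finset.sum_eq_zero fun k _ => ?_
  rw [map_vectorField_pow_of_eq_zero h]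
  simp

/-- The scalar power rule is valid because `X` commutes with its own derivative, which is `X`. -/
lemma map_vectorField_pow_of_eq_self {v : Fin (n + 1) → MvPowerSeries (Fin (n + 1)) ℂ}
    (h : X.map (vectorField v) = X) (k : ℕ) : (X ^ k).map (vectorField v) = (k : ℂ) • X ^ k := by
  induction k with
  | zero =>
    ext i j : 2
    rw [pow_zero, Matrix.map_apply, Matrix.one_apply]
    split_ifs <;> simp
  | succ k ih =>
    rw [pow_succ, map_derivation_mul, ih, h, smul_mul_assoc]
    push_cast
    rw [add_smul, one_smul]

/-- If `δ X = X`, then `δ (c X) = X c' X`. -/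
lemma map_vectorField_matrixValue_of_eq_self (hX : HasNoConstantTerm X) (c : PowerSeries ℂ)
    {v : Fin (n + 1) → MvPowerSeries (Fin (n + 1)) ℂ} (h : X.map (vectorField v) = X) :
    (matrixValue c X).map (vectorField v) =
      matrixValue (PowerSeries.X * PowerSeries.derivative ℂ c) X := by
  ext i j d
  rw [Matrix.map_apply, coeff_vectorField_matrixValue hX c v i j d.degree.lt_succ_self,
    coeff_matrixValue hX _ i j (N := d.degree.succ + 1) (by omega)]
  refine Finset.sum_congr rfl fun k _ => ?_
  rw [map_vectorField_pow_of_eq_self h]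
  cases k with
  | zero => simp
  | succ k =>
    rw [PowerSeries.coeff_succ_X_mul, PowerSeries.coeff_derivative]
    simp
    ring

lemma coeff_rescale_const {σ K : Type*} [CommRing K] (s : K) (f : MvPowerSeries σ K) (d : σ →₀ ℕ) :
    MvPowerSeries.coeff d (MvPowerSeries.rescale (fun _ => s) f) =
      s ^ d.degree * MvPowerSeries.coeff d f := by
  rw [MvPowerSeries.coeff_rescale, Finsupp.prod, Finset.prod_pow_eq_pow_sum]
  rfl

lemma SupportedIn.rescale {σ K : Type*} [CommRing K] {S : Set ℤ} {f : MvPowerSeries σ K}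
    (hf : SupportedIn S f) (s : K) : SupportedIn S (MvPowerSeries.rescale (fun _ => s) f) := by
  intro d hd
  rw [coeff_rescale_const] at hd
  exact hf d (right_ne_zero_of_mul hd)

lemma map_rescale_matrixValue (hX : HasNoConstantTerm X) (c : PowerSeries ℂ) (s : ℂ) :
    (matrixValue c X).map (MvPowerSeries.rescale fun _ => s) =
      matrixValue c (X.map (MvPowerSeries.rescale fun _ => s)) := by
  have hX' : HasNoConstantTerm (X.map (MvPowerSeries.rescale fun _ => s)) := fun i j =>
    (hX i j).rescale s
  ext i j d
  rw [Matrix.map_apply, coeff_rescale_const, coeff_matrixValue hX c i j d.degree.lt_succ_self,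
    coeff_matrixValue hX' c i j d.degree.lt_succ_self, Finset.mul_sum]
  refine Finset.sum_congr rfl fun k _ => ?_
  rw [← Matrix.map_pow, Matrix.map_apply, coeff_rescale_const, mul_left_comm]

end MatrixFunctions

/-! ### Hyperbolic series and inverse square roots -/

section Series

open PowerSeries

/-- The power series of the hyperbolic cosine. -/
def coshSeries : PowerSeries ℂ := (1 / 2 : ℂ) • (exp ℂ + rescale (-1) (exp ℂ))

/-- The power series of the hyperbolic sine. -/
def sinhSeries : PowerSeries ℂ := (1 / 2 : ℂ) • (exp ℂ - rescale (-1) (exp ℂ))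

/-- The power series `tanh x / x`. -/
def tanhQuotSeries : PowerSeries ℂ :=
  PowerSeries.mk fun k => coeff (k + 1) tanSeries * Complex.I ^ k

/-- The power series of the hyperbolic tangent. -/
def tanhSeries : PowerSeries ℂ := X * tanhQuotSeries

lemma derivative_rescale (a : ℂ) (f : PowerSeries ℂ) :
    derivative ℂ (rescale a f) = a • rescale a (derivative ℂ f) := by
  ext k
  simp only [coeff_derivative, coeff_rescale, map_smul, smul_eq_mul]
  ring

lemma derivative_coshSeries : derivative ℂ coshSeries = sinhSeries := by
  simp [coshSeries, sinhSeries, derivative_rescale, derivative_exp, sub_eq_add_neg]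

lemma derivative_sinhSeries : derivative ℂ sinhSeries = coshSeries := by
  simp [coshSeries, sinhSeries, derivative_rescale, derivative_exp, sub_eq_add_neg]

lemma rescale_cos : rescale Complex.I (cos ℂ) = coshSeries := by
  ext k
  simp only [coshSeries, cos, coeff_rescale, coeff_mk, map_smul, map_add, coeff_exp, smul_eq_mul]
  rcases Nat.even_or_odd' k with ⟨m, rfl | rfl⟩
  · rw [if_pos (even_two_mul m), pow_mul, pow_mul, Complex.I_sq, Nat.mul_div_cancel_left m two_pos]
    have h : ((-1 : ℂ) ^ m) * (-1) ^ m = 1 := by rw [← mul_pow]; norm_num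
    simp only [map_div₀, map_pow, map_neg, map_one, map_natCast]
    norm_num
    linear_combination (((2 * m).factorial : ℂ)⁻¹) * h
  · rw [if_neg (by simp), pow_succ (-1 : ℂ), pow_mul (-1 : ℂ)]
    norm_num

lemma rescale_sin : rescale Complex.I (sin ℂ) = Complex.I • sinhSeries := by
  ext k
  simp only [sinhSeries, sin, coeff_rescale, coeff_mk, map_smul, map_sub, coeff_exp, smul_eq_mul]
  rcases Nat.even_or_odd' k with ⟨m, rfl | rfl⟩
  · rw [if_pos (even_two_mul m), pow_mul, pow_mul]
    norm_num
  · rw [if_neg (by simp), pow_succ, pow_mul, pow_succ (-1 : ℂ), pow_mul (-1 : ℂ), Complex.I_sq,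
      show (2 * m + 1) / 2 = m by omega]
    have h : ((-1 : ℂ) ^ m) * (-1) ^ m = 1 := by rw [← mul_pow]; norm_num
    simp only [map_div₀, map_pow, map_neg, map_one, map_natCast]
    norm_num
    linear_combination (Complex.I * ((2 * m + 1).factorial : ℂ)⁻¹) * h

lemma constantCoeff_tanSeries : coeff 0 tanSeries = 0 := by
  simp [tanSeries, sin]

/-- This is `tan (i x) = i tanh x`. The tangent has no constant term, so each of its terms yields a
spare factor `i`. -/
lemma rescale_tanSeries : rescale Complex.I tanSeries = Complex.I • tanhSeries := by
  ext k
  cases k with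
  | zero => simp [tanhSeries, constantCoeff_tanSeries, coeff_rescale]
  | succ k =>
    rw [coeff_rescale, map_smul, tanhSeries, coeff_succ_X_mul, tanhQuotSeries, coeff_mk, smul_eq_mul]
    ring

lemma tanSeries_mul_cos : tanSeries * cos ℂ = sin ℂ := by
  rw [tanSeries, mul_assoc, PowerSeries.inv_mul_cancel, mul_one]
  simp [cos]

/-- Substituting `i x` into `tan · cos = sin` shows that the series built from the tangent
coefficients is indeed `sinh / cosh`. -/
lemma tanhSeries_mul_coshSeries : tanhSeries * coshSeries = sinhSeries := by
  have h := congrArg (rescale Complex.I) tanSeries_mul_cos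
  rw [map_mul, rescale_tanSeries, rescale_cos, rescale_sin, smul_mul_assoc] at h
  exact smul_right_injective _ Complex.I_ne_zero h

lemma constantCoeff_coshSeries : constantCoeff coshSeries = 1 := by
  rw [← coeff_zero_eq_constantCoeff_apply, coshSeries, map_smul, map_add, coeff_rescale]
  simp
  norm_num

lemma derivative_tanhSeries : derivative ℂ tanhSeries = 1 - tanhSeries ^ 2 := by
  have h := congrArg (derivative ℂ) tanhSeries_mul_coshSeries
  rw [Derivation.leibniz, derivative_coshSeries, derivative_sinhSeries,
    ← tanhSeries_mul_coshSeries, smul_eq_mul, smul_eq_mul] at h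
  have h0 : coshSeries ≠ 0 := fun h0 => by
    have := constantCoeff_coshSeries
    rw [h0] at this
    simp at this
  refine mul_left_cancel₀ h0 ?_
  linear_combination h

/-- With `q = tanh x / x`, the combination `q + x q'` is what half the Euler field produces from the
exponent of the closed form. -/
lemma derivative_tanhSeries' :
    tanhQuotSeries + X * derivative ℂ tanhQuotSeries = 1 - tanhSeries ^ 2 := by
  rw [← derivative_tanhSeries, tanhSeries, Derivation.leibniz, derivative_X]
  simp [add_comm]

lemma rescale_neg_one_tanhSeries : rescale (-1) tanhSeries = -tanhSeries := by
  have h1 : rescale (-1) coshSeries = coshSeries := by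
    ext k
    simp only [coshSeries, coeff_rescale, map_smul, map_add, smul_eq_mul]
    have h : ((-1 : ℂ) ^ k) * (-1) ^ k = 1 := by rw [← mul_pow]; norm_num
    linear_combination (1 / 2 * coeff k (exp ℂ)) * h
  have h2 : rescale (-1) sinhSeries = -sinhSeries := by
    ext k
    simp only [sinhSeries, coeff_rescale, map_smul, map_sub, map_neg, smul_eq_mul]
    have h : ((-1 : ℂ) ^ k) * (-1) ^ k = 1 := by rw [← mul_pow]; norm_num
    linear_combination (-1 / 2 * coeff k (exp ℂ)) * h
  have h := congrArg (rescale (-1 : ℂ)) tanhSeries_mul_coshSeries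
  rw [map_mul, h1, h2, ← tanhSeries_mul_coshSeries, ← neg_mul] at h
  have h0 : coshSeries ≠ 0 := fun h0 => by
    have := constantCoeff_coshSeries
    rw [h0] at this
    simp at this
  exact mul_right_cancel₀ h0 h

/-- Evenness of `tanh x / x` is the reason why the phase matrix is symmetric. -/
lemma rescale_neg_one_tanhQuotSeries : rescale (-1) tanhQuotSeries = tanhQuotSeries := by
  ext k
  have h := congrArg (coeff (k + 1)) rescale_neg_one_tanhSeries
  rw [coeff_rescale, map_neg, tanhSeries, coeff_succ_X_mul, pow_succ] at h
  rw [coeff_rescale]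
  linear_combination -h

/-- The binomial series `(1 + x)^{-1/2}` can be evaluated at `x = u - 1`, which has no constant
term. -/
lemma exists_isInvSqrt {n : ℕ} {u : MvPowerSeries (Fin (n + 1)) ℂ}
    (hu : MvPowerSeries.constantCoeff u = 1) : ∃ D, IsInvSqrt D u := by
  have hs : HasSubst (u - 1) := HasSubst.of_constantCoeff_zero (by simp [hu])
  refine ⟨(PowerSeries.binomialSeries ℂ (-(1 / 2) : ℂ)).subst (u - 1), ?_, ?_⟩
  · have h := constantCoeff_subst_eq_zero (a := u - 1) (by simp [hu])
      (PowerSeries.binomialSeries ℂ (-(1 / 2) : ℂ) - 1) (by simp)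
    rw [subst_sub hs, ← coe_substAlgHom hs, map_one, map_sub, map_one, sub_eq_zero] at h
    rw [← coe_substAlgHom hs, h]
  · have h : PowerSeries.binomialSeries ℂ (-(1 / 2) : ℂ) ^ 2 * (1 + X) = 1 := by
      have h1 := PowerSeries.binomialSeries_nat (R := ℂ) (A := ℂ) 1
      rw [pow_one] at h1
      rw [← h1, pow_two, ← PowerSeries.binomialSeries_add, ← PowerSeries.binomialSeries_add]
      norm_num
    have h2 := congrArg (PowerSeries.substAlgHom (R := ℂ) hs) h
    rw [map_mul, map_pow, map_add, map_one, substAlgHom_X] at h2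
    rw [coe_substAlgHom, add_sub_cancel] at h2
    exact h2

/-- In a domain two square roots differ by a sign, which the constant term determines. -/
lemma IsInvSqrt.unique {n : ℕ} {u D D' : MvPowerSeries (Fin (n + 1)) ℂ} (h : IsInvSqrt D u)
    (h' : IsInvSqrt D' u) : D = D' := by
  have hu : u ≠ 0 := fun hu => by
    have := h.2
    rw [hu, mul_zero] at this
    exact zero_ne_one this
  have h2 : D ^ 2 = D' ^ 2 := mul_right_cancel₀ hu (h.2.trans h'.2.symm)
  rcases sq_eq_sq_iff_eq_or_eq_neg.1 h2 with h3 | h3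
  · exact h3
  · have h4 := congrArg MvPowerSeries.constantCoeff h3
    rw [map_neg, h.1, h'.1] at h4
    norm_num at h4

/-- Logarithmic differentiation of `D² u = 1`, written without dividing by `2` or by `u`. -/
lemma IsInvSqrt.derivation {n : ℕ} {u D t : MvPowerSeries (Fin (n + 1)) ℂ} (h : IsInvSqrt D u)
    (δ : Derivation ℂ (MvPowerSeries (Fin (n + 1)) ℂ) (MvPowerSeries (Fin (n + 1)) ℂ))
    (ht : δ u = u * t) : 2 * δ D = -(D * t) := by
  have h1 := congrArg δ h.2
  rw [Derivation.leibniz, Derivation.leibniz_pow, ht, Derivation.map_one_eq_zero] at h1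
  simp only [smul_eq_mul, nsmul_eq_mul, Nat.add_one_sub_one, pow_one, Nat.cast_ofNat] at h1
  have h2 := h.2
  linear_combination D * h1 - (2 * δ D + D * t) * h2

end Series

/-! ### Substitution into a series in one variable -/

section ChainRule

variable {σ K : Type*} [CommRing K] [Algebra ℂ K] {f : MvPowerSeries σ K}

lemma SupportedIn.pow (hf : SupportedIn {x | 1 ≤ x} f) (k : ℕ) :
    SupportedIn {x | (k : ℤ) ≤ x} (f ^ k) := by
  induction k with
  | zero => simpa using SupportedIn.nonneg _
  | succ k ih =>
    rw [pow_succ]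
    refine (ih.mul hf).mono ?_
    rintro _ ⟨x, hx, y, hy, rfl⟩
    simp only [Set.mem_ofPred_eq] at hx hy ⊢
    push_cast
    omega

lemma SupportedIn.hasSubst (hf : SupportedIn {x | 1 ≤ x} f) : PowerSeries.HasSubst f := by
  refine PowerSeries.HasSubst.of_constantCoeff_zero ?_
  rw [← MvPowerSeries.coeff_zero_eq_constantCoeff_apply]
  exact hf.coeff_eq_zero (by simp)

lemma coeff_subst_eq_sum (hf : SupportedIn {x | 1 ≤ x} f) (c : PowerSeries ℂ) {N : ℕ}
    {d : σ →₀ ℕ} (hN : d.degree < N) :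
    MvPowerSeries.coeff d (c.subst f) = MvPowerSeries.coeff d
      (∑ k ∈ Finset.range N, PowerSeries.coeff k c • f ^ k) := by
  rw [PowerSeries.coeff_subst hf.hasSubst, map_sum]
  refine finsum_eq_sum_of_support_subset _ fun k hk => ?_
  simp only [Finset.coe_range, Set.mem_Iio]
  by_contra hlt
  refine hk ?_
  simp only [(hf.pow k).coeff_eq_zero (d := d) (by simp only [Set.mem_ofPred_eq]; omega),
    smul_zero]

lemma vectorField_smul_complex [Fintype σ] (v : σ → MvPowerSeries σ K) (c : ℂ)
    (g : MvPowerSeries σ K) : vectorField v (c • g) = c • vectorField v g := by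
  rw [← algebraMap_smul K c g, Derivation.map_smul, algebraMap_smul]

/-- The chain rule. -/
lemma vectorField_subst [Fintype σ] (v : σ → MvPowerSeries σ K) (hf : SupportedIn {x | 1 ≤ x} f)
    (c : PowerSeries ℂ) :
    vectorField v (c.subst f) = (PowerSeries.derivative ℂ c).subst f * vectorField v f := by
  ext d
  set N := d.degree + 1
  -- The truncation error starts in degree `N + 1`, so after one derivative it still misses `d`.
  have h1 : SupportedIn {x | (N : ℤ) + 1 ≤ x}
      (c.subst f - ∑ k ∈ Finset.range (N + 1), PowerSeries.coeff k c • f ^ k) := by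
    intro e he
    by_contra h
    simp only [Set.mem_ofPred_eq, not_le] at h
    exact he (by rw [map_sub, coeff_subst_eq_sum hf c (N := N + 1) (by omega), sub_self])
  have h2 := (h1.vectorField v).coeff_eq_zero (d := d) (by simp only [Set.mem_ofPred_eq]; omega)
  rw [map_sub, map_sub, sub_eq_zero] at h2
  rw [h2, coeff_mul_congr (fun e he => coeff_subst_eq_sum hf (PowerSeries.derivative ℂ c) (N := N)
    (Nat.lt_succ_of_le he)) (fun e he => rfl), map_sum, Finset.sum_range_succ']
  simp only [vectorField_smul_complex, Derivation.leibniz_pow, pow_zero,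
    Derivation.map_one_eq_zero, smul_zero, add_zero]
  rw [Finset.sum_mul, map_sum, map_sum]
  refine Finset.sum_congr rfl fun k _ => ?_
  rw [PowerSeries.coeff_derivative, Nat.add_sub_cancel, smul_eq_mul, ← Nat.cast_smul_eq_nsmul ℂ,
    smul_smul, smul_mul_assoc]
  push_cast
  rfl

end ChainRule

/-! ### The Euler field -/

section Euler

variable {σ K : Type*} [Fintype σ] [CommRing K] [Algebra ℂ K]

/-- Half the Euler vector field: it multiplies a form of degree `2 k` by `k`. -/
def halfEuler (σ K : Type*) [Fintype σ] [CommRing K] [Algebra ℂ K] :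
    Derivation K (MvPowerSeries σ K) (MvPowerSeries σ K) :=
  vectorField fun a => (1 / 2 : ℂ) • (MvPowerSeries.X a : MvPowerSeries σ K)

lemma coeff_X_mul_pderiv (a : σ) (f : MvPowerSeries σ K) (d : σ →₀ ℕ) :
    MvPowerSeries.coeff d (MvPowerSeries.X a * MvPowerSeries.pderiv K a f) =
      (d a : K) * MvPowerSeries.coeff d f := by
  classical
  rw [MvPowerSeries.X_def, MvPowerSeries.coeff_monomial_mul]
  split_ifs with h
  · rw [MvPowerSeries.coeff_pderiv, tsub_add_cancel_of_le h, one_mul, mul_comm]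
    congr 1
    have h1 : 1 ≤ d a := by simpa using h a
    simp [Nat.cast_sub h1]
  · have h1 : d a = 0 := by
      by_contra h0
      exact h (Finsupp.single_le_iff.2 (Nat.one_le_iff_ne_zero.2 h0))
    rw [h1, Nat.cast_zero, zero_mul]

lemma coeff_halfEuler (f : MvPowerSeries σ K) (d : σ →₀ ℕ) :
    MvPowerSeries.coeff d (halfEuler σ K f) = ((d.degree : ℂ) / 2) • MvPowerSeries.coeff d f := by
  rw [halfEuler, vectorField_apply, map_sum]
  have h : ∀ a, MvPowerSeries.coeff d ((1 / 2 : ℂ) • (MvPowerSeries.X a : MvPowerSeries σ K) *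
      MvPowerSeries.pderiv K a f) = ((d a : ℂ) / 2) • MvPowerSeries.coeff d f := by
    intro a
    rw [smul_mul_assoc]
    change (1 / 2 : ℂ) • MvPowerSeries.coeff d (MvPowerSeries.X a * MvPowerSeries.pderiv K a f) = _
    rw [coeff_X_mul_pderiv, ← nsmul_eq_mul, ← Nat.cast_smul_eq_nsmul ℂ, smul_smul]
    congr 1
    ring
  simp only [h, ← Finset.sum_smul, ← Finset.sum_div]
  congr 2
  rw [Finsupp.degree_eq_sum]
  push_cast
  rfl

/-- The factor one half is chosen so that quadratic data, in particular the entries of `ΛA`, are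
fixed. -/
lemma SupportedIn.halfEuler {f : MvPowerSeries σ K} (hf : SupportedIn {2} f) :
    halfEuler σ K f = f := by
  ext d
  rw [coeff_halfEuler]
  by_cases h : (d.degree : ℤ) ∈ ({2} : Set ℤ)
  · have h2 : d.degree = 2 := Nat.cast_injective (R := ℤ) (Set.mem_singleton_iff.1 h)
    rw [h2]
    simp
  · rw [hf.coeff_eq_zero h, smul_zero]

lemma halfEuler_X (a : σ) : halfEuler σ K (MvPowerSeries.X a) =
    (1 / 2 : ℂ) • (MvPowerSeries.X a : MvPowerSeries σ K) := by
  classical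
  rw [halfEuler, vectorField_apply, Finset.sum_eq_single a]
  · simp
  · intro b _ hb
    rw [MvPowerSeries.pderiv_X_of_ne (Ne.symm hb), mul_zero]
  · simp

end Euler

/-! ### Quadratic forms with variable coefficients -/

section QuadraticForms

open Matrix

variable {n : ℕ} {K : Type*} [CommRing K]

/-- The vector of the coordinates. -/
def coords (n : ℕ) (K : Type*) [CommRing K] : Fin (n + 1) → MvPowerSeries (Fin (n + 1)) K :=
  fun i => MvPowerSeries.X i

lemma quadForm_eq (M : Matrix (Fin (n + 1)) (Fin (n + 1)) (MvPowerSeries (Fin (n + 1)) K)) :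
    quadForm M = coords n K ⬝ᵥ M *ᵥ coords n K := by
  simp [quadForm, dotProduct, mulVec, coords, Finset.mul_sum, mul_assoc]

lemma quadForm_transpose (M : Matrix (Fin (n + 1)) (Fin (n + 1)) (MvPowerSeries (Fin (n + 1)) K)) :
    quadForm Mᵀ = quadForm M := by
  rw [quadForm, quadForm, Finset.sum_comm]
  exact Finset.sum_congr rfl fun i _ => Finset.sum_congr rfl fun j _ => by
    rw [transpose_apply]; ring

lemma quadForm_eq_zero_of_antisymm [Algebra ℂ K]
    {M : Matrix (Fin (n + 1)) (Fin (n + 1)) (MvPowerSeries (Fin (n + 1)) K)} (h : Mᵀ = -M) :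
    quadForm M = 0 := by
  have h1 := quadForm_transpose M
  rw [h, quadForm_eq, neg_mulVec, dotProduct_neg, ← quadForm_eq] at h1
  have h2 : (2 : ℂ) • quadForm M = 0 := by
    rw [two_smul]; nth_rewrite 1 [← h1]; simp
  have h3 := congrArg (fun p => (1 / 2 : ℂ) • p) h2
  simpa [smul_smul] using h3

lemma derivation_dotProduct {R : Type*} [CommRing R] [Algebra K R] (δ : Derivation K R R)
    (u v : Fin (n + 1) → R) :
    δ (u ⬝ᵥ v) = (δ ∘ u) ⬝ᵥ v + u ⬝ᵥ (δ ∘ v) := by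
  simp only [dotProduct, map_sum, Derivation.leibniz, smul_eq_mul, Function.comp,
    ← Finset.sum_add_distrib]
  exact Finset.sum_congr rfl fun i _ => by ring

lemma derivation_mulVec {R : Type*} [CommRing R] [Algebra K R] (δ : Derivation K R R)
    (M : Matrix (Fin (n + 1)) (Fin (n + 1)) R) (v : Fin (n + 1) → R) :
    δ ∘ (M *ᵥ v) = M.map δ *ᵥ v + M *ᵥ (δ ∘ v) := by
  funext i
  change δ (M i ⬝ᵥ v) = _
  rw [derivation_dotProduct]
  rfl

/-- Symmetry of `M` merges the two terms in which `δ` hits a coordinate. -/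
lemma derivation_quadForm (δ : Derivation K (MvPowerSeries (Fin (n + 1)) K)
      (MvPowerSeries (Fin (n + 1)) K))
    {M : Matrix (Fin (n + 1)) (Fin (n + 1)) (MvPowerSeries (Fin (n + 1)) K)} (hM : Mᵀ = M) :
    δ (quadForm M) = quadForm (M.map δ) + 2 * ((δ ∘ coords n K) ⬝ᵥ M *ᵥ coords n K) := by
  have h : coords n K ⬝ᵥ M *ᵥ (δ ∘ coords n K) = (δ ∘ coords n K) ⬝ᵥ M *ᵥ coords n K := by
    rw [dotProduct_mulVec, ← mulVec_transpose, hM, dotProduct_comm]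
  rw [quadForm_eq, derivation_dotProduct, derivation_mulVec, dotProduct_add, h, quadForm_eq]
  ring

end QuadraticForms

/-! ### Phase and determinant under the Hamiltonian fields and the Euler field -/

section Phase

open Matrix

variable {n : ℕ} {Λ : Bivector n} {A : Matrix (Fin (n + 1)) (Fin (n + 1)) ℂ}

/-- The matrix `ΛA`. -/
def lambdaMul (Λ : Bivector n) (A : Matrix (Fin (n + 1)) (Fin (n + 1)) ℂ) :
    Matrix (Fin (n + 1)) (Fin (n + 1)) (MvPowerSeries (Fin (n + 1)) ℂ) :=
  lambdaMatrix Λ * constMatrix ℂ A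

lemma supportedIn_C {σ K : Type*} [CommRing K] (c : K) :
    SupportedIn {0} (MvPowerSeries.C c : MvPowerSeries σ K) := by
  classical
  intro d hd
  rw [MvPowerSeries.coeff_C] at hd
  have : d = 0 := by by_contra h; simp [h] at hd
  simp [this]

lemma supportedIn_lambdaMatrix (hΛ : ∀ a b, (Λ a b).IsHomogeneous 2) (a b : Fin (n + 1)) :
    SupportedIn {2} (lambdaMatrix Λ a b) := supportedIn_of_isHomogeneous (hΛ a b)

lemma supportedIn_lambdaMul (hΛ : ∀ a b, (Λ a b).IsHomogeneous 2) (i j : Fin (n + 1)) :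
    SupportedIn {2} (lambdaMul Λ A i j) := by
  rw [lambdaMul, Matrix.mul_apply]
  refine SupportedIn.sum fun l _ =>
    ((supportedIn_lambdaMatrix hΛ i l).mul (supportedIn_C (algebraMap ℂ ℂ (A l j)))).mono ?_
  rintro _ ⟨x, rfl, y, rfl, rfl⟩
  simp

lemma hasNoConstantTerm_lambdaMul (hΛ : ∀ a b, (Λ a b).IsHomogeneous 2) :
    HasNoConstantTerm (lambdaMul Λ A) := fun i j =>
  (supportedIn_lambdaMul hΛ i j).mono fun x hx => by
    obtain rfl : x = 2 := hx
    simp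

/-- The matrix `tanh (ΛA)`. -/
def tanhMatrix (Λ : Bivector n) (A : Matrix (Fin (n + 1)) (Fin (n + 1)) ℂ) :
    Matrix (Fin (n + 1)) (Fin (n + 1)) (MvPowerSeries (Fin (n + 1)) ℂ) :=
  matrixValue tanhSeries (lambdaMul Λ A)

lemma phaseMatrix_eq : phaseMatrix Λ A =
    constMatrix ℂ A * matrixValue tanhQuotSeries (lambdaMul Λ A) := rfl

/-- Since `tanh x` is `x` times the series in the phase matrix, the cancelled `Λ` is restored; `Λ`
itself may be degenerate. -/
lemma lambdaMatrix_mul_phaseMatrix (hΛ : ∀ a b, (Λ a b).IsHomogeneous 2) :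
    lambdaMatrix Λ * phaseMatrix Λ A = tanhMatrix Λ A := by
  have hX := hasNoConstantTerm_lambdaMul (A := A) hΛ
  rw [phaseMatrix_eq, ← mul_assoc, tanhMatrix, tanhSeries, matrixValue_mul hX, matrixValue_X hX]
  rfl

theorem lambdaMatrix_mul_phaseMatrix_eq_tan (hΛ : ∀ a b, (Λ a b).IsHomogeneous 2) :
    lambdaMatrix Λ * phaseMatrix Λ A = (1 / Complex.I) •
      matrixValue tanSeries (Complex.I • (lambdaMatrix Λ * constMatrix ℂ A)) := by
  rw [lambdaMatrix_mul_phaseMatrix hΛ, matrixValue_smul_matrix, rescale_tanSeries]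
  change _ = (1 / Complex.I) • matrixValue _ (lambdaMul Λ A)
  rw [matrixValue_smul (hasNoConstantTerm_lambdaMul hΛ), smul_smul, one_div,
    inv_mul_cancel₀ Complex.I_ne_zero, one_smul, tanhMatrix]

lemma constMatrix_transpose {K : Type*} [CommRing K] [Algebra ℂ K] (hA : A.IsSymm) :
    (constMatrix K A)ᵀ = constMatrix K A := by
  rw [constMatrix, ← transpose_map, hA.eq]

lemma lambdaMatrix_transpose (hΛ : ∀ a b, Λ a b = -Λ b a) :
    (lambdaMatrix Λ)ᵀ = -lambdaMatrix Λ := by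
  refine Matrix.ext fun i j => ?_
  rw [transpose_apply, neg_apply, lambdaMatrix, lambdaMatrix, hΛ j i]
  exact map_neg (MvPolynomial.coeToMvPowerSeries.ringHom (R := ℂ)) (Λ i j)

/-- Symmetry of `A` and skewness of `Λ` give `(ΛA)ᵀ A = -A (ΛA)`, one sign per factor. Hence `A
c(ΛA)` is symmetric for even `c` and antisymmetric for odd `c`. -/
lemma constMatrix_mul_pow_transpose (hΛ : ∀ a b, Λ a b = -Λ b a) (hA : A.IsSymm) (k : ℕ) :
    (constMatrix ℂ A * lambdaMul Λ A ^ k)ᵀ =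
      (-1 : ℂ) ^ k • (constMatrix ℂ A * lambdaMul Λ A ^ k) := by
  have h : (lambdaMul Λ A)ᵀ * constMatrix ℂ A = -(constMatrix ℂ A * lambdaMul Λ A) := by
    rw [lambdaMul, transpose_mul, constMatrix_transpose hA, lambdaMatrix_transpose hΛ]
    simp [mul_assoc]
  rw [transpose_mul, transpose_pow, constMatrix_transpose hA]
  induction k with
  | zero => simp
  | succ k ih =>
    rw [pow_succ', mul_assoc, ih, Matrix.mul_smul, ← mul_assoc, h, pow_succ', pow_succ',
      mul_smul, neg_one_smul, neg_mul, smul_neg, mul_assoc]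

lemma coeff_constMatrix_mul_matrixValue (hΛ : ∀ a b, (Λ a b).IsHomogeneous 2) (c : PowerSeries ℂ)
    (i j : Fin (n + 1)) (d : Fin (n + 1) →₀ ℕ) :
    MvPowerSeries.coeff d ((constMatrix ℂ A * matrixValue c (lambdaMul Λ A)) i j) =
      ∑ k ∈ Finset.range (d.degree + 1), PowerSeries.coeff k c *
        MvPowerSeries.coeff d ((constMatrix ℂ A * lambdaMul Λ A ^ k) i j) := by
  rw [Matrix.mul_apply, map_sum, Finset.sum_congr rfl fun l _ => coeff_mul_congr (fun e _ => rfl)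
    (fun e he => coeff_matrixValue_eq_truncValue (hasNoConstantTerm_lambdaMul hΛ) c l j
      (Nat.lt_succ_of_le he)), ← map_sum, ← Matrix.mul_apply, truncValue, Finset.mul_sum]
  simp [Matrix.sum_apply, map_sum]

/-- The transpose of `A c(ΛA)` is `A c(-ΛA)`. -/
lemma constMatrix_mul_matrixValue_transpose (hΛ : IsHolomorphicPoisson Λ) (hA : A.IsSymm)
    (c : PowerSeries ℂ) :
    (constMatrix ℂ A * matrixValue c (lambdaMul Λ A))ᵀ =
      constMatrix ℂ A * matrixValue (PowerSeries.rescale (-1) c) (lambdaMul Λ A) := by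
  ext i j d
  rw [transpose_apply, coeff_constMatrix_mul_matrixValue hΛ.homogeneous,
    coeff_constMatrix_mul_matrixValue hΛ.homogeneous]
  refine Finset.sum_congr rfl fun k _ => ?_
  rw [← transpose_apply (constMatrix ℂ A * lambdaMul Λ A ^ k),
    constMatrix_mul_pow_transpose hΛ.skew hA, PowerSeries.coeff_rescale, Matrix.smul_apply,
    MvPowerSeries.coeff_smul]
  ring

lemma phaseMatrix_transpose (hΛ : IsHolomorphicPoisson Λ) (hA : A.IsSymm) :
    (phaseMatrix Λ A)ᵀ = phaseMatrix Λ A := by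
  rw [phaseMatrix_eq, constMatrix_mul_matrixValue_transpose hΛ hA, rescale_neg_one_tanhQuotSeries]

lemma constMatrix_mul_tanhMatrix_transpose (hΛ : IsHolomorphicPoisson Λ) (hA : A.IsSymm) :
    (constMatrix ℂ A * tanhMatrix Λ A)ᵀ = -(constMatrix ℂ A * tanhMatrix Λ A) := by
  rw [tanhMatrix, constMatrix_mul_matrixValue_transpose hΛ hA, rescale_neg_one_tanhSeries,
    ← neg_one_smul ℂ, matrixValue_smul (hasNoConstantTerm_lambdaMul hΛ.homogeneous),
    neg_one_smul, mul_neg]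

/-- The vector fields `∑_b Λ^{ab} ∂_b`. -/
def hamiltonian (Λ : Bivector n) (a : Fin (n + 1)) : Derivation ℂ (MvPowerSeries (Fin (n + 1)) ℂ)
    (MvPowerSeries (Fin (n + 1)) ℂ) :=
  vectorField fun b => lambdaMatrix Λ a b

lemma constMatrix_map_derivation {K : Type*} [CommRing K] [Algebra ℂ K]
    (δ : Derivation K (MvPowerSeries (Fin (n + 1)) K) (MvPowerSeries (Fin (n + 1)) K)) :
    (constMatrix K A).map δ = 0 := by
  refine Matrix.ext fun i j => ?_
  exact Derivation.map_algebraMap δ (algebraMap ℂ K (A i j))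

lemma hamiltonian_lambdaMatrix (hΛ : IsFlatBivector Λ) (a b c : Fin (n + 1)) :
    hamiltonian Λ a (lambdaMatrix Λ b c) = 0 := by
  rw [hamiltonian, vectorField_apply]
  have := congrArg (MvPolynomial.coeToMvPowerSeries.ringHom (R := ℂ)) (hΛ.right a b c)
  simpa [MvPowerSeries.pderiv_coe, lambdaMatrix] using this

lemma hamiltonian_lambdaMul (hΛ : IsFlatBivector Λ) (a : Fin (n + 1)) :
    (lambdaMul Λ A).map (hamiltonian Λ a) = 0 := by
  have h : (lambdaMatrix Λ).map (hamiltonian Λ a) = 0 := by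
    refine Matrix.ext fun i j => ?_
    exact hamiltonian_lambdaMatrix hΛ a i j
  rw [lambdaMul, map_derivation_mul, constMatrix_map_derivation, h, zero_mul, mul_zero, add_zero]

lemma hamiltonian_matrixValue (hΛ : ∀ a b, (Λ a b).IsHomogeneous 2) (hflat : IsFlatBivector Λ)
    (c : PowerSeries ℂ) (a : Fin (n + 1)) :
    (matrixValue c (lambdaMul Λ A)).map (hamiltonian Λ a) = 0 :=
  map_vectorField_matrixValue_of_eq_zero (hasNoConstantTerm_lambdaMul hΛ) c
    (hamiltonian_lambdaMul hflat a)

lemma hamiltonian_coords (a : Fin (n + 1)) :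
    hamiltonian Λ a ∘ coords n ℂ = lambdaMatrix Λ a := by
  funext b
  rw [Function.comp, hamiltonian, vectorField_apply, Finset.sum_eq_single b]
  · simp [coords]
  · intro c _ hc
    rw [coords, MvPowerSeries.pderiv_X_of_ne (Ne.symm hc), mul_zero]
  · simp

/-- The vector `tanh (ΛA) Z`. -/
def tanhVec (Λ : Bivector n) (A : Matrix (Fin (n + 1)) (Fin (n + 1)) ℂ) :
    Fin (n + 1) → MvPowerSeries (Fin (n + 1)) ℂ :=
  tanhMatrix Λ A *ᵥ coords n ℂ

/-- The field kills the phase matrix and differentiates only the two outer coordinates. This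
produces `Λ` times the phase matrix, which is `tanh (ΛA)`. -/
lemma hamiltonian_quadForm_phaseMatrix (hΛ : IsHolomorphicPoisson Λ) (hflat : IsFlatBivector Λ)
    (hA : A.IsSymm) (a : Fin (n + 1)) :
    hamiltonian Λ a (quadForm (phaseMatrix Λ A)) = 2 * tanhVec Λ A a := by
  rw [derivation_quadForm _ (phaseMatrix_transpose hΛ hA), phaseMatrix_eq, map_derivation_mul,
    hamiltonian_matrixValue hΛ.homogeneous hflat, constMatrix_map_derivation, zero_mul, mul_zero,
    add_zero, hamiltonian_coords, ← phaseMatrix_eq, tanhVec, ← lambdaMatrix_mul_phaseMatrix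
    hΛ.homogeneous, ← mulVec_mulVec, quadForm_eq, zero_mulVec, dotProduct_zero, zero_add]
  rfl

lemma hamiltonian_tanhVec (hΛ : ∀ a b, (Λ a b).IsHomogeneous 2) (hflat : IsFlatBivector Λ)
    (a c : Fin (n + 1)) :
    hamiltonian Λ a (tanhVec Λ A c) = (lambdaMatrix Λ * (tanhMatrix Λ A)ᵀ) a c := by
  have h := congrFun (derivation_mulVec (hamiltonian Λ a) (tanhMatrix Λ A) (coords n ℂ)) c
  rw [hamiltonian_coords, tanhMatrix, hamiltonian_matrixValue hΛ hflat, zero_mulVec, zero_add,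
    ← tanhMatrix] at h
  rw [tanhVec]
  refine h.trans ?_
  rw [Matrix.mul_apply']
  exact dotProduct_comm _ _

lemma halfEuler_lambdaMul (hΛ : ∀ a b, (Λ a b).IsHomogeneous 2) :
    (lambdaMul Λ A).map (halfEuler (Fin (n + 1)) ℂ) = lambdaMul Λ A := by
  refine Matrix.ext fun i j => ?_
  exact (supportedIn_lambdaMul hΛ i j).halfEuler

lemma halfEuler_matrixValue (hΛ : ∀ a b, (Λ a b).IsHomogeneous 2) (c : PowerSeries ℂ) :
    (matrixValue c (lambdaMul Λ A)).map (halfEuler (Fin (n + 1)) ℂ) =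
      matrixValue (PowerSeries.X * PowerSeries.derivative ℂ c) (lambdaMul Λ A) :=
  map_vectorField_matrixValue_of_eq_self (hasNoConstantTerm_lambdaMul hΛ) c
    (halfEuler_lambdaMul hΛ)

/-- With `q = tanh x / x`, the two coordinates contribute `q` and the matrix contributes `x q'`;
together they give `1 - tanh²`. -/
lemma halfEuler_quadForm_phaseMatrix (hΛ : IsHolomorphicPoisson Λ) (hA : A.IsSymm) :
    halfEuler (Fin (n + 1)) ℂ (quadForm (phaseMatrix Λ A)) = quadForm (constMatrix ℂ A) -
      quadForm (constMatrix ℂ A * (tanhMatrix Λ A * tanhMatrix Λ A)) := by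
  have hX := hasNoConstantTerm_lambdaMul (A := A) hΛ.homogeneous
  have h1 : halfEuler (Fin (n + 1)) ℂ ∘ coords n ℂ = (1 / 2 : ℂ) • coords n ℂ :=
    funext fun a => halfEuler_X a
  have h2 : (2 : MvPowerSeries (Fin (n + 1)) ℂ) * ((1 / 2 : ℂ) • quadForm (phaseMatrix Λ A)) =
      quadForm (phaseMatrix Λ A) := by
    rw [mul_smul_comm, two_mul, ← two_smul ℂ, smul_smul]
    norm_num
  rw [derivation_quadForm _ (phaseMatrix_transpose hΛ hA), h1, smul_dotProduct, ← quadForm_eq, h2,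
    phaseMatrix_eq, map_derivation_mul, constMatrix_map_derivation, zero_mul, zero_add,
    halfEuler_matrixValue hΛ.homogeneous, quadForm_eq, quadForm_eq, quadForm_eq, quadForm_eq,
    ← dotProduct_add, ← add_mulVec, ← mul_add, ← matrixValue_add hX,
    add_comm (PowerSeries.X * _),
    derivative_tanhSeries', matrixValue_sub hX, matrixValue_one hX, pow_two, matrixValue_mul hX,
    mul_sub, mul_one, sub_mulVec, dotProduct_sub]
  rfl

lemma coshMatrix_eq (hΛ : ∀ a b, (Λ a b).IsHomogeneous 2) :
    coshMatrix Λ A = matrixValue coshSeries (lambdaMul Λ A) := by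
  have hX := hasNoConstantTerm_lambdaMul (A := A) hΛ
  rw [coshSeries, matrixValue_smul hX, matrixValue_add hX, ← matrixValue_neg_matrix]
  rfl

lemma coshMatrix_mul_inv (hΛ : ∀ a b, (Λ a b).IsHomogeneous 2) :
    coshMatrix Λ A * matrixValue coshSeries⁻¹ (lambdaMul Λ A) = 1 := by
  have hX := hasNoConstantTerm_lambdaMul (A := A) hΛ
  rw [coshMatrix_eq hΛ, ← matrixValue_mul hX, PowerSeries.mul_inv_cancel, matrixValue_one hX]
  rw [constantCoeff_coshSeries]
  exact one_ne_zero

/-- The factor `0` puts the vanishing into the form `u * t` expected by `IsInvSqrt.derivation`. -/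
lemma hamiltonian_det_coshMatrix (hΛ : ∀ a b, (Λ a b).IsHomogeneous 2) (hflat : IsFlatBivector Λ)
    (a : Fin (n + 1)) : hamiltonian Λ a (coshMatrix Λ A).det = (coshMatrix Λ A).det * 0 := by
  rw [derivation_det _ _ _ (coshMatrix_mul_inv hΛ), coshMatrix_eq hΛ,
    hamiltonian_matrixValue hΛ hflat, mul_zero, trace_zero]

/-- Jacobi's formula puts under the trace the series `x cosh' / cosh = x tanh x`. -/
lemma halfEuler_det_coshMatrix (hΛ : ∀ a b, (Λ a b).IsHomogeneous 2) :
    halfEuler (Fin (n + 1)) ℂ (coshMatrix Λ A).det =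
      (coshMatrix Λ A).det * (lambdaMul Λ A * tanhMatrix Λ A).trace := by
  have hX := hasNoConstantTerm_lambdaMul (A := A) hΛ
  have h : lambdaMul Λ A * tanhMatrix Λ A =
      matrixValue (PowerSeries.X * tanhSeries) (lambdaMul Λ A) := by
    rw [matrixValue_mul hX, matrixValue_X hX, tanhMatrix]
  rw [derivation_det _ _ _ (coshMatrix_mul_inv hΛ), coshMatrix_eq hΛ, halfEuler_matrixValue hΛ,
    ← matrixValue_mul hX, h, derivative_coshSeries, ← tanhSeries_mul_coshSeries]
  congr 3
  rw [mul_comm, ← mul_assoc, mul_assoc, PowerSeries.mul_inv_cancel, mul_one]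
  rw [constantCoeff_coshSeries]
  exact one_ne_zero

lemma constantCoeff_det_coshMatrix (hΛ : ∀ a b, (Λ a b).IsHomogeneous 2) :
    MvPowerSeries.constantCoeff (coshMatrix Λ A).det = 1 := by
  have h : (MvPowerSeries.constantCoeff (σ := Fin (n + 1)) (R := ℂ)).mapMatrix (coshMatrix Λ A)
      = 1 := by
    ext i j
    rw [coshMatrix_eq hΛ, RingHom.mapMatrix_apply, map_apply,
      ← MvPowerSeries.coeff_zero_eq_constantCoeff_apply,
      coeff_matrixValue (hasNoConstantTerm_lambdaMul hΛ) coshSeries i j (N := 1) (by simp)]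
    simp only [Finset.range_one, Finset.sum_singleton, pow_zero]
    rw [PowerSeries.coeff_zero_eq_constantCoeff_apply, constantCoeff_coshSeries, one_mul,
      one_apply, one_apply]
    split_ifs <;> simp
  rw [RingHom.map_det, h, det_one]

end Phase

/-! ### Star multiplication by a quadratic form -/

section QuadraticStar

open Matrix

variable {n : ℕ} {K : Type*} [CommRing K] [Algebra ℂ K] {Λ : Bivector n}
variable {A : Matrix (Fin (n + 1)) (Fin (n + 1)) ℂ}

lemma pderiv_coords (a : Fin (n + 1)) :
    MvPowerSeries.pderiv K a ∘ coords n K = Pi.single a 1 := by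
  funext b
  rw [Function.comp, coords, MvPowerSeries.pderiv_X, Pi.single_apply, eq_comm]

lemma pderiv_quadForm_constMatrix (hA : A.IsSymm) (a : Fin (n + 1)) :
    MvPowerSeries.pderiv K a (quadForm (constMatrix K A)) =
      2 * (constMatrix K A *ᵥ coords n K) a := by
  rw [derivation_quadForm _ (constMatrix_transpose hA), constMatrix_map_derivation,
    pderiv_coords, single_one_dotProduct, quadForm_eq, zero_mulVec, dotProduct_zero, zero_add]

lemma pderiv_pderiv_quadForm_constMatrix (hA : A.IsSymm) (a c : Fin (n + 1)) :
    MvPowerSeries.pderiv K c (MvPowerSeries.pderiv K a (quadForm (constMatrix K A))) =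
      2 * constMatrix K A a c := by
  have h := congrFun (derivation_mulVec (MvPowerSeries.pderiv K c) (constMatrix K A)
    (coords n K)) a
  rw [constMatrix_map_derivation, pderiv_coords, zero_mulVec, zero_add, mulVec_single_one] at h
  rw [pderiv_quadForm_constMatrix hA, two_mul, map_add, two_mul]
  exact congrArg₂ (· + ·) h h

lemma pderiv_pderiv_pderiv_quadForm_constMatrix (hA : A.IsSymm) (a b c : Fin (n + 1)) :
    MvPowerSeries.pderiv K a (MvPowerSeries.pderiv K b
      (MvPowerSeries.pderiv K c (quadForm (constMatrix K A)))) = 0 := by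
  have h : MvPowerSeries.pderiv K a (constMatrix K A c b) = 0 :=
    congrFun₂ (constMatrix_map_derivation (MvPowerSeries.pderiv K a)) c b
  rw [pderiv_pderiv_quadForm_constMatrix hA, two_mul, map_add, h, add_zero]

lemma bidiffSeries_one (f g : MvPowerSeries (Fin (n + 1)) K) :
    bidiffSeries Λ 1 f g =
      ∑ a, MvPowerSeries.pderiv K a f * vectorField (coeffSeries K Λ a) g := by
  rw [bidiffSeries, bidiff_succ pderiv_comm]
  refine Finset.sum_congr rfl fun a _ => ?_
  rw [vectorField_apply, Finset.mul_sum]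
  refine Finset.sum_congr rfl fun b _ => ?_
  rw [bidiff_zero]
  ring

/-- By flatness the outer field passes the coefficients of the inner one. Normally ordered
second-order terms therefore become compositions of vector fields. -/
lemma vectorField_vectorField (hflat : IsFlatBivector Λ) (a c : Fin (n + 1))
    (g : MvPowerSeries (Fin (n + 1)) K) :
    vectorField (coeffSeries K Λ c) (vectorField (coeffSeries K Λ a) g) =
      ∑ b, coeffSeries K Λ a b * vectorField (coeffSeries K Λ c) (MvPowerSeries.pderiv K b g) := by
  rw [vectorField_apply (coeffSeries K Λ a), map_sum]
  refine Finset.sum_congr rfl fun b _ => ?_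
  have h := (hflat.isFlat_coeffSeries (K := K)).right c a b
  rw [← vectorField_apply] at h
  rw [Derivation.leibniz, h, smul_zero, add_zero, smul_eq_mul]

lemma bidiffSeries_two (hflat : IsFlatBivector Λ) (f g : MvPowerSeries (Fin (n + 1)) K) :
    bidiffSeries Λ 2 f g = ∑ a, ∑ c, MvPowerSeries.pderiv K c (MvPowerSeries.pderiv K a f) *
      vectorField (coeffSeries K Λ c) (vectorField (coeffSeries K Λ a) g) := by
  rw [bidiffSeries, bidiff_succ pderiv_comm]
  refine Finset.sum_congr rfl fun a _ => ?_
  simp_rw [vectorField_vectorField hflat, Finset.mul_sum]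
  rw [Finset.sum_comm]
  refine Finset.sum_congr rfl fun b _ => ?_
  have h := bidiffSeries_one (Λ := Λ) (MvPowerSeries.pderiv K a f) (MvPowerSeries.pderiv K b g)
  rw [bidiffSeries] at h
  rw [h, Finset.mul_sum]
  exact Finset.sum_congr rfl fun c _ => by ring

lemma bidiffSeries_quadForm_eq_zero (hA : A.IsSymm) (k : ℕ) (g : MvPowerSeries (Fin (n + 1)) K) :
    bidiffSeries Λ (k + 3) (quadForm (constMatrix K A)) g = 0 := by
  have h0 : ∀ g : MvPowerSeries (Fin (n + 1)) K,
      bidiff (fun a => MvPowerSeries.pderiv K a) (coeffSeries K Λ) k 0 g = 0 := by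
    intro g
    rw [bidiff_eq_bidiffLin, map_zero, LinearMap.zero_apply]
  simp [bidiffSeries, bidiff_succ pderiv_comm, pderiv_pderiv_pderiv_quadForm_constMatrix hA, h0]

/-- The star product with a quadratic form is a differential operator of second order. -/
lemma formalStar_quadForm (hΛ : ∀ a b, (Λ a b).IsHomogeneous 2) (hflat : IsFlatBivector Λ)
    (hA : A.IsSymm) {μ ν : K} (hμ : μ * ν = 1) (g : MvPowerSeries (Fin (n + 1)) K) :
    formalStar Λ μ (ν • quadForm (constMatrix K A)) g =
      ν • (quadForm (constMatrix K A) * g) +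
      ∑ a, (constMatrix K A *ᵥ coords n K) a * vectorField (coeffSeries K Λ a) g +
      (1 / 4 : ℂ) • μ • ∑ a, ∑ c, constMatrix K A a c *
        vectorField (coeffSeries K Λ c) (vectorField (coeffSeries K Λ a) g) := by
  have hk : ∀ k, bidiffSeries Λ k (ν • quadForm (constMatrix K A)) g =
      ν • bidiffSeries Λ k (quadForm (constMatrix K A)) g := fun k => by
    simp only [bidiffSeries, bidiff_eq_bidiffLin, map_smul, LinearMap.smul_apply]
  have hsum : formalStar Λ μ (ν • quadForm (constMatrix K A)) g = ∑ k ∈ Finset.range 3,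
      starWeight μ k • ν • bidiffSeries Λ k (quadForm (constMatrix K A)) g := by
    ext d
    rw [coeff_formalStar μ hΛ (N := d.degree + 3) (by omega), map_sum]
    simp only [hk, ← MvPowerSeries.coeff_smul]
    symm
    refine Finset.sum_subset (Finset.range_subset_range.2 (by omega)) fun k _ hk3 => ?_
    obtain ⟨j, rfl⟩ : ∃ j, k = j + 3 := ⟨k - 3, by simp at hk3; omega⟩
    rw [bidiffSeries_quadForm_eq_zero hA, smul_zero, smul_zero, map_zero]
  -- With `μ ν = 1` the weights of orders one and two become `1/2` and `μ/8`; the factor `2` from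
  -- the derivatives of the quadratic form turns them into `1` and `μ/4`.
  have hw1 : starWeight μ 1 * ν = algebraMap ℂ K (1 / 2) := by
    rw [starWeight, smul_mul_assoc, pow_one μ, hμ, Algebra.algebraMap_eq_smul_one]
    norm_num
  have hw2 : starWeight μ 2 * ν = algebraMap ℂ K (1 / 8) * μ := by
    rw [starWeight, smul_mul_assoc, pow_two μ, mul_assoc μ, hμ, mul_one, ← Algebra.smul_def]
    norm_num [Nat.factorial]
  rw [hsum, Finset.sum_range_succ, Finset.sum_range_succ, Finset.sum_range_one, smul_smul,
    smul_smul, smul_smul, starWeight_zero, one_mul, hw1, hw2, mul_smul, algebraMap_smul,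
    algebraMap_smul, bidiffSeries_one, bidiffSeries_two hflat, bidiffSeries, bidiff_zero]
  simp only [pderiv_pderiv_quadForm_constMatrix hA]
  simp only [pderiv_quadForm_constMatrix hA, mul_assoc, ← Finset.mul_sum]
  refine congrArg₂ (· + ·) (congrArg₂ (· + ·) rfl ?_) ?_
  · rw [two_mul, ← two_smul ℂ, smul_smul]
    norm_num
  · rw [two_mul, ← two_smul ℂ, smul_comm μ (2 : ℂ), smul_smul]
    norm_num

end QuadraticStar

/-! ### Transport of identities over `ℂ` to a coefficient algebra -/

section BaseChange

variable {n : ℕ} {K : Type*} [CommRing K] [Algebra ℂ K] {Λ : Bivector n}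

lemma map_pderiv {σ R S : Type*} [CommRing R] [CommRing S] (φ : R →+* S) (a : σ)
    (f : MvPowerSeries σ R) : MvPowerSeries.map φ (MvPowerSeries.pderiv R a f) =
      MvPowerSeries.pderiv S a (MvPowerSeries.map φ f) := by
  ext d
  simp [MvPowerSeries.coeff_pderiv]

lemma map_vectorField {σ R S : Type*} [Fintype σ] [CommRing R] [CommRing S] (φ : R →+* S)
    (v : σ → MvPowerSeries σ R) (f : MvPowerSeries σ R) :
    MvPowerSeries.map φ (vectorField v f) =
      vectorField (fun a => MvPowerSeries.map φ (v a)) (MvPowerSeries.map φ f) := by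
  simp [vectorField_apply, map_pderiv]

lemma coeffSeries_eq_map (a b : Fin (n + 1)) :
    coeffSeries K Λ a b = MvPowerSeries.map (algebraMap ℂ K) (lambdaMatrix Λ a b) := by
  ext d
  simp [coeffSeries, lambdaMatrix, MvPolynomial.coeff_map]

lemma map_hamiltonian (a : Fin (n + 1)) (f : MvPowerSeries (Fin (n + 1)) ℂ) :
    MvPowerSeries.map (algebraMap ℂ K) (hamiltonian Λ a f) =
      vectorField (coeffSeries K Λ a) (MvPowerSeries.map (algebraMap ℂ K) f) := by
  rw [hamiltonian, map_vectorField]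
  exact congrArg (fun v => vectorField v _) (funext fun b => (coeffSeries_eq_map a b).symm)

lemma map_halfEuler {σ : Type*} [Fintype σ] (f : MvPowerSeries σ ℂ) :
    MvPowerSeries.map (algebraMap ℂ K) (halfEuler σ ℂ f) =
      halfEuler σ K (MvPowerSeries.map (algebraMap ℂ K) f) := by
  ext d
  rw [MvPowerSeries.coeff_map, coeff_halfEuler, coeff_halfEuler, MvPowerSeries.coeff_map,
    smul_eq_mul, map_mul, Algebra.smul_def]

lemma map_constMatrix (A : Matrix (Fin (n + 1)) (Fin (n + 1)) ℂ) (i j : Fin (n + 1)) :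
    MvPowerSeries.map (algebraMap ℂ K) (constMatrix ℂ A i j) = constMatrix K A i j := by
  simp [constMatrix]

lemma map_coords (i : Fin (n + 1)) :
    MvPowerSeries.map (algebraMap ℂ K) (coords n ℂ i) = coords n K i := by
  simp [coords]

lemma map_quadForm_constMatrix (A : Matrix (Fin (n + 1)) (Fin (n + 1)) ℂ) :
    MvPowerSeries.map (algebraMap ℂ K) (quadForm (constMatrix ℂ A)) =
      quadForm (constMatrix K A) := by
  simp [quadForm, map_constMatrix]

lemma map_constMatrix_mulVec (A : Matrix (Fin (n + 1)) (Fin (n + 1)) ℂ) (a : Fin (n + 1)) :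
    MvPowerSeries.map (algebraMap ℂ K) ((Matrix.mulVec (constMatrix ℂ A) (coords n ℂ)) a) =
      (Matrix.mulVec (constMatrix K A) (coords n K)) a := by
  simp [Matrix.mulVec, dotProduct, map_constMatrix, map_coords]

end BaseChange

/-! ### The stationary equation of the closed form -/

section StaticEquation

open Matrix

variable {n : ℕ} {K : Type*} [CommRing K] [Algebra ℂ K] {Λ : Bivector n}
variable {A : Matrix (Fin (n + 1)) (Fin (n + 1)) ℂ}

/-- `A tanh (ΛA)` is antisymmetric, so its quadratic form vanishes; this removes the first-order
part of the star product. -/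
lemma sum_constMatrix_mul_tanhVec (hΛ : IsHolomorphicPoisson Λ) (hA : A.IsSymm) :
    ∑ a, (constMatrix ℂ A *ᵥ coords n ℂ) a * tanhVec Λ A a = 0 := by
  have h := quadForm_eq_zero_of_antisymm (constMatrix_mul_tanhMatrix_transpose hΛ hA)
  rw [quadForm_eq, ← mulVec_mulVec, dotProduct_mulVec, ← mulVec_transpose,
    constMatrix_transpose hA] at h
  exact h

lemma tanhMatrix_transpose_mul (hΛ : IsHolomorphicPoisson Λ) (hA : A.IsSymm) :
    (tanhMatrix Λ A)ᵀ * constMatrix ℂ A = -(constMatrix ℂ A * tanhMatrix Λ A) := by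
  rw [← constMatrix_mul_tanhMatrix_transpose hΛ hA, transpose_mul, constMatrix_transpose hA]

/-- Moving one transposed `tanh (ΛA)` across `A` costs the sign. The result is the `tanh²` term in
the Euler derivative of the phase. -/
lemma sum_constMatrix_mul_tanhVec_mul_tanhVec (hΛ : IsHolomorphicPoisson Λ) (hA : A.IsSymm) :
    ∑ a, ∑ c, constMatrix ℂ A a c * (tanhVec Λ A a * tanhVec Λ A c) =
      -quadForm (constMatrix ℂ A * (tanhMatrix Λ A * tanhMatrix Λ A)) := by
  have h : ∑ a, ∑ c, constMatrix ℂ A a c * (tanhVec Λ A a * tanhVec Λ A c) =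
      tanhVec Λ A ⬝ᵥ constMatrix ℂ A *ᵥ tanhVec Λ A := by
    simp only [dotProduct, mulVec, Finset.mul_sum]
    exact Finset.sum_congr rfl fun a _ => Finset.sum_congr rfl fun c _ => by ring
  rw [h, tanhVec, ← vecMul_transpose (tanhMatrix Λ A), ← dotProduct_mulVec, vecMul_transpose,
    mulVec_mulVec, mulVec_mulVec, ← mul_assoc, tanhMatrix_transpose_mul hΛ hA, neg_mul, neg_mulVec,
    dotProduct_neg, mul_assoc, quadForm_eq]

/-- The trace obtained here is the one in the Euler derivative of `det cosh (ΛA)`; it is what forces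
the power `-1/2` of the determinant. -/
lemma sum_constMatrix_mul_hamiltonian_tanhVec (hΛ : IsHolomorphicPoisson Λ)
    (hflat : IsFlatBivector Λ) (hA : A.IsSymm) :
    ∑ a, ∑ c, constMatrix ℂ A a c * hamiltonian Λ c (tanhVec Λ A a) =
      -(lambdaMul Λ A * tanhMatrix Λ A).trace := by
  have h : ∑ a, ∑ c, constMatrix ℂ A a c * hamiltonian Λ c (tanhVec Λ A a) =
      (constMatrix ℂ A * (lambdaMatrix Λ * (tanhMatrix Λ A)ᵀ)).trace := by
    simp only [hamiltonian_tanhVec hΛ.homogeneous hflat, trace, diag_apply, Matrix.mul_apply (M :=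
      constMatrix ℂ A)]
  rw [h, ← mul_assoc, trace_mul_comm, ← mul_assoc, tanhMatrix_transpose_mul hΛ hA, neg_mul,
    trace_neg, trace_mul_comm, ← mul_assoc, lambdaMul]

/-- On the closed form of the star exponential, half the Euler field acts as the star product with
the quadratic form. -/
lemma halfEuler_eq_formalStar (hΛ : IsHolomorphicPoisson Λ) (hflat : IsFlatBivector Λ)
    (hA : A.IsSymm) {μ ν : K} (hμ : μ * ν = 1) {D : MvPowerSeries (Fin (n + 1)) ℂ}
    (hD : IsInvSqrt D (coshMatrix Λ A).det) {g : MvPowerSeries (Fin (n + 1)) K}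
    (hφ : SupportedIn {x | 1 ≤ x} (ν • MvPowerSeries.map (algebraMap ℂ K)
      (quadForm (phaseMatrix Λ A))))
    (hg : g = MvPowerSeries.map (algebraMap ℂ K) D * (PowerSeries.exp ℂ).subst
      (ν • MvPowerSeries.map (algebraMap ℂ K) (quadForm (phaseMatrix Λ A)))) :
    halfEuler (Fin (n + 1)) K g = formalStar Λ μ (ν • quadForm (constMatrix K A)) g := by
  set φ := MvPowerSeries.map (σ := Fin (n + 1)) (algebraMap ℂ K) with hφdef
  set E := (PowerSeries.exp ℂ).subst (ν • φ (quadForm (phaseMatrix Λ A))) with hE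
  have hMN : MvPowerSeries.C (σ := Fin (n + 1)) μ * MvPowerSeries.C ν = 1 := by
    rw [← map_mul, hμ, map_one]
  have hderE : ∀ v, vectorField v E =
      MvPowerSeries.C ν * E * vectorField v (φ (quadForm (phaseMatrix Λ A))) := by
    intro v
    have h := vectorField_subst v hφ (PowerSeries.exp ℂ)
    rw [PowerSeries.derivative_exp, ← hE, Derivation.map_smul, mul_smul_comm,
      MvPowerSeries.smul_eq_C_mul] at h
    rw [h, mul_assoc]
  -- The Hamiltonian fields annihilate `D`, so only the exponential is differentiated.
  have hY : ∀ a, vectorField (coeffSeries K Λ a) g =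
      2 * MvPowerSeries.C ν * g * φ (tanhVec Λ A a) := by
    intro a
    have hDa : vectorField (coeffSeries K Λ a) (φ D) = 0 := by
      rw [hφdef, ← map_hamiltonian]
      have h := hD.derivation (hamiltonian Λ a)
        (hamiltonian_det_coshMatrix hΛ.homogeneous hflat a)
      rw [mul_zero, neg_zero, two_mul, ← two_smul ℂ] at h
      have h2 : hamiltonian Λ a D = 0 := (smul_eq_zero.1 h).resolve_left two_ne_zero
      rw [h2, map_zero]
    rw [hg, Derivation.leibniz, hDa, smul_zero, add_zero, hderE, hφdef, ← map_hamiltonian,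
      hamiltonian_quadForm_phaseMatrix hΛ hflat hA, map_mul, map_ofNat, smul_eq_mul]
    ring
  have hYY : ∀ a c, vectorField (coeffSeries K Λ c) (vectorField (coeffSeries K Λ a) g) =
      4 * MvPowerSeries.C ν * MvPowerSeries.C ν * g * (φ (tanhVec Λ A a) * φ (tanhVec Λ A c)) +
        2 * MvPowerSeries.C ν * g * φ (hamiltonian Λ c (tanhVec Λ A a)) := by
    intro a c
    have h : (2 * MvPowerSeries.C ν : MvPowerSeries (Fin (n + 1)) K) =
        algebraMap K (MvPowerSeries (Fin (n + 1)) K) (2 * ν) := by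
      rw [map_mul, map_ofNat]
      rfl
    rw [hY a, h, mul_assoc, ← Algebra.smul_def, Derivation.map_smul, Derivation.leibniz, hY c,
      hφdef, map_hamiltonian, Algebra.smul_def, ← h, smul_eq_mul, smul_eq_mul]
    ring
  have h1 := congrArg φ (sum_constMatrix_mul_tanhVec hΛ hA)
  have h2 := congrArg φ (sum_constMatrix_mul_tanhVec_mul_tanhVec hΛ hA)
  have h3 := congrArg φ (sum_constMatrix_mul_hamiltonian_tanhVec hΛ hflat hA)
  have h4 := congrArg φ (halfEuler_quadForm_phaseMatrix hΛ hA)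
  have h5 := congrArg φ (hD.derivation _ (halfEuler_det_coshMatrix hΛ.homogeneous))
  simp only [map_sum, map_mul, map_zero, map_neg, map_sub, map_ofNat, hφdef, map_halfEuler,
    map_constMatrix, map_constMatrix_mulVec, map_quadForm_constMatrix] at h1 h2 h3 h4 h5
  simp only [← hφdef] at h1 h2 h3 h4 h5
  have hs1 : ∑ a, (constMatrix K A *ᵥ coords n K) a * vectorField (coeffSeries K Λ a) g = 0 := by
    rw [← mul_zero (2 * MvPowerSeries.C ν * g), ← h1, Finset.mul_sum]
    exact Finset.sum_congr rfl fun a _ => by rw [hY]; ring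
  have hs2 : ∑ a, ∑ c, constMatrix K A a c *
        vectorField (coeffSeries K Λ c) (vectorField (coeffSeries K Λ a) g) =
      4 * MvPowerSeries.C ν * MvPowerSeries.C ν * g * -φ (quadForm (constMatrix ℂ A *
        (tanhMatrix Λ A * tanhMatrix Λ A))) +
      2 * MvPowerSeries.C ν * g * -φ (lambdaMul Λ A * tanhMatrix Λ A).trace := by
    rw [← h2, ← h3, Finset.mul_sum, Finset.mul_sum, ← Finset.sum_add_distrib]
    refine Finset.sum_congr rfl fun a _ => ?_
    rw [Finset.mul_sum, Finset.mul_sum, ← Finset.sum_add_distrib]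
    exact Finset.sum_congr rfl fun c _ => by rw [hYY]; ring
  have hE' : halfEuler (Fin (n + 1)) K g = φ D * (MvPowerSeries.C ν * E *
      halfEuler (Fin (n + 1)) K (φ (quadForm (phaseMatrix Λ A)))) +
      E * halfEuler (Fin (n + 1)) K (φ D) := by
    rw [hg, Derivation.leibniz, smul_eq_mul, smul_eq_mul]
    congr 2
    exact hderE _
  -- Multiplying by four clears the complex scalar `1/4`, leaving an identity of commutative rings
  -- for the last line.
  have hquarter : ∀ x : MvPowerSeries (Fin (n + 1)) K, 4 * ((1 / 4 : ℂ) • x) = x := fun x => by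
    rw [mul_smul_comm, show (4 : MvPowerSeries (Fin (n + 1)) K) = algebraMap ℂ _ 4 from
      (map_ofNat (algebraMap ℂ _) 4).symm,
      ← Algebra.smul_def, smul_smul]
    norm_num
  have h4inj : ∀ x y : MvPowerSeries (Fin (n + 1)) K, 4 * x = 4 * y → x = y := fun x y h => by
    rw [← hquarter x, ← hquarter y, mul_smul_comm, mul_smul_comm, h]
  refine h4inj _ _ ?_
  rw [formalStar_quadForm hΛ.homogeneous hflat hA hμ, hs1, hs2, mul_add, hquarter, hE',
    MvPowerSeries.smul_eq_C_mul, MvPowerSeries.smul_eq_C_mul, h4, hg]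
  set N := MvPowerSeries.C (σ := Fin (n + 1)) ν
  set M := MvPowerSeries.C (σ := Fin (n + 1)) μ
  set T := φ (lambdaMul Λ A * tanhMatrix Λ A).trace
  set Q := φ (quadForm (constMatrix ℂ A * (tanhMatrix Λ A * tanhMatrix Λ A)))
  -- `h5` trades the Euler derivative of `D` for the trace, and `hMN` cancels the products `μ ν`.
  linear_combination 2 * E * h5 + (4 * N * φ D * E * Q + 2 * φ D * E * T) * hMN

end StaticEquation

/-! ### Supports of coordinates and quadratic forms -/

section Support

variable {σ R S : Type*} [CommRing R] [CommRing S]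

lemma supportedIn_X (a : σ) : SupportedIn {1} (MvPowerSeries.X a : MvPowerSeries σ R) := by
  classical
  intro d hd
  rw [MvPowerSeries.coeff_X] at hd
  have : d = Finsupp.single a 1 := by by_contra h; simp [h] at hd
  simp [this]

lemma SupportedIn.map {s : Set ℤ} {f : MvPowerSeries σ R} (hf : SupportedIn s f) (φ : R →+* S) :
    SupportedIn s (MvPowerSeries.map φ f) := by
  intro d hd
  refine hf d fun h => hd ?_
  rw [MvPowerSeries.coeff_map, h, map_zero]

lemma supportedIn_quadForm {n : ℕ} {s : Set ℤ}
    {M : Matrix (Fin (n + 1)) (Fin (n + 1)) (MvPowerSeries (Fin (n + 1)) R)}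
    (hM : ∀ i j, SupportedIn s (M i j)) : SupportedIn {x | x - 2 ∈ s} (quadForm M) := by
  refine SupportedIn.sum fun i _ => SupportedIn.sum fun j _ =>
    (((supportedIn_X i).mul (hM i j)).mul (supportedIn_X j)).mono ?_
  rintro _ ⟨_, ⟨_, rfl, x, hx, rfl⟩, _, rfl, rfl⟩
  simpa [add_sub_assoc, add_comm] using (by ring_nf; exact hx : (1 + x + 1 - 2 : ℤ) ∈ s)

end Support

/-! ### Scaling of the coordinates -/

section Rescale

open Matrix

variable {n : ℕ} {Λ : Bivector n} {A : Matrix (Fin (n + 1)) (Fin (n + 1)) ℂ}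

lemma rescale_eq_smul_of_supportedIn {σ R : Type*} [CommRing R] {k : ℕ} {f : MvPowerSeries σ R}
    (hf : SupportedIn {(k : ℤ)} f) (s : R) :
    MvPowerSeries.rescale (fun _ => s) f = s ^ k • f := by
  ext d
  rw [coeff_rescale_const, MvPowerSeries.coeff_smul]
  by_cases h : (d.degree : ℤ) ∈ ({(k : ℤ)} : Set ℤ)
  · rw [Nat.cast_injective (R := ℤ) (Set.mem_singleton_iff.1 h)]
  · rw [hf.coeff_eq_zero h, mul_zero, mul_zero]

lemma rescale_map {σ R S : Type*} [CommRing R] [CommRing S] (φ : R →+* S) (s : R)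
    (f : MvPowerSeries σ R) : MvPowerSeries.rescale (fun _ => φ s) (MvPowerSeries.map φ f) =
      MvPowerSeries.map φ (MvPowerSeries.rescale (fun _ => s) f) := by
  ext d
  rw [coeff_rescale_const, MvPowerSeries.coeff_map, MvPowerSeries.coeff_map, coeff_rescale_const,
    map_mul, map_pow]

lemma rescale_subst {σ K : Type*} [CommRing K] [Algebra ℂ K] {f : MvPowerSeries σ K}
    (hf : SupportedIn {x | 1 ≤ x} f) (c : PowerSeries ℂ) (s : K) :
    MvPowerSeries.rescale (fun _ => s) (c.subst f) =
      c.subst (MvPowerSeries.rescale (fun _ => s) f) := by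
  ext d
  rw [coeff_rescale_const, coeff_subst_eq_sum hf c d.degree.lt_succ_self,
    coeff_subst_eq_sum (hf.rescale s) c d.degree.lt_succ_self, map_sum, map_sum, Finset.mul_sum]
  refine Finset.sum_congr rfl fun k _ => ?_
  rw [← map_pow]
  change s ^ d.degree * (PowerSeries.coeff k c • MvPowerSeries.coeff d (f ^ k)) =
    PowerSeries.coeff k c • MvPowerSeries.coeff d (MvPowerSeries.rescale (fun _ => s) (f ^ k))
  rw [coeff_rescale_const, mul_smul_comm]

lemma lambdaMul_smul (t : ℂ) : lambdaMul Λ (t • A) = t • lambdaMul Λ A := by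
  have h : constMatrix ℂ (t • A) = t • constMatrix ℂ A := by
    refine Matrix.ext fun i j => ?_
    simp [constMatrix, MvPowerSeries.smul_eq_C_mul]
  rw [lambdaMul, h, Matrix.mul_smul, lambdaMul]

lemma map_rescale_lambdaMul (hΛ : ∀ a b, (Λ a b).IsHomogeneous 2) (s : ℂ) :
    (lambdaMul Λ A).map (MvPowerSeries.rescale fun _ => s) = lambdaMul Λ (s ^ 2 • A) := by
  rw [lambdaMul_smul]
  refine Matrix.ext fun i j => ?_
  exact rescale_eq_smul_of_supportedIn (k := 2) (supportedIn_lambdaMul hΛ i j) s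

lemma map_rescale_coshMatrix (hΛ : ∀ a b, (Λ a b).IsHomogeneous 2) (s : ℂ) :
    (coshMatrix Λ A).map (MvPowerSeries.rescale fun _ => s) = coshMatrix Λ (s ^ 2 • A) := by
  rw [coshMatrix_eq hΛ, coshMatrix_eq hΛ, map_rescale_matrixValue (hasNoConstantTerm_lambdaMul hΛ),
    map_rescale_lambdaMul hΛ]

/-- `Z ↦ s Z` multiplies the quadratic matrix `ΛA` by `s²`, and the two outer coordinates supply the
`s²` for the leading factor `A`. -/
lemma rescale_quadForm_phaseMatrix (hΛ : ∀ a b, (Λ a b).IsHomogeneous 2) (s : ℂ) :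
    MvPowerSeries.rescale (fun _ => s) (quadForm (phaseMatrix Λ A)) =
      quadForm (phaseMatrix Λ (s ^ 2 • A)) := by
  have h : phaseMatrix Λ (s ^ 2 • A) =
      s ^ 2 • (phaseMatrix Λ A).map (MvPowerSeries.rescale fun _ => s) := by
    have h1 : (constMatrix ℂ A).map (MvPowerSeries.rescale (σ := Fin (n + 1)) fun _ => s) =
        constMatrix ℂ A := by
      refine Matrix.ext fun i j => ?_
      exact (rescale_eq_smul_of_supportedIn (k := 0)
        (supportedIn_C (algebraMap ℂ ℂ (A i j))) s).trans (by rw [pow_zero, one_smul]; rfl)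
    have h2 : constMatrix ℂ (s ^ 2 • A) = s ^ 2 • constMatrix ℂ A := by
      refine Matrix.ext fun i j => ?_
      simp [constMatrix, MvPowerSeries.smul_eq_C_mul]
    rw [phaseMatrix_eq, phaseMatrix_eq, Matrix.map_mul, h1,
      map_rescale_matrixValue (hasNoConstantTerm_lambdaMul hΛ), map_rescale_lambdaMul hΛ, h2,
      Matrix.smul_mul]
  have hX : ∀ i : Fin (n + 1), MvPowerSeries.rescale (fun _ => s)
      (MvPowerSeries.X i : MvPowerSeries (Fin (n + 1)) ℂ) = s • MvPowerSeries.X i := fun i => by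
    simpa using rescale_eq_smul_of_supportedIn (k := 1) (supportedIn_X i) s
  simp only [h, quadForm, map_sum, map_mul, hX, Matrix.smul_apply, map_apply,
    MvPowerSeries.smul_eq_C_mul, map_pow]
  exact Finset.sum_congr rfl fun i _ => Finset.sum_congr rfl fun j _ => by ring

lemma IsInvSqrt.rescale (hΛ : ∀ a b, (Λ a b).IsHomogeneous 2) {D : MvPowerSeries (Fin (n + 1)) ℂ}
    (hD : IsInvSqrt D (coshMatrix Λ A).det) (s : ℂ) :
    IsInvSqrt (MvPowerSeries.rescale (fun _ => s) D) (coshMatrix Λ (s ^ 2 • A)).det := by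
  constructor
  · rw [← MvPowerSeries.coeff_zero_eq_constantCoeff_apply, coeff_rescale_const, map_zero, pow_zero,
      one_mul, MvPowerSeries.coeff_zero_eq_constantCoeff_apply, hD.1]
  · rw [← map_rescale_coshMatrix hΛ, ← RingHom.mapMatrix_apply, ← RingHom.map_det, ← map_pow,
      ← map_mul, hD.2, map_one]

lemma supportedIn_phase (Q : Matrix (Fin (n + 1)) (Fin (n + 1)) (MvPowerSeries (Fin (n + 1)) ℂ)) :
    SupportedIn {x | 1 ≤ x} (muInv • toMu (quadForm Q)) := by
  refine (((supportedIn_quadForm fun i j => SupportedIn.nonneg (Q i j)).map _).smul muInv).mono ?_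
  intro x hx
  simp only [Set.mem_ofPred_eq] at hx ⊢
  omega

/-- `det^{-1/2} (cosh ΛA) exp ((1/μ) (Λ⁻¹ tanh ΛA)[Z])`, with `D` as the first factor. -/
def closedForm (Λ : Bivector n) (A : Matrix (Fin (n + 1)) (Fin (n + 1)) ℂ)
    (D : MvPowerSeries (Fin (n + 1)) ℂ) : MvPowerSeries (Fin (n + 1)) ℂ[T;T⁻¹] :=
  toMu D * expQuad (phaseMatrix Λ A)

lemma rescale_closedForm (hΛ : ∀ a b, (Λ a b).IsHomogeneous 2) (D : MvPowerSeries (Fin (n + 1)) ℂ)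
    (s : ℂ) : MvPowerSeries.rescale (fun _ => algebraMap ℂ ℂ[T;T⁻¹] s) (closedForm Λ A D) =
      closedForm Λ (s ^ 2 • A) (MvPowerSeries.rescale (fun _ => s) D) := by
  rw [closedForm, map_mul, expQuad, rescale_subst (supportedIn_phase _), toMu, rescale_map,
    MvPowerSeries.smul_eq_C_mul, map_mul, toMu, rescale_map, rescale_quadForm_phaseMatrix hΛ,
    rescale_eq_smul_of_supportedIn (k := 0) (supportedIn_C muInv), pow_zero, one_smul,
    ← MvPowerSeries.smul_eq_C_mul]
  rfl

/-- The scaling `s = -1` leaves `A` unchanged because `s² = 1`, and `D` by uniqueness of the inverse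
square root; so the closed form is even. -/
lemma coeff_closedForm_eq_zero_of_odd (hΛ : ∀ a b, (Λ a b).IsHomogeneous 2)
    {D : MvPowerSeries (Fin (n + 1)) ℂ} (hD : IsInvSqrt D (coshMatrix Λ A).det)
    {d : Fin (n + 1) →₀ ℕ} (hd : Odd d.degree) :
    MvPowerSeries.coeff d (closedForm Λ A D) = 0 := by
  have hD' := hD.rescale hΛ (-1)
  have h := rescale_closedForm (A := A) hΛ D (-1)
  rw [neg_one_sq, one_smul] at hD' h
  rw [hD'.unique hD] at h
  have h1 := congrArg (MvPowerSeries.coeff d) h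
  rw [coeff_rescale_const, map_neg, map_one, hd.neg_one_pow, neg_one_mul] at h1
  have h2 : (2 : ℂ) • MvPowerSeries.coeff d (closedForm Λ A D) = 0 := by
    rw [two_smul]
    nth_rewrite 1 [← h1]
    exact neg_add_cancel _
  have h3 := congrArg (fun p => (1 / 2 : ℂ) • p) h2
  simpa [smul_smul] using h3

lemma coeff_zero_closedForm {D : MvPowerSeries (Fin (n + 1)) ℂ}
    (hD : MvPowerSeries.constantCoeff D = 1) :
    MvPowerSeries.coeff 0 (closedForm Λ A D) = 1 := by
  have h := coeff_subst_eq_sum (supportedIn_phase (phaseMatrix Λ A)) (PowerSeries.exp ℂ) (N := 1)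
    (d := 0) (by simp)
  rw [Finset.sum_range_one, pow_zero, PowerSeries.coeff_zero_eq_constantCoeff_apply,
    PowerSeries.constantCoeff_exp, one_smul, MvPowerSeries.coeff_zero_one] at h
  rw [closedForm, MvPowerSeries.coeff_zero_eq_constantCoeff_apply, map_mul,
    ← MvPowerSeries.coeff_zero_eq_constantCoeff_apply,
    ← MvPowerSeries.coeff_zero_eq_constantCoeff_apply, expQuad, h, toMu, MvPowerSeries.coeff_map,
    MvPowerSeries.coeff_zero_eq_constantCoeff_apply, hD, map_one, mul_one]

end Rescale

/-! ### The evolution equation -/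

section Evolution

variable {n : ℕ} {Λ : Bivector n} {A : Matrix (Fin (n + 1)) (Fin (n + 1)) ℂ}

/-- The action of the time `t`: a form of degree `2 k` is multiplied by `t ^ k`. -/
def timeScale {σ K : Type*} [CommRing K] [Algebra ℂ K] (t : ℂ) (f : MvPowerSeries σ K) :
    MvPowerSeries σ K :=
  fun d => t ^ (d.degree / 2) • MvPowerSeries.coeff d f

lemma coeff_timeScale {σ K : Type*} [CommRing K] [Algebra ℂ K] (t : ℂ) (f : MvPowerSeries σ K)
    (d : σ →₀ ℕ) : MvPowerSeries.coeff d (timeScale t f) =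
      t ^ (d.degree / 2) • MvPowerSeries.coeff d f := rfl

/-- In degree `2 k` both sides scale by `s^{2k}`. In odd degree, where the rounding in `d.degree /
2` would matter, the closed form vanishes. The exponent `d.degree / 2` makes the solution polynomial
in `t` in each degree, with no choice of a square root. -/
lemma timeScale_closedForm (hΛ : ∀ a b, (Λ a b).IsHomogeneous 2)
    {D : MvPowerSeries (Fin (n + 1)) ℂ} (hD : IsInvSqrt D (coshMatrix Λ A).det) (s : ℂ) :
    timeScale (s ^ 2) (closedForm Λ A D) =
      closedForm Λ (s ^ 2 • A) (MvPowerSeries.rescale (fun _ => s) D) := by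
  rw [← rescale_closedForm hΛ]
  ext1 d
  rw [coeff_timeScale, coeff_rescale_const, ← map_pow, ← Algebra.smul_def, ← pow_mul]
  rcases Nat.even_or_odd d.degree with h | h
  · rw [Nat.two_mul_div_two_of_even h]
  · rw [coeff_closedForm_eq_zero_of_odd hΛ hD h, smul_zero, smul_zero]

lemma supportedIn_quadForm_constMatrix (K : Type*) [CommRing K] [Algebra ℂ K]
    (A : Matrix (Fin (n + 1)) (Fin (n + 1)) ℂ) (ν : K) :
    SupportedIn {2} (ν • quadForm (constMatrix K A)) := by
  refine ((supportedIn_quadForm fun i j => supportedIn_C (algebraMap ℂ K (A i j))).smul ν).mono ?_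
  intro x hx
  simp only [Set.mem_ofPred_eq, Set.mem_singleton_iff] at hx ⊢
  omega

lemma formalStar_sub_right {K : Type*} [CommRing K] [Algebra ℂ K] (hΛ : IsHolomorphicPoisson Λ)
    (hflat : IsFlatBivector Λ) (μ : K) (f g h : MvPowerSeries (Fin (n + 1)) K) :
    formalStar Λ μ f (g - h) = formalStar Λ μ f g - formalStar Λ μ f h := by
  have := (isAssociativeProduct_formalStar μ hΛ.homogeneous hflat).add_right f (g - h) h
  rw [sub_add_cancel] at this
  rw [this, add_sub_cancel_right]

lemma mu_mul_muInv : mu * muInv = 1 := by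
  rw [mu, muInv, ← LaurentPolynomial.T_add]
  simp

/-- Star multiplication by the quadratic form raises degrees by exactly two, so the coefficient at
`d` sees only degree `d.degree - 2`, where time acts by a single power of `t`. The stationary
equation then supplies the factor `d.degree / 2`. -/
lemma coeff_formalStar_timeScale (hΛ : IsHolomorphicPoisson Λ) (hflat : IsFlatBivector Λ)
    (hA : A.IsSymm) {D : MvPowerSeries (Fin (n + 1)) ℂ} (hD : IsInvSqrt D (coshMatrix Λ A).det)
    (t : ℂ) (d : Fin (n + 1) →₀ ℕ) :
    MvPowerSeries.coeff d (formalStar Λ mu (muInv • quadForm (constMatrix ℂ[T;T⁻¹] A))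
      (timeScale t (closedForm Λ A D))) =
      (((d.degree / 2 : ℕ) : ℂ) * t ^ (d.degree / 2 - 1)) •
        MvPowerSeries.coeff d (closedForm Λ A D) := by
  set q := muInv • quadForm (constMatrix ℂ[T;T⁻¹] A)
  set g := closedForm Λ A D
  have hq : SupportedIn {2} q := supportedIn_quadForm_constMatrix _ A muInv
  rcases lt_or_ge d.degree 2 with hlt | hge
  -- Below degree two both sides vanish: the factor `d.degree / 2` is zero, so the truncated
  -- exponent is harmless.
  · rw [(SupportedIn.formalStar mu hΛ.homogeneous hq
      (SupportedIn.nonneg (timeScale t g))).coeff_eq_zero, Nat.div_eq_of_lt hlt, Nat.cast_zero,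
      zero_mul, zero_smul]
    simp only [Set.mem_ofPred_eq]
    omega
  -- In degree `d.degree - 2` the scaled series is a constant multiple of `g`; what is left over
  -- lies in other degrees and cannot reach `d`.
  · have hs : SupportedIn {x | x ≠ (d.degree : ℤ) - 2}
        (timeScale t g - algebraMap ℂ ℂ[T;T⁻¹] (t ^ (d.degree / 2 - 1)) • g) := by
      intro e he h
      refine he ?_
      have h' : e.degree / 2 = d.degree / 2 - 1 := by omega
      rw [map_sub, coeff_timeScale, MvPowerSeries.coeff_smul, h', Algebra.smul_def, sub_self]
    have h0 := (SupportedIn.formalStar mu hΛ.homogeneous hq hs).coeff_eq_zero (d := d) (by simp)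
    have hstat : halfEuler (Fin (n + 1)) ℂ[T;T⁻¹] g = formalStar Λ mu q g :=
      halfEuler_eq_formalStar hΛ hflat hA mu_mul_muInv hD (supportedIn_phase _) rfl
    rw [formalStar_sub_right hΛ hflat,
      (isAssociativeProduct_formalStar mu hΛ.homogeneous hflat).smul_right, ← hstat, map_sub,
      sub_eq_zero, MvPowerSeries.coeff_smul, coeff_halfEuler, ← Algebra.smul_def, smul_smul] at h0
    rw [h0]
    rcases Nat.even_or_odd d.degree with h | h
    · congr 1
      rw [Nat.cast_div h.two_dvd two_ne_zero, mul_comm]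
      simp
    · rw [coeff_closedForm_eq_zero_of_odd hΛ.homogeneous hD h, smul_zero, smul_zero]

theorem isStarExponential_timeScale (hΛ : IsHolomorphicPoisson Λ) (hflat : IsFlatBivector Λ)
    (hA : A.IsSymm) {D : MvPowerSeries (Fin (n + 1)) ℂ} (hD : IsInvSqrt D (coshMatrix Λ A).det) :
    IsStarExponential Λ A fun t => timeScale t (closedForm Λ A D) := by
  constructor
  · ext1 d
    rw [coeff_timeScale]
    -- At `t = 0` the convention `0 ^ 0 = 1` keeps degrees zero and one; parity removes degree one.
    rcases Nat.lt_or_ge d.degree 2 with h | h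
    · rw [Nat.div_eq_of_lt h, pow_zero, one_smul]
      by_cases h0 : d = 0
      · rw [h0, coeff_zero_closedForm hD.1, MvPowerSeries.coeff_zero_one]
      · have h1 : d.degree ≠ 0 := fun h => h0 ((Finsupp.degree_eq_zero_iff d).1 h)
        rw [coeff_closedForm_eq_zero_of_odd hΛ.homogeneous hD (by
          rw [show d.degree = 1 by omega]; exact odd_one)]
        classical
        rw [MvPowerSeries.coeff_one, if_neg h0]
    · have h0 : d ≠ 0 := by rintro rfl; simp at h
      classical
      rw [zero_pow (by omega), zero_smul, MvPowerSeries.coeff_one, if_neg h0]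
  · intro t d m
    rw [coeff_formalStar_timeScale hΛ hflat hA hD]
    have h := (hasDerivAt_pow (d.degree / 2) t).mul_const
      ((MvPowerSeries.coeff d (closedForm Λ A D)).coeff m)
    exact h

/-- Induction on the degree: the time derivative in degree `N` involves only degree `N - 2` of the
solution. Two solutions then have coefficients with equal derivatives and equal initial values. -/
theorem IsStarExponential.unique (hΛ : IsHolomorphicPoisson Λ) (hflat : IsFlatBivector Λ)
    {F F' : ℂ → MvPowerSeries (Fin (n + 1)) ℂ[T;T⁻¹]} (hF : IsStarExponential Λ A F)
    (hF' : IsStarExponential Λ A F') : F = F' := by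
  have key : ∀ (N : ℕ) (d : Fin (n + 1) →₀ ℕ), d.degree = N → ∀ t,
      MvPowerSeries.coeff d (F t) = MvPowerSeries.coeff d (F' t) := by
    intro N
    induction N using Nat.strong_induction_on with
    | _ N ih =>
    intro d hd t
    have hstar : ∀ t, MvPowerSeries.coeff d (formalStar Λ mu
        (muInv • quadForm (constMatrix ℂ[T;T⁻¹] A)) (F t)) = MvPowerSeries.coeff d
        (formalStar Λ mu (muInv • quadForm (constMatrix ℂ[T;T⁻¹] A)) (F' t)) := by
      intro t
      have hs : SupportedIn {x | (N : ℤ) ≤ x} (F t - F' t) := by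
        intro e he
        by_contra hlt
        simp only [Set.mem_ofPred_eq, not_le, Nat.cast_lt] at hlt
        exact he (by rw [map_sub, ih _ hlt e rfl t, sub_self])
      have h := (SupportedIn.formalStar mu hΛ.homogeneous
        (supportedIn_quadForm_constMatrix _ A muInv) hs).coeff_eq_zero (d := d)
        (by simp only [Set.mem_ofPred_eq]; omega)
      rwa [formalStar_sub_right hΛ hflat, map_sub, sub_eq_zero] at h
    ext m
    have hder : ∀ t, HasDerivAt (fun s => (MvPowerSeries.coeff d (F s)).coeff m -
        (MvPowerSeries.coeff d (F' s)).coeff m) 0 t := fun t => by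
      have h := (hF.2 t d m).sub (hF'.2 t d m)
      rw [hstar t, sub_self] at h
      exact h
    have hconst := is_const_of_deriv_eq_zero (fun t => (hder t).differentiableAt)
      (fun t => (hder t).deriv) t 0
    simpa [hF.1, hF'.1, sub_eq_zero] using hconst
  funext t
  ext1 d
  exact key _ d rfl t

end Evolution

end StarProduct

end

/-! ### The theorem for the family `τ • Λ` -/

theorem theorem3 (n : ℕ) (Λ : StarProduct.Bivector n)
    (hΛ : StarProduct.IsHolomorphicPoisson Λ) (hrel : StarProduct.LambdaRelation Λ) (τ : ℂ) :
    -- the family of Poisson structures and its quantization on sections and germs over `ℂP^n`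
    StarProduct.IsHolomorphicPoisson (τ • Λ) ∧
    (∀ S : Set (Projectivization ℂ (Fin (n + 1) → ℂ)),
      StarProduct.IsSymbolCalculus (τ • Λ) S (StarProduct.sectionStar (τ • Λ))) ∧
    -- the product on polynomials and their formal sums, with `μ` formal or specialized
    (∀ (K : Type) [CommRing K] [Algebra ℂ K] (μ : K),
      StarProduct.IsAssociativeProduct K
        (StarProduct.formalStar (τ • Λ) μ :
          MvPowerSeries (Fin (n + 1)) K → MvPowerSeries (Fin (n + 1)) K →
            MvPowerSeries (Fin (n + 1)) K) ∧
      ∀ (i j : ℕ) (p q : MvPolynomial (Fin (n + 1)) K), p.IsHomogeneous i → q.IsHomogeneous j →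
        ∃ r : MvPolynomial (Fin (n + 1)) K, r.IsHomogeneous (i + j) ∧
          (r : MvPowerSeries (Fin (n + 1)) K) =
            StarProduct.formalStar (τ • Λ) μ (p : MvPowerSeries (Fin (n + 1)) K) q) ∧
    -- existence, uniqueness and closed form of the star exponentials
    ∀ A : Matrix (Fin (n + 1)) (Fin (n + 1)) ℂ, A.IsSymm →
      (StarProduct.lambdaMatrix (τ • Λ) * StarProduct.phaseMatrix (τ • Λ) A =
        (1 / Complex.I) • StarProduct.matrixValue StarProduct.tanSeries
          (Complex.I • (StarProduct.lambdaMatrix (τ • Λ) * StarProduct.constMatrix ℂ A))) ∧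
      ∃ F : ℂ → MvPowerSeries (Fin (n + 1)) (LaurentPolynomial ℂ),
        StarProduct.IsStarExponential (τ • Λ) A F ∧
        (∀ F', StarProduct.IsStarExponential (τ • Λ) A F' → F' = F) ∧
        ∀ t : ℂ, ∃ D : MvPowerSeries (Fin (n + 1)) ℂ,
          StarProduct.IsInvSqrt D (StarProduct.coshMatrix (τ • Λ) (t • A)).det ∧
          F t = StarProduct.toMu D *
            StarProduct.expQuad (StarProduct.phaseMatrix (τ • Λ) (t • A)) := by
  have hΛ' := hΛ.smul τ
  -- Flatness is derived for `Λ` and then scaled, so the arrow relation is never needed for `τ • Λ`.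
  have hflat := (hΛ.isFlatBivector hrel).smul τ
  refine ⟨hΛ', fun S => StarProduct.isSymbolCalculus_sectionStar hΛ'.homogeneous hflat S, ?_, ?_⟩
  · intro K _ _ μ
    exact ⟨StarProduct.isAssociativeProduct_formalStar μ hΛ'.homogeneous hflat,
      fun i j p q hp hq => StarProduct.exists_isHomogeneous_formalStar μ hΛ'.homogeneous hp hq⟩
  · intro A hA
    refine ⟨StarProduct.lambdaMatrix_mul_phaseMatrix_eq_tan hΛ'.homogeneous, ?_⟩
    obtain ⟨D, hD⟩ := StarProduct.exists_isInvSqrt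
      (StarProduct.constantCoeff_det_coshMatrix (A := A) hΛ'.homogeneous)
    have hexp := StarProduct.isStarExponential_timeScale hΛ' hflat hA hD
    refine ⟨_, hexp, fun F' hF' => hF'.unique hΛ' hflat hexp, fun t => ?_⟩
    -- Every complex `t` is a square, `t = 0` included; scaling the coordinates by the root gives
    -- the formula for `t • A`.
    obtain ⟨s, rfl⟩ := IsAlgClosed.exists_pow_nat_eq t two_pos
    exact ⟨_, hD.rescale hΛ'.homogeneous s, StarProduct.timeScale_closedForm hΛ'.homogeneous hD s⟩
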